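/- A finite simple graph is *outerplanar* if it has a planar straight-line drawing in which all vertices are incident with the outer face, and *maximal outerplanar* if moreover no edge can be added between its vertices without destroying outerplanarity. For a planar straight-line drawing $\Gamma$ let $\rho(\Gamma)$ be the ratio of the longest to the shortest edge length of $\Gamma$ (for a graph without edges, $\rho(\Gamma)=0$). The *planar edge-length ratio* of a graph $G$ is the infimum of $\rho(\Gamma)$ over all planar straight-line drawings $\Gamma$ of $G$. **Theorem.** 1. Every outerplanar graph has a planar straight-line drawing $\Gamma$ with $\rho(\Gamma)<2$; hence its planar edge-length ratio is strictly less than $2$. 2. For maximal outerplanar graphs such a drawing is computable in linear time: there are a fixed real RAM program (unit-cost exact real arithmetic $+,-,\times,/,\sqrt{\cdot}$ and comparisons, and integer arrays with indirect addressing, addition and subtraction) and a constant $C$ such that, for every maximal outerplanar graph $G$ with $n\ge 2$ vertices, given as a doubly-connected edge list of an outerplanar embedding of $G$, the program halts after at most $Cn$ operations and outputs the vertex coordinates of a planar straight-line drawing $\Gamma$ of $G$ with $\rho(\Gamma)<2$. 3. The bound $2$ is tight: for every real $\varepsilon>0$ there is a $k\ge 0$ such that the fan with pendant triangles $F_k$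 is maximal outerplanar and has planar edge-length ratio greater than $2-\varepsilon$. Here $F_k$ consists of a path with $k+2$ vertices, a hub adjacent to all vertices of the path, and, for each of the $k+1$ edges of the path, one further vertex adjacent to exactly the two ends of that edge. -/

import Mathlib

open scoped ENNReal

/-! ## Planar straight-line drawings and outerplanar graphs -/

/-- The Euclidean plane. -/
abbrev Plane : Type := EuclideanSpace ℝ (Fin 2)

/-- `p` gives the vertex positions of a planar straight-line drawing of `G`: distinct vertices are
distinct points, an edge passes through no vertex other than its ends, and two distinct edges
meet in common endpoints only. -/
structure IsPlanarDrawing {V : Type*} (G : SimpleGraph V) (p : V → Plane) : Prop where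
  injective : Function.Injective p
  vertex_edge : ∀ u v w, G.Adj u v → p w ∈ segment ℝ (p u) (p v) → w = u ∨ w = v
  edge_edge : ∀ u v x y, G.Adj u v → G.Adj x y → s(u, v) ≠ s(x, y) →
    segment ℝ (p u) (p v) ∩ segment ℝ (p x) (p y) ⊆ p '' ({u, v} ∩ {x, y})

/-- The point set covered by the drawing: all vertices and all edges. -/
def drawingSet {V : Type*} (G : SimpleGraph V) (p : V → Plane) : Set Plane :=
  Set.range p ∪ ⋃ (u : V) (v : V) (_ : G.Adj u v), segment ℝ (p u) (p v)

/-- The outer face of the drawing: the unbounded part of the complement, that is, the points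
whose connected component in the complement of the drawing is unbounded. -/
def outerFace {V : Type*} (G : SimpleGraph V) (p : V → Plane) : Set Plane :=
  {x | x ∈ (drawingSet G p)ᶜ ∧ ¬ Bornology.IsBounded (connectedComponentIn (drawingSet G p)ᶜ x)}

/-- A (finite) graph is outerplanar if it has a planar straight-line drawing in which every vertex
is incident with the outer face. -/
def IsOuterplanar {V : Type*} (G : SimpleGraph V) : Prop :=
  ∃ p : V → Plane, IsPlanarDrawing G p ∧ ∀ v, p v ∈ closure (outerFace G p)

/-- An outerplanar graph is maximal outerplanar if no edge can be added between its vertices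
without destroying outerplanarity. -/
def IsMaximalOuterplanar {V : Type*} (G : SimpleGraph V) : Prop :=
  Maximal IsOuterplanar G

/-! ## Edge-length ratios -/

/-- The ratio of the longest to the shortest edge length of a drawing, as the largest quotient of
two edge lengths (it is `0` when there are no edges). -/
noncomputable def drawingRatio {V : Type*} (G : SimpleGraph V) (p : V → Plane) : ℝ≥0∞ :=
  ⨆ (u : V) (v : V) (_ : G.Adj u v) (x : V) (y : V) (_ : G.Adj x y),
    edist (p u) (p v) / edist (p x) (p y)

/-- The planar edge-length ratio of `G`: the infimum of the ratios of all its planar straight-line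
drawings (it is `∞` when there are none). -/
noncomputable def planarEdgeLengthRatio {V : Type*} (G : SimpleGraph V) : ℝ≥0∞ :=
  ⨅ (p : V → Plane) (_ : IsPlanarDrawing G p), drawingRatio G p

/-! ## Fans with pendant triangles -/

/-- Vertices of the fan with pendant triangles: the hub, `k + 2` path vertices, and `k + 1`
apexes of pendant triangles. -/
inductive PendantFanVertex (k : ℕ) : Type
  | hub : PendantFanVertex k
  | rim (i : Fin (k + 2)) : PendantFanVertex k
  | apex (i : Fin (k + 1)) : PendantFanVertex k

/-- The hub is joined to all vertices of the path `rim 0, …, rim (k + 1)`, and `apex i` is joined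
to both ends of the `i`-th path edge. -/
def pendantFan (k : ℕ) : SimpleGraph (PendantFanVertex k) :=
  SimpleGraph.fromRel fun a b =>
    match a, b with
    | .hub, .rim _ => True
    | .rim i, .rim j => (i : ℕ) + 1 = j
    | .apex i, .rim j => j = i.castSucc ∨ j = i.succ
    | _, _ => False

/-! ## The real RAM

A program works on finitely many unbounded arrays of natural numbers and finitely many unbounded
arrays of real numbers; arrays and their cells are numbered by natural numbers. -/

namespace RealRAM

/-- Memory: cell `i` of the array `a` of natural numbers, respectively of real numbers. -/
structure Memory where
  nat : ℕ → ℕ → ℕ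
  real : ℕ → ℕ → ℝ

namespace Memory

/-- Store `x` in cell `i` of the array `a` of natural numbers. -/
def setNat (s : Memory) (a i x : ℕ) : Memory :=
  { s with nat := Function.update s.nat a (Function.update (s.nat a) i x) }

/-- Store `x` in cell `i` of the array `a` of real numbers. -/
noncomputable def setReal (s : Memory) (a i : ℕ) (x : ℝ) : Memory :=
  { s with real := Function.update s.real a (Function.update (s.real a) i x) }

end Memory

/-- Expressions of natural-number type: constants, array access (with indirect addressing),
addition and truncated subtraction. -/
inductive NatExpr : Type
  | const (c : ℕ)
  | get (a : ℕ) (i : NatExpr)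
  | add (e e' : NatExpr)
  | sub (e e' : NatExpr)

/-- Expressions of real type: rational constants, array access, exact arithmetic, square root. -/
inductive RealExpr : Type
  | const (q : ℚ)
  | get (a : ℕ) (i : NatExpr)
  | add (e e' : RealExpr)
  | sub (e e' : RealExpr)
  | mul (e e' : RealExpr)
  | div (e e' : RealExpr)
  | sqrt (e : RealExpr)

/-- Comparisons. -/
inductive Test : Type
  | natEq (e e' : NatExpr)
  | natLt (e e' : NatExpr)
  | realLt (e e' : RealExpr)
  | not (b : Test)

/-- Programs. -/
inductive Program : Type
  | skip
  | setNat (a : ℕ) (i e : NatExpr)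
  | setReal (a : ℕ) (i : NatExpr) (e : RealExpr)
  | seq (P Q : Program)
  | cond (b : Test) (P Q : Program)
  | loop (b : Test) (P : Program)

/-- Value of an expression. -/
def NatExpr.eval (s : Memory) : NatExpr → ℕ
  | const c => c
  | get a i => s.nat a (i.eval s)
  | add e e' => e.eval s + e'.eval s
  | sub e e' => e.eval s - e'.eval s

/-- Number of operations needed to evaluate an expression. -/
def NatExpr.cost : NatExpr → ℕ
  | const _ => 1
  | get _ i => i.cost + 1
  | add e e' => e.cost + e'.cost + 1
  | sub e e' => e.cost + e'.cost + 1

/-- Value of an expression. -/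
noncomputable def RealExpr.eval (s : Memory) : RealExpr → ℝ
  | const q => (q : ℝ)
  | get a i => s.real a (i.eval s)
  | add e e' => e.eval s + e'.eval s
  | sub e e' => e.eval s - e'.eval s
  | mul e e' => e.eval s * e'.eval s
  | div e e' => e.eval s / e'.eval s
  | sqrt e => Real.sqrt (e.eval s)

/-- Number of operations needed to evaluate an expression. -/
def RealExpr.cost : RealExpr → ℕ
  | const _ => 1
  | get _ i => i.cost + 1
  | add e e' => e.cost + e'.cost + 1
  | sub e e' => e.cost + e'.cost + 1
  | mul e e' => e.cost + e'.cost + 1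
  | div e e' => e.cost + e'.cost + 1
  | sqrt e => e.cost + 1

/-- Truth of a comparison. -/
def Test.holds (s : Memory) : Test → Prop
  | natEq e e' => e.eval s = e'.eval s
  | natLt e e' => e.eval s < e'.eval s
  | realLt e e' => e.eval s < e'.eval s
  | not b => ¬ b.holds s

/-- Number of operations needed to evaluate a comparison. -/
def Test.cost : Test → ℕ
  | natEq e e' => e.cost + e'.cost + 1
  | natLt e e' => e.cost + e'.cost + 1
  | realLt e e' => e.cost + e'.cost + 1
  | not b => b.cost + 1

/-- `Exec P s t s'`: started in memory `s`, the program `P` halts after exactly `t` unit-cost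
operations in memory `s'`. -/
inductive Exec : Program → Memory → ℕ → Memory → Prop
  | skip (s : Memory) : Exec .skip s 1 s
  | setNat (s : Memory) (a : ℕ) (i e : NatExpr) :
      Exec (.setNat a i e) s (i.cost + e.cost + 1) (s.setNat a (i.eval s) (e.eval s))
  | setReal (s : Memory) (a : ℕ) (i : NatExpr) (e : RealExpr) :
      Exec (.setReal a i e) s (i.cost + e.cost + 1) (s.setReal a (i.eval s) (e.eval s))
  | seq {P Q : Program} {s s' s'' : Memory} {t t' : ℕ} :
      Exec P s t s' → Exec Q s' t' s'' → Exec (.seq P Q) s (t + t') s''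
  | cond_true {b : Test} {P Q : Program} {s s' : Memory} {t : ℕ} :
      b.holds s → Exec P s t s' → Exec (.cond b P Q) s (b.cost + t) s'
  | cond_false {b : Test} {P Q : Program} {s s' : Memory} {t : ℕ} :
      ¬ b.holds s → Exec Q s t s' → Exec (.cond b P Q) s (b.cost + t) s'
  | loop_true {b : Test} {P : Program} {s s' s'' : Memory} {t t' : ℕ} :
      b.holds s → Exec P s t s' → Exec (.loop b P) s' t' s'' →
      Exec (.loop b P) s (b.cost + t + t') s''
  | loop_false {b : Test} {P : Program} {s : Memory} :
      ¬ b.holds s → Exec (.loop b P) s b.cost s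

end RealRAM

/-! ## Doubly-connected edge lists -/

/-- The records of a doubly-connected edge list with `n` vertices, `m` half-edges and `f` faces. -/
structure EdgeList (n m f : ℕ) where
  /-- the vertex at which a half-edge starts -/
  origin : Fin m → Fin n
  /-- the oppositely directed half-edge -/
  twin : Equiv.Perm (Fin m)
  /-- the following half-edge on the boundary of the same face -/
  succ : Equiv.Perm (Fin m)
  /-- the face bounded by a half-edge -/
  face : Fin m → Fin f
  /-- a half-edge starting at a given vertex -/
  vertexEdge : Fin n → Fin m
  /-- a half-edge bounding a given face -/
  faceEdge : Fin f → Fin m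
  /-- the outer face -/
  outer : Fin f

namespace EdgeList

/-- `D` describes an outerplanar combinatorial embedding of the connected graph `G`: half-edges
are the directed edges of `G`, the half-edges starting at a vertex form one cyclic rotation, faces
are the cycles of `succ`, the genus is `0` (by the formula of Euler), and every vertex lies on the
outer face. -/
structure IsOuterplanarEmbedding {n m f : ℕ} (D : EdgeList n m f) (G : SimpleGraph (Fin n)) :
    Prop where
  connected : G.Connected
  twin_twin : ∀ h, D.twin (D.twin h) = h
  adj_iff : ∀ u v, G.Adj u v ↔ ∃ h, D.origin h = u ∧ D.origin (D.twin h) = v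
  ends_injective : ∀ h h', D.origin h = D.origin h' →
    D.origin (D.twin h) = D.origin (D.twin h') → h = h'
  origin_succ : ∀ h, D.origin (D.succ h) = D.origin (D.twin h)
  rotation : ∀ h h', D.origin h = D.origin h' → (D.succ * D.twin).SameCycle h h'
  face_eq_iff : ∀ h h', D.face h = D.face h' ↔ D.succ.SameCycle h h'
  origin_vertexEdge : ∀ v, D.origin (D.vertexEdge v) = v
  face_faceEdge : ∀ i, D.face (D.faceEdge i) = i
  euler : 2 * n + 2 * f = m + 4
  outer_vertex : ∀ v, ∃ h, D.face h = D.outer ∧ D.origin h = v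

/-- The array with entries `g 0, …, g (k - 1)`, followed by zeros. -/
def toArray {k l : ℕ} (g : Fin k → Fin l) (i : ℕ) : ℕ :=
  if h : i < k then (g ⟨i, h⟩ : ℕ) else 0

/-- The memory of a real RAM at the start of a computation with input `D`. Array `0` holds the
three sizes and the outer face; arrays `1` to `7` hold the records. All other cells are `0`. -/
def toMemory {n m f : ℕ} (D : EdgeList n m f) : RealRAM.Memory where
  nat a i :=
    match a with
    | 0 => match i with
      | 0 => n
      | 1 => m
      | 2 => f
      | 3 => D.outer
      | _ => 0
    | 1 => toArray D.origin i
    | 2 => toArray D.twin i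
    | 3 => toArray D.succ i
    | 4 => toArray D.succ.symm i
    | 5 => toArray D.face i
    | 6 => toArray D.vertexEdge i
    | 7 => toArray D.faceEdge i
    | _ => 0
  real _ _ := 0

end EdgeList

/-- The vertex positions that a real RAM returns: the coordinates of vertex `v` stand in cell `v`
of the real arrays `0` and `1`. -/
noncomputable def RealRAM.Memory.positions (s : RealRAM.Memory) (n : ℕ) : Fin n → Plane :=
  fun v => !₂[s.real 0 v, s.real 1 v]

/-! Outerplanarity is a topological hypothesis, so its combinatorial content has to be extracted
first: the vertices can be ranked on a line so that edges drawn on one side of it do not cross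
(`NoncrossingOn`). The obstruction is a tripod, a vertex `u` with three neighbours any two of which
are joined by a walk avoiding `u` and the third. In a drawing with all vertices on the outer face,
the closed walk through `u` and two of these neighbours has winding number 0 on the outer face,
hence along the whole edge from `u` to the third neighbour. On a small circle around `u`, the three
vanishing conditions contradict the jump by 2π that a winding number makes across an edge
(`OuterDrawing.tripodFree`). An induction that splits the graph at separating neighbours turns the
absence of tripods into a ranking (`TripodFree.exists_noncrossingOn`). Conversely, points on a
parabola realise every ranking by an outerplanar drawing.

A ranking extends to a triangulated polygon, recorded as a tree of triangles (`Hang`). It has 2n - 3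
edges, so maximality can be decided by counting edges.

For the upper bound, every triangle gets two sides of length 1 and one long side, the long side
being the diagonal of a rhombus. The sum of two unit vectors with distinct nonnegative slopes has
length in [1, 2), and as there are finitely many edges, the ratio is less than 2. Planarity comes
from an interval of slopes between `a` and `a + 6 * d` reserved for each unit edge: it has room for
separate subintervals for the three polygons hung on the other sides of the rhombus and for the
direction `a + 4 * d` of its new side. Each polygon stays in a wedge cut out by its slopes, and
wedges meet only at shared vertices (`Hang.isComplex`).

For linear time, counting half-edges in an embedding of a maximal outerplanar graph shows that all
inner faces are triangles and that the outer face passes each vertex once. A depth-first search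
through the faces therefore finds the tree of triangles (`Traverse.complete`). With N triangles it
makes 2N + 1 calls of bounded cost (`exec_search`).

For the lower bound, suppose that all edges of a fan have lengths in [1, 2 - g]. Then the areas of
its triangles are bounded below, and for a long fan compactness yields three triangles at the hub
that almost coincide and have only the hub in common. Being free of crossings, they are nested. The
pendant triangle of the middle one is squeezed by the other two and has too small an area
(`false_of_three_ears`). -/

namespace OuterplanarDrawing

/-! ## Noncrossing rankings from local separation -/

section Combinatorics

variable {V : Type*}

/-- `x` and `y` are joined by a walk of `G` inside the vertex set `A`. -/
def Joined (G : SimpleGraph V) (A : Set V) (x y : V) : Prop :=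
  x ∈ A ∧ Relation.ReflTransGen (fun s t => G.Adj s t ∧ t ∈ A) x y

namespace Joined

variable {G H : SimpleGraph V} {A B : Set V} {x y z : V}

theorem refl (h : x ∈ A) : Joined G A x x := ⟨h, .refl⟩

theorem mem_left (h : Joined G A x y) : x ∈ A := h.1

theorem mem_right (h : Joined G A x y) : y ∈ A := by
  obtain ⟨hx, h⟩ := h
  induction h with
  | refl => exact hx
  | tail _ h _ => exact h.2

theorem trans (h : Joined G A x y) (h' : Joined G A y z) : Joined G A x z :=
  ⟨h.1, h.2.trans h'.2⟩

theorem tail (h : Joined G A x y) (h' : G.Adj y z) (hz : z ∈ A) : Joined G A x z :=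
  ⟨h.1, h.2.tail ⟨h', hz⟩⟩

theorem single (h : G.Adj x y) (hx : x ∈ A) (hy : y ∈ A) : Joined G A x y :=
  (refl hx).tail h hy

theorem symm (h : Joined G A x y) : Joined G A y x := by
  obtain ⟨hx, h⟩ := h
  induction h with
  | refl => exact refl hx
  | @tail b c hb h ih =>
    have hb' : b ∈ A := ih.mem_left
    exact (single h.1.symm h.2 hb').trans ih

/-- Transferring a walk step by step, with a whole walk allowed in place of each edge, covers
changes of the vertex set and of the graph alike. -/
theorem of_walks (h : Joined G A x y) (hx : x ∈ B)
    (hs : ∀ s t, Joined G A x s → s ∈ B → G.Adj s t → t ∈ A → Joined H B s t) :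
    Joined H B x y := by
  obtain ⟨hxA, h⟩ := h
  induction h with
  | refl => exact refl hx
  | @tail b c hb h ih => exact ih.trans (hs _ _ ⟨hxA, hb⟩ ih.mem_right h.1 h.2)

theorem mono (h : Joined G A x y) (hAB : A ⊆ B) : Joined G B x y :=
  h.of_walks (hAB h.1) fun _ _ _ hs ha ht => single ha hs (hAB ht)

theorem inside (h : Joined G A x y) (hB : ∀ z, Joined G A x z → z ∈ B) : Joined G B x y :=
  h.of_walks (hB _ (refl h.1)) fun _ _ hs hsB ha ht => single ha hsB (hB _ (hs.tail ha ht))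

end Joined

/-- No vertex `u` of `S` has three neighbours any two of which are joined in `S` avoiding `u` and
the third. -/
def TripodFree (G : SimpleGraph V) (S : Set V) : Prop :=
  ∀ u b₁ b₂ b₃, u ∈ S → G.Adj u b₁ → G.Adj u b₂ → G.Adj u b₃ → b₁ ≠ b₂ → b₂ ≠ b₃ → b₃ ≠ b₁ →
    Joined G (S \ {u, b₃}) b₁ b₂ → Joined G (S \ {u, b₁}) b₂ b₃ →
    Joined G (S \ {u, b₂}) b₃ b₁ → False

/-- `ρ` ranks the vertices in `S` so that no two edges cross when the vertices are placed in this
order on a line, and the edges on one side of it. -/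
structure NoncrossingOn (G : SimpleGraph V) (S : Set V) (ρ : V → ℕ) : Prop where
  inj : ∀ x ∈ S, ∀ y ∈ S, ρ x = ρ y → x = y
  not_cross : ∀ p ∈ S, ∀ q ∈ S, ∀ r ∈ S, ∀ s ∈ S, ρ p < ρ q → ρ q < ρ r → ρ r < ρ s →
    G.Adj p r → G.Adj q s → False

theorem TripodFree.mono {G : SimpleGraph V} {S T : Set V} (h : TripodFree G S) (hT : T ⊆ S) :
    TripodFree G T := fun u b₁ b₂ b₃ hu h₁ h₂ h₃ n₁ n₂ n₃ j₁ j₂ j₃ =>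
  h u b₁ b₂ b₃ (hT hu) h₁ h₂ h₃ n₁ n₂ n₃ (j₁.mono (Set.sdiff_subset_sdiff_left hT))
    (j₂.mono (Set.sdiff_subset_sdiff_left hT)) (j₃.mono (Set.sdiff_subset_sdiff_left hT))

/-- No two neighbours of `a` other than `b` are joined to `b` avoiding each other. -/
def OuterAt (G : SimpleGraph V) (S : Set V) (a b : V) : Prop :=
  ∀ c c', G.Adj a c → G.Adj a c' → c ≠ b → c' ≠ b → c ≠ c' →
    Joined G (S \ {a, c'}) c b → Joined G (S \ {a, c}) c' b → False

theorem exists_rank_bound [Finite V] (ρ : V → ℕ) : ∃ M, ∀ x, ρ x < M := by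
  obtain ⟨M, hM⟩ := (Set.finite_range ρ).bddAbove
  exact ⟨M + 1, fun x => Nat.lt_succ_of_le (hM ⟨x, rfl⟩)⟩

/-- Whether two chords cross depends only on the cyclic order of their ends, so the order may be cut
open at any vertex. -/
theorem NoncrossingOn.rotate [Finite V] {G : SimpleGraph V} {S : Set V} {ρ : V → ℕ}
    (h : NoncrossingOn G S ρ) {a : V} :
    ∃ σ, NoncrossingOn G S σ ∧ ∀ x, σ a ≤ σ x := by
  obtain ⟨M, hM⟩ := exists_rank_bound ρ
  refine ⟨fun x => if ρ x < ρ a then ρ x + M else ρ x, ⟨?_, ?_⟩, ?_⟩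
  · intro x hx y hy hxy
    have := hM x; have := hM y
    refine h.inj x hx y hy ?_
    grind
  · intro p hp q hq r hr s hs h1 h2 h3 e1 e2
    have := hM p; have := hM q; have := hM r; have := hM s
    -- The old order lists the four vertices in the same cyclic order, beginning with any one of
    -- them.
    have c1 := h.not_cross p hp q hq r hr s hs
    have c2 := h.not_cross s hs p hp q hq r hr
    have c3 := h.not_cross r hr s hs p hp q hq
    have c4 := h.not_cross q hq r hr s hs p hp
    have := e1.symm; have := e2.symm
    grind
  · intro x
    have := hM a
    grind

theorem NoncrossingOn.rotate_last [Finite V] {G : SimpleGraph V} {S : Set V} {ρ : V → ℕ}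
    (h : NoncrossingOn G S ρ) {a : V} :
    ∃ σ, NoncrossingOn G S σ ∧ ∀ x ∈ S, σ x ≤ σ a := by
  obtain ⟨M, hM⟩ := exists_rank_bound ρ
  refine ⟨fun x => if ρ a < ρ x then ρ x else ρ x + M, ⟨?_, ?_⟩, ?_⟩
  · intro x hx y hy hxy
    have := hM x; have := hM y
    refine h.inj x hx y hy ?_
    grind
  · intro p hp q hq r hr s hs h1 h2 h3 e1 e2
    have := hM p; have := hM q; have := hM r; have := hM s
    have c1 := h.not_cross p hp q hq r hr s hs
    have c2 := h.not_cross s hs p hp q hq r hr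
    have c3 := h.not_cross r hr s hs p hp q hq
    have c4 := h.not_cross q hq r hr s hs p hp
    have := e1.symm; have := e2.symm
    grind
  · intro x hx
    have := hM x
    grind

/-- The rankings of two vertex sets are put one after the other. -/
theorem NoncrossingOn.append [Finite V] {G : SimpleGraph V} {S T : Set V} {ρ σ : V → ℕ} {a b : V}
    (hρ : NoncrossingOn G S ρ) (hσ : NoncrossingOn G T σ) (hST : Disjoint S T)
    (haS : ∀ x ∈ S, ρ a ≤ ρ x) (hbT : ∀ x ∈ T, σ x ≤ σ b) (ha : a ∈ S) (hb : b ∈ T)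
    (hadj : ∀ x ∈ S, ∀ y ∈ T, G.Adj x y → x = a ∧ y = b) :
    ∃ τ, NoncrossingOn G (S ∪ T) τ ∧ (∀ x ∈ S ∪ T, τ a ≤ τ x) ∧ ∀ x ∈ S ∪ T, τ x ≤ τ b := by
  classical
  obtain ⟨M, hM⟩ := exists_rank_bound ρ
  have hd : ∀ x, x ∈ T → x ∉ S := fun x hx hx' => Set.disjoint_left.1 hST hx' hx
  refine ⟨fun x => if x ∈ S then ρ x else σ x + M, ⟨?_, ?_⟩, ?_, ?_⟩
  · intro x hx y hy hxy
    have := hM x; have := hM y; have := hρ.inj x; have := hσ.inj x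
    grind
  · intro p hp q hq r hr s hs h1 h2 h3 e1 e2
    have := hM p; have := hM q; have := hM r; have := hM s
    have := hρ.not_cross p; have := hσ.not_cross p
    have := haS p; have := hbT s; have := haS q; have := hbT r
    have := hadj p; have := hadj q
    grind
  · intro x hx
    have := hM a
    grind
  · intro x hx
    have := hM x
    grind

/-- The rankings of two vertex sets with a common vertex are put one after the other. -/
theorem NoncrossingOn.glue [Finite V] {G : SimpleGraph V} {S T : Set V} {ρ σ : V → ℕ} {a w b : V}
    (hρ : NoncrossingOn G S ρ) (hσ : NoncrossingOn G T σ) (hST : ∀ x ∈ S, x ∈ T → x = w)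
    (haS : ∀ x ∈ S, ρ a ≤ ρ x) (hwS : ∀ x ∈ S, ρ x ≤ ρ w) (hwT : ∀ x ∈ T, σ w ≤ σ x)
    (hbT : ∀ x ∈ T, σ x ≤ σ b) (ha : a ∈ S) (hb : b ∈ T) (hw : w ∈ S) (hw' : w ∈ T)
    (hwb : w ≠ b)
    (hadj : ∀ x ∈ S, ∀ y ∈ T, x ≠ w → y ≠ w → G.Adj x y → x = a ∧ y = b) :
    ∃ τ, NoncrossingOn G (S ∪ T) τ ∧ (∀ x ∈ S ∪ T, τ a ≤ τ x) ∧ ∀ x ∈ S ∪ T, τ x ≤ τ b := by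
  classical
  obtain ⟨M, hM⟩ := exists_rank_bound ρ
  have hM' : ∀ x ∈ T, x ≠ w → σ w < σ x := fun x hx hxw =>
    lt_of_le_of_ne (hwT x hx) fun h => hxw (hσ.inj _ hw' _ hx h).symm
  have hMS : ∀ x ∈ S, x ≠ w → ρ x < ρ w := fun x hx hxw =>
    lt_of_le_of_ne (hwS x hx) fun h => hxw (hρ.inj _ hx _ hw h)
  have hbS : b ∉ S := fun h => hwb (hST b h hb).symm
  refine ⟨fun x => if x ∈ S then ρ x else σ x + M, ⟨?_, ?_⟩, ?_, ?_⟩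
  · intro x hx y hy hxy
    have := hM x; have := hM y; have := hρ.inj x; have := hσ.inj x
    grind
  · intro p hp q hq r hr s hs h1 h2 h3 e1 e2
    have hadj' : ∀ x ∈ S, ∀ y ∈ S ∪ T, y ∉ S → G.Adj x y → x = w ∨ x = a ∧ y = b := by
      intro x hx y hy hyS hxy
      by_cases hxw : x = w
      · exact .inl hxw
      · exact .inr (hadj x hx y (hy.resolve_left hyS) hxw (fun h => hyS (h ▸ hw)) hxy)
    have m1 := hM p; have m2 := hM q; have m3 := hM r; have m4 := hM s
    by_cases pS : p ∈ S <;> by_cases qS : q ∈ S <;> by_cases rS : r ∈ S <;>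
      by_cases sS : s ∈ S <;> simp only [pS, qS, rS, sS, if_true, if_false] at h1 h2 h3
    · exact hρ.not_cross p pS q qS r rS s sS h1 h2 h3 e1 e2
    · have := hwS r rS; have := haS p pS
      rcases hadj' q qS s hs sS e2 with h | ⟨h, -⟩ <;> subst h <;> omega
    · omega
    · have := hwS q qS; have := hbT s (hs.resolve_left sS)
      rcases hadj' p pS r hr rS e1 with h | ⟨-, h⟩ <;> subst h <;> omega
    · omega
    · omega
    · omega
    -- The edge from `p` into `T` starts at `w`, which comes first in `T`, or else it is `ab`; in
    -- the second case `b` would precede `s` although it is last.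
    · have := hbT s (hs.resolve_left sS)
      have := hM' q (hq.resolve_left qS) (fun h => qS (h ▸ hw))
      rcases hadj' p pS r hr rS e1 with h | ⟨-, h⟩
      · subst h
        exact hσ.not_cross p hw' q (hq.resolve_left qS) r (hr.resolve_left rS) s
          (hs.resolve_left sS) this (by omega) (by omega) e1 e2
      · subst h
        omega
    · omega
    · omega
    · omega
    · omega
    · omega
    · omega
    · omega
    · have := hσ.not_cross p
      grind
  · intro x hx
    have := hM a
    grind
  · intro x hx
    have := hM x
    grind

theorem NoncrossingOn.mono_graph {G H : SimpleGraph V} {S : Set V} {ρ : V → ℕ}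
    (h : NoncrossingOn H S ρ) (hG : G ≤ H) : NoncrossingOn G S ρ :=
  ⟨h.inj, fun p hp q hq r hr s hs h1 h2 h3 e1 e2 =>
    h.not_cross p hp q hq r hr s hs h1 h2 h3 (hG e1) (hG e2)⟩

/-- Two vertex sets that share only a cut vertex. -/
theorem NoncrossingOn.union_cut [Finite V] {G : SimpleGraph V} {S T : Set V} {ρ σ : V → ℕ} {a : V}
    (hρ : NoncrossingOn G S ρ) (hσ : NoncrossingOn G T σ)
    (haS : ∀ x ∈ S, ρ a ≤ ρ x) (haT : ∀ x ∈ T, σ a ≤ σ x) (ha : a ∈ S) (ha' : a ∈ T)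
    (hadj : ∀ x ∈ S, ∀ y ∈ T, y ∉ S → G.Adj x y → x = a) :
    ∃ τ, NoncrossingOn G (S ∪ T) τ := by
  classical
  obtain ⟨M, hM⟩ := exists_rank_bound ρ
  have hT : ∀ x ∈ S ∪ T, x ∉ S → x ∈ T ∧ σ a < σ x := fun x hx hxS =>
    ⟨hx.resolve_left hxS, lt_of_le_of_ne (haT x (hx.resolve_left hxS)) fun h =>
      hxS (hσ.inj _ ha' _ (hx.resolve_left hxS) h ▸ ha)⟩
  refine ⟨fun x => if x ∈ S then ρ x else σ x + M, ⟨?_, ?_⟩⟩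
  · intro x hx y hy hxy
    have := hM x; have := hM y; have := hρ.inj x; have := hσ.inj x
    grind
  · intro p hp q hq r hr s hs h1 h2 h3 e1 e2
    have m1 := hM p; have m2 := hM q; have m3 := hM r; have m4 := hM s
    by_cases pS : p ∈ S <;> by_cases qS : q ∈ S <;> by_cases rS : r ∈ S <;>
      by_cases sS : s ∈ S <;> simp only [pS, qS, rS, sS, if_true, if_false] at h1 h2 h3
    · exact hρ.not_cross p pS q qS r rS s sS h1 h2 h3 e1 e2
    · have := hadj q qS s (hT s hs sS).1 sS e2
      have := haS p pS
      subst q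
      omega
    · omega
    · have := hadj q qS s (hT s hs sS).1 sS e2
      have := haS p pS
      subst q
      omega
    · omega
    · omega
    · omega
    · have := hadj p pS r (hT r hr rS).1 rS e1
      subst p
      exact hσ.not_cross a ha' q (hT q hq qS).1 r (hT r hr rS).1 s (hT s hs sS).1
        (hT q hq qS).2 (by omega) (by omega) e1 e2
    · omega
    · omega
    · omega
    · omega
    · omega
    · omega
    · omega
    · exact hσ.not_cross p (hT p hp pS).1 q (hT q hq qS).1 r (hT r hr rS).1 s (hT s hs sS).1
        (by omega) (by omega) (by omega) e1 e2

/-- A walk from `b` to `w` first meets `w` right after a vertex joined to `b` off `w`. -/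
theorem Joined.first_hit {G : SimpleGraph V} {A : Set V} {b w : V} (h : Joined G A b w)
    (hbw : b ≠ w) : Joined G (insert w {y | Joined G (A \ {w}) b y}) b w := by
  set B := insert w {y | Joined G (A \ {w}) b y} with hB
  have hb : Joined G (A \ {w}) b b := .refl ⟨h.mem_left, hbw⟩
  have key : ∀ y, Relation.ReflTransGen (fun s t => G.Adj s t ∧ t ∈ A) b y →
      Joined G (A \ {w}) b y ∨ Joined G B b w := by
    intro y hy
    induction hy with
    | refl => exact .inl hb
    | @tail s t _ hst ih =>
      refine ih.imp_left id |>.elim (fun hs => ?_) .inr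
      by_cases htw : t = w
      · subst htw
        exact .inr ((hs.inside fun z hz => .inr hz).tail hst.1 (.inl rfl))
      · exact .inl (hs.tail hst.1 ⟨hst.2, htw⟩)
  exact (key w h.2).resolve_left fun h' => h'.mem_right.2 rfl

theorem Joined.of_sup_edge_avoiding {G : SimpleGraph V} {A : Set V} {w b x y : V}
    (h : Joined (G ⊔ .edge w b) A x y) (hw : w ∉ A) : Joined G A x y :=
  h.of_walks h.mem_left fun s t _ hs hst ht => by
    refine .single ?_ hs ht
    rcases hst with h | h
    · exact h
    · rw [SimpleGraph.edge_adj] at h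
      rcases h.1 with ⟨rfl, -⟩ | ⟨-, rfl⟩
      exacts [(hw hs).elim, (hw ht).elim]

/-- A tripod at `w` that uses the new edge `wb` becomes one in `G` when `b` is replaced by `a`:
walks avoiding `w` do not contain the new edge, and those ending at `b` are prolonged along `ba`. -/
theorem TripodFree.sup_edge_at {G : SimpleGraph V} {S T : Set V} {a b w b₁ b₂ b₃ : V}
    (h : TripodFree G S) (ha : a ∈ S) (haT : a ∉ T) (hT : T ⊆ S) (hw : w ∈ T)
    (hab : G.Adj a b) (haw : G.Adj a w)
    (h₁ : (G ⊔ .edge w b).Adj w b₁) (h₂ : (G ⊔ .edge w b).Adj w b₂)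
    (h₃ : (G ⊔ .edge w b).Adj w b₃) (n₁ : b₁ ≠ b₂) (n₂ : b₂ ≠ b₃) (n₃ : b₃ ≠ b₁)
    (j₁ : Joined (G ⊔ .edge w b) (T \ {w, b₃}) b₁ b₂)
    (j₂ : Joined (G ⊔ .edge w b) (T \ {w, b₁}) b₂ b₃)
    (j₃ : Joined (G ⊔ .edge w b) (T \ {w, b₂}) b₃ b₁) : False := by
  classical
  let f : V → V := fun x => if x = b then a else x
  have hf : ∀ x, (G ⊔ .edge w b).Adj w x → G.Adj w (f x) := by
    intro x hx
    by_cases hxb : x = b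
    · simpa [f, hxb] using haw.symm
    · simp only [f, hxb, if_false]
      rcases hx with h | h
      · exact h
      · rw [SimpleGraph.edge_adj] at h
        grind
  have hne : ∀ x ∈ T, x ≠ a := fun x hx h => haT (h ▸ hx)
  have hinj : ∀ x ∈ T, ∀ y ∈ T, x ≠ y → f x ≠ f y := by
    intro x hx y hy hxy
    have := hne x hx; have := hne y hy
    grind
  have hj : ∀ x y c, c ∈ T → Joined (G ⊔ .edge w b) (T \ {w, c}) x y →
      Joined G (S \ {w, f c}) (f x) (f y) := by
    intro x y c hc hxy
    have h0 : Joined G (T \ {w, c}) x y := hxy.of_sup_edge_avoiding (by simp)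
    have hx := h0.mem_left; have hy := h0.mem_right
    -- If the avoided vertex is `b`, its replacement `a` is avoided automatically, because `a` is
    -- not in `T`.
    by_cases hcb : c = b
    · have hxb : x ≠ b := by grind
      have hyb : y ≠ b := by grind
      simp only [f, hcb, hxb, hyb, if_true, if_false]
      refine h0.mono fun z hz => ⟨hT hz.1, ?_⟩
      have := hne z hz.1
      grind
    · have hca := hne c hc
      have hwa := hne w hw
      have haA : a ∈ S \ {w, f c} := by grind
      have h1 : Joined G (S \ {w, f c}) x y := h0.mono (by grind)
      have h2 : ∀ z ∈ S \ {w, f c}, Joined G (S \ {w, f c}) z (f z) := by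
        intro z hz
        by_cases hzb : z = b
        · subst hzb
          simpa [f] using Joined.single hab.symm hz (by simpa [f] using haA)
        · simpa [f, hzb] using Joined.refl hz
      exact ((h2 x h1.mem_left).symm.trans h1).trans (h2 y h1.mem_right)
  have m₁ := j₁.mem_left.1; have m₂ := j₂.mem_left.1; have m₃ := j₃.mem_left.1
  exact h w (f b₁) (f b₂) (f b₃) (hT hw) (hf _ h₁) (hf _ h₂) (hf _ h₃) (hinj _ m₁ _ m₂ n₁)
    (hinj _ m₂ _ m₃ n₂) (hinj _ m₃ _ m₁ n₃) (hj _ _ _ m₃ j₁) (hj _ _ _ m₁ j₂) (hj _ _ _ m₂ j₃)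

/-- The new edge only abbreviates the path `w a b`, and `a` is free for this use because it lies
outside `T`. Tripods centred at an end of the new edge need the separate argument of `sup_edge_at`.
-/
theorem TripodFree.sup_edge {G : SimpleGraph V} {S T : Set V} {a b w : V}
    (h : TripodFree G S) (ha : a ∈ S) (haT : a ∉ T) (hT : T ⊆ S)
    (hab : G.Adj a b) (haw : G.Adj a w) : TripodFree (G ⊔ .edge w b) T := by
  intro u b₁ b₂ b₃ hu h₁ h₂ h₃ n₁ n₂ n₃ j₁ j₂ j₃
  by_cases huw : u = w
  · subst huw
    exact h.sup_edge_at ha haT hT hu hab haw h₁ h₂ h₃ n₁ n₂ n₃ j₁ j₂ j₃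
  by_cases hub : u = b
  · subst hub
    rw [SimpleGraph.edge_comm] at *
    exact h.sup_edge_at ha haT hT hu haw hab h₁ h₂ h₃ n₁ n₂ n₃ j₁ j₂ j₃
  have hadj : ∀ x, (G ⊔ .edge w b).Adj u x → G.Adj u x := by
    rintro x (h | h)
    · exact h
    · rw [SimpleGraph.edge_adj] at h
      grind
  have hj : ∀ x y c, c ∈ T → Joined (G ⊔ .edge w b) (T \ {u, c}) x y →
      Joined G (S \ {u, c}) x y := by
    intro x y c hc hxy
    have hA : T \ {u, c} ⊆ S \ {u, c} := Set.sdiff_subset_sdiff_left hT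
    refine hxy.of_walks (hA hxy.mem_left) fun s t hs _ hst ht => ?_
    have hsA := hA hs.mem_right
    rcases hst with h' | h'
    · exact .single h' hsA (hA ht)
    · rw [SimpleGraph.edge_adj] at h'
      have haA : a ∈ S \ {u, c} := by grind
      rcases h'.1 with ⟨rfl, rfl⟩ | ⟨rfl, rfl⟩
      · exact (Joined.single haw.symm hsA haA).tail hab (hA ht)
      · exact (Joined.single hab.symm hsA haA).tail haw (hA ht)
  exact h u b₁ b₂ b₃ (hT hu) (hadj _ h₁) (hadj _ h₂) (hadj _ h₃) n₁ n₂ n₃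
    (hj _ _ _ j₃.mem_left.1 j₁) (hj _ _ _ j₁.mem_left.1 j₂) (hj _ _ _ j₂.mem_left.1 j₃)

end Combinatorics

/-! ### Rankings of graphs without tripods. -/

section Ranking

variable {V : Type*}

/-- The component of `b` off `a` and `w` is attached to the rest only through `w` and the edge `ab`,
which is the form needed for gluing at `w`. -/
theorem Joined.split_avoiding {G : SimpleGraph V} {S : Set V} {a b w : V}
    (hw : G.Adj a w) (hwb : w ≠ b) (hwj : Joined G (S \ {a}) w b)
    (hsep : ∀ c, G.Adj a c → c ≠ b → c ≠ w → ¬ Joined G (S \ {a, w}) c b) :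
    ∀ x ∈ S \ {y | Joined G (S \ {a, w}) b y}, ∀ y, Joined G (S \ {a, w}) b y → x ≠ w →
      G.Adj x y → x = a ∧ y = b := by
  intro x hx y hy hxw hxy
  by_cases hxa : x = a
  · subst hxa
    refine ⟨rfl, ?_⟩
    by_contra hyb
    refine hsep y hxy hyb ?_ hy.symm
    rintro rfl
    exact hy.mem_right.2 (by simp)
  · exact (hx.2 (hy.tail hxy.symm ⟨hx.1, by simp [hxa, hxw]⟩)).elim

variable [Finite V]

/-- The choice of the third vertex of the triangle at the edge `ab`. -/
theorem OuterAt.exists_separating {G : SimpleGraph V} {S : Set V} {a b : V}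
    (h : OuterAt G S a b) (hN : ∃ c, G.Adj a c ∧ c ≠ b ∧ Joined G (S \ {a}) c b) :
    ∃ w, G.Adj a w ∧ w ≠ b ∧ Joined G (S \ {a}) w b ∧
      ∀ c, G.Adj a c → c ≠ b → c ≠ w → ¬ Joined G (S \ {a, w}) c b := by
  -- The neighbour closest to `b`: the component of `b` that it cuts off is as small as possible.
  obtain ⟨w, ⟨hw, hwb, hwj⟩, hmin⟩ := Set.exists_min_image
    {c | G.Adj a c ∧ c ≠ b ∧ Joined G (S \ {a}) c b}
    (fun w => {y | Joined G (S \ {a, w}) b y}.ncard) (Set.toFinite _) hN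
  refine ⟨w, hw, hwb, hwj, fun c hc hcb hcw hj => ?_⟩
  have h1 : ¬ Joined G (S \ {a, c}) w b := fun h' => h c w hc hw hcb hwb hcw hj h'
  have h2 := hmin c ⟨hc, hcb, hj.mono (by grind)⟩
  -- Replacing `w` by `c` would give a smaller component: it cannot contain `w`, so it lies in the
  -- old one, and it loses `c`.
  refine absurd h2 (not_le.2 (Set.ncard_lt_ncard ?_ (Set.toFinite _)))
  refine ⟨fun y hy => hy.inside fun z hz => ?_, fun h' => ?_⟩
  · have := hz.mem_right
    have : z ≠ w := by rintro rfl; exact h1 hz.symm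
    grind
  · exact (h' hj.symm : Joined _ _ _ _).mem_right.2 (by simp)

/-- If `b` is chosen so that its removal leaves the largest component around `c₀`, all other
neighbours of `a` in `S` belong to this component. Two of them that violate the outer condition at
`ab` are then joined through `c₀` avoiding `b`, and form a tripod with `b`. -/
theorem exists_outerAt {G : SimpleGraph V} {S : Set V} {a c₀ : V} (h : TripodFree G S)
    (ha : a ∈ S) (hc₀ : c₀ ∈ S) (hac₀ : G.Adj a c₀)
    (hconn : ∀ z ∈ S \ {a}, Joined G (S \ {a}) c₀ z) :
    ∃ b ∈ S, G.Adj a b ∧ OuterAt G S a b := by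
  by_cases hN : {c | c ∈ S ∧ G.Adj a c ∧ c ≠ c₀}.Nonempty
  · obtain ⟨b, ⟨hb, hab, hbc⟩, hmax⟩ := Set.exists_max_image _
      (fun w => {y | Joined G (S \ {a, w}) c₀ y}.ncard) (Set.toFinite _) hN
    refine ⟨b, hb, hab, fun c c' hc hc' hcb hcb' hcc' j j' => ?_⟩
    have key : ∀ d, d ∈ S → G.Adj a d → d ≠ b → Joined G (S \ {a, b}) c₀ d := by
      intro d hd had hdb
      by_contra hj
      have hdc : d ≠ c₀ := by
        rintro rfl
        exact hj (.refl (by have := had.ne; grind))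
      -- Otherwise removing `d` instead of `b` would keep the component of `c₀` and add `b` to it.
      refine absurd (hmax d ⟨hd, had, hdc⟩) (not_le.2 (Set.ncard_lt_ncard ?_ (Set.toFinite _)))
      refine ⟨fun y hy => hy.inside fun z hz => ?_, fun h' => ?_⟩
      · have := hz.mem_right
        have : z ≠ d := by rintro rfl; exact hj hz
        grind
      · have h1 := (hconn b ⟨hb, hab.ne'⟩).first_hit hbc.symm
        rw [Set.sdiff_sdiff, Set.singleton_union] at h1
        have h2 : Joined G (S \ {a, d}) c₀ b := by
          refine h1.mono ?_
          rintro z (rfl | hz)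
          · exact ⟨hb, by have := hab.ne; grind⟩
          · have hz' : Joined G (S \ {a, b}) c₀ z := by
              convert (hz : Joined _ _ _ _) using 1
              grind
            have := hz'.mem_right
            have : z ≠ d := by rintro rfl; exact hj hz'
            grind
        exact (h' h2 : Joined _ _ _ _).mem_right.2 (by simp)
    have k1 := key c j.mem_left.1 hc hcb
    have k2 := key c' j'.mem_left.1 hc' hcb'
    exact h a b c c' ha hab hc hc' hcb.symm hcc' hcb' j.symm (k1.symm.trans k2) j'
  · refine ⟨c₀, hc₀, hac₀, fun c c' hc hc' hcb hcb' hcc' j j' => ?_⟩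
    exact hN ⟨c, j.mem_left.1, hc, hcb⟩

/-- The rooted version is what the induction can glue: a first and a last vertex are known. Over the
root edge `ab`, the separating neighbour `w` is the third corner of a triangle. The piece at `aw`
and the piece at `wb` are ranked separately and share only `w`. The unrooted version splits at a cut
vertex or finds a root edge. -/
theorem TripodFree.exists_noncrossingOn_aux (n : ℕ) :
    (∀ (G : SimpleGraph V) (S : Set V), S.ncard = n → TripodFree G S →
      ∃ ρ, NoncrossingOn G S ρ) ∧
    ∀ (G : SimpleGraph V) (S : Set V) (a b : V), S.ncard = n → a ∈ S → b ∈ S → G.Adj a b →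
      TripodFree G S → OuterAt G S a b →
      ∃ ρ, NoncrossingOn G S ρ ∧ (∀ x ∈ S, ρ a ≤ ρ x) ∧ ∀ x ∈ S, ρ x ≤ ρ b := by
  induction n using Nat.strong_induction_on with
  | _ n ih =>
  have ihT : ∀ (G : SimpleGraph V) (S T : Set V), S.ncard = n → T ⊂ S → TripodFree G S →
      ∃ ρ, NoncrossingOn G T ρ := fun G S T hS hT h =>
    (ih T.ncard (hS ▸ Set.ncard_lt_ncard hT)).1 G T rfl (h.mono hT.1)
  have rooted : ∀ (G : SimpleGraph V) (S : Set V) (a b : V), S.ncard = n → a ∈ S → b ∈ S →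
      G.Adj a b → TripodFree G S → OuterAt G S a b →
      ∃ ρ, NoncrossingOn G S ρ ∧ (∀ x ∈ S, ρ a ≤ ρ x) ∧ ∀ x ∈ S, ρ x ≤ ρ b := by
    intro G S a b hS ha hb hab hQ hout
    have hbA : b ∈ S \ {a} := ⟨hb, hab.ne'⟩
    by_cases hN : ∃ c, G.Adj a c ∧ c ≠ b ∧ Joined G (S \ {a}) c b
    · obtain ⟨w, haw, hwb, hwj, hsep⟩ := hout.exists_separating hN
      set X := {y | Joined G (S \ {a, w}) b y} with hX
      have hbX : b ∈ X := .refl ⟨hb, by have := hab.ne; grind⟩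
      have hXS : X ⊆ S := fun y hy => (hy : Joined _ _ _ _).mem_right.1
      have hXa : a ∉ X := fun h' => (h' : Joined _ _ _ _).mem_right.2 (by simp)
      have hXw : w ∉ X := fun h' => (h' : Joined _ _ _ _).mem_right.2 (by simp)
      have hw := hwj.mem_left.1
      have hjw : Joined G (insert w X) w b := by
        have := (hwj.symm.first_hit hwb.symm).symm
        rwa [Set.sdiff_sdiff, Set.singleton_union] at this
      have hadj := Joined.split_avoiding haw hwb hwj hsep
      -- The outer condition passes from `ab` to `aw`, since walks to `w` continue to `b` inside
      -- `insert w X`.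
      obtain ⟨ρ, hρ, hρa, hρw⟩ := (ih (S \ X).ncard (hS ▸ Set.ncard_lt_ncard
        ⟨Set.sdiff_subset, fun h => (h hb).2 hbX⟩)).2 G (S \ X) a w rfl ⟨ha, hXa⟩ ⟨hw, hXw⟩ haw
        (hQ.mono Set.sdiff_subset) (by
          intro c c' hc hc' hcw hcw' hcc' j j'
          have hcX := j.mem_left.1.2
          have hcX' := j'.mem_left.1.2
          have hcb : c ≠ b := fun h => hcX (h ▸ hbX)
          have hcb' : c' ≠ b := fun h => hcX' (h ▸ hbX)
          have hsub : ∀ d, d ≠ w → d ∉ X → insert w X ⊆ S \ {a, d} := by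
            rintro d hdw hdX z (rfl | hz)
            · exact ⟨hw, by have := haw.ne; grind⟩
            · exact ⟨hXS hz, by grind⟩
          refine hout c c' hc hc' hcb hcb' hcc' ?_ ?_
          · exact (j.mono (by grind)).trans (hjw.mono (hsub c' hcw' hcX'))
          · exact (j'.mono (by grind)).trans (hjw.mono (hsub c hcw hcX)))
      have hYS : insert w X ⊆ S := Set.insert_subset hw hXS
      have haY : a ∉ insert w X := by have := haw.ne; grind
      -- The edge `wb` is added so that it can serve as the root. Two neighbours of `w` violating
      -- the outer condition there would form a tripod at `w` together with `a`.
      obtain ⟨σ, hσ, hσw, hσb⟩ := (ih (insert w X).ncard (hS ▸ Set.ncard_lt_ncard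
        ⟨hYS, fun h => haY (h ha)⟩)).2 (G ⊔ .edge w b) (insert w X) w b rfl (.inl rfl) (.inr hbX)
        (.inr (by simp [SimpleGraph.edge_adj, hwb])) (hQ.sup_edge ha haY hYS hab haw) (by
          intro c c' hc hc' hcb hcb' hcc' j j'
          have j := j.of_sup_edge_avoiding (by simp)
          have j' := j'.of_sup_edge_avoiding (by simp)
          have hG : ∀ c, c ≠ b → (G ⊔ .edge w b).Adj w c → G.Adj w c := by
            rintro c hcb (h | h)
            · exact h
            · rw [SimpleGraph.edge_adj] at h
              grind
          have hca : ∀ c ∈ insert w X, a ≠ c := by grind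
          have hac := hca c j.mem_left.1
          have hac' := hca c' j'.mem_left.1
          have haw' := haw.ne
          refine hQ w a c c' hw haw.symm (hG c hcb hc) (hG c' hcb' hc') hac hcc' hac'.symm
            ?_ ?_ ?_
          · refine .trans (.single hab ⟨ha, by grind⟩ ?_) (j.symm.mono (by grind))
            exact ⟨hb, by grind⟩
          · exact ((j.trans (.refl j.mem_right)).mono (by grind)).trans (j'.symm.mono (by grind))
          · refine .trans (j'.mono (by grind)) (.single hab.symm ⟨hb, by grind⟩ ⟨ha, by grind⟩))
      obtain ⟨τ, hτ, h1, h2⟩ := hρ.glue (hσ.mono_graph le_sup_left) (w := w) (a := a) (b := b)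
        (by grind) hρa hρw hσw hσb ⟨ha, hXa⟩ (.inr hbX) ⟨hw, hXw⟩ (.inl rfl) hwb
        (fun x hx y hy hxw hyw hxy => hadj x hx y (hy.resolve_left hyw) hxw hxy)
      have hU : S \ X ∪ insert w X = S := by grind
      rw [hU] at hτ h1 h2
      exact ⟨τ, hτ, h1, h2⟩
    · push Not at hN
      set X := {y | Joined G (S \ {a}) b y} with hX
      have hbX : b ∈ X := .refl hbA
      have hXS : X ⊆ S := fun y hy => (hy : Joined _ _ _ _).mem_right.1
      have hXa : a ∉ X := fun h' => (h' : Joined _ _ _ _).mem_right.2 (by simp)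
      obtain ⟨ρ, hρ⟩ := ihT G S (S \ X) hS ⟨Set.sdiff_subset, fun h => (h hb).2 hbX⟩ hQ
      obtain ⟨σ, hσ⟩ := ihT G S X hS ⟨hXS, fun h => hXa (h ha)⟩ hQ
      obtain ⟨ρ', hρ', hρa⟩ := hρ.rotate (a := a)
      obtain ⟨σ', hσ', hσb⟩ := hσ.rotate_last (a := b)
      -- Here `ab` is the only edge between the two pieces.
      obtain ⟨τ, hτ, h1, h2⟩ := hρ'.append hσ' Set.disjoint_sdiff_left (fun x _ => hρa x) hσb
        ⟨ha, hXa⟩ hbX (by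
          intro x hx y hy hxy
          by_cases hxa : x = a
          · subst hxa
            refine ⟨rfl, ?_⟩
            by_contra hyb
            exact hN y hxy hyb (hy : Joined _ _ _ _).symm
          · exact (hx.2 ((hy : Joined _ _ _ _).tail hxy.symm ⟨hx.1, by simp [hxa]⟩)).elim)
      have hU : S \ X ∪ X = S := by grind
      rw [hU] at hτ h1 h2
      exact ⟨τ, hτ, h1, h2⟩
  refine ⟨fun G S hS hQ => ?_, rooted⟩
  rcases S.eq_empty_or_nonempty with rfl | ⟨a, ha⟩
  · exact ⟨fun _ => 0, by simp, by simp⟩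
  by_cases hN : ∃ c ∈ S, G.Adj a c
  · obtain ⟨c, hc, hac⟩ := hN
    set K := {y | Joined G (S \ {a}) c y} with hK
    have hcK : c ∈ K := .refl ⟨hc, hac.ne'⟩
    have hKS : K ⊆ S := fun y hy => (hy : Joined _ _ _ _).mem_right.1
    have hKa : a ∉ K := fun h' => (h' : Joined _ _ _ _).mem_right.2 (by simp)
    by_cases hconn : ∀ z ∈ S \ {a}, Joined G (S \ {a}) c z
    · obtain ⟨b, hb, hab, hout⟩ := exists_outerAt hQ ha hc hac hconn
      obtain ⟨ρ, hρ, -⟩ := rooted G S a b hS ha hb hab hQ hout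
      exact ⟨ρ, hρ⟩
    · push Not at hconn
      obtain ⟨z, hz, hzK⟩ := hconn
      obtain ⟨ρ, hρ⟩ := ihT G S (insert a K) hS ⟨Set.insert_subset ha hKS, fun h => by
        rcases h hz.1 with h | h
        exacts [hz.2 h, hzK h]⟩ hQ
      obtain ⟨σ, hσ⟩ := ihT G S (S \ K) hS ⟨Set.sdiff_subset, fun h => (h hc).2 hcK⟩ hQ
      obtain ⟨ρ', hρ', hρa⟩ := hρ.rotate (a := a)
      obtain ⟨σ', hσ', hσa⟩ := hσ.rotate (a := a)
      obtain ⟨τ, hτ⟩ := hρ'.union_cut hσ' (fun x _ => hρa x) (fun x _ => hσa x) (.inl rfl)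
        ⟨ha, hKa⟩ (by
          intro x hx y hy hyK hxy
          rcases hx with hx | hx
          · exact hx
          · exact (hyK (.inr ((hx : Joined _ _ _ _).tail hxy ⟨hy.1, by grind⟩))).elim)
      have hU : insert a K ∪ S \ K = S := by grind
      rw [hU] at hτ
      exact ⟨τ, hτ⟩
  · push Not at hN
    classical
    obtain ⟨ρ, hρ⟩ := ihT G S (S \ {a}) hS ⟨Set.sdiff_subset, fun h => (h ha).2 rfl⟩ hQ
    refine ⟨fun x => if x = a then 0 else ρ x + 1, ⟨?_, ?_⟩⟩
    · intro x hx y hy hxy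
      have := hρ.inj x; have := hρ.inj y
      grind
    · intro p hp q hq r hr s hs h1 h2 h3 e1 e2
      have hpa : p ≠ a := by rintro rfl; exact hN r hr e1
      have hqa : q ≠ a := by rintro rfl; exact hN s hs e2
      have hra : r ≠ a := by rintro rfl; exact hN p hp e1.symm
      have hsa : s ≠ a := by rintro rfl; exact hN q hq e2.symm
      simp only [hpa, hqa, hra, hsa, if_false] at h1 h2 h3
      exact hρ.not_cross p ⟨hp, hpa⟩ q ⟨hq, hqa⟩ r ⟨hr, hra⟩ s ⟨hs, hsa⟩ (by omega) (by omega)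
        (by omega) e1 e2

/-- A graph is noncrossing for some ranking if at each vertex, one of any three neighbours
separates the other two. -/
theorem TripodFree.exists_noncrossingOn {G : SimpleGraph V} {S : Set V} (h : TripodFree G S) :
    ∃ ρ, NoncrossingOn G S ρ :=
  (exists_noncrossingOn_aux S.ncard).1 G S rfl h

end Ranking

/-! ### Angles under which segments and closed walks are seen. -/

section AngleSums

open Filter Topology Bornology

/-- The two ends are seen in opposite directions only from points of the segment, so the principal
argument has no other discontinuities. -/
theorem div_mem_slitPlane_of_notMem_segment {a b z : ℂ} (h : z ∉ segment ℝ a b) :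
    (b - z) / (a - z) ∈ Complex.slitPlane := by
  have ha : a - z ≠ 0 := fun h' => h (by rw [← sub_eq_zero.1 h']; exact left_mem_segment _ _ _)
  by_contra hs
  rw [Complex.mem_slitPlane_iff, not_or, not_lt, not_not] at hs
  set q := (b - z) / (a - z) with hq
  have hqr : q = (q.re : ℂ) := Complex.ext (by simp) (by simpa using hs.2)
  have h1 : b - z = q.re * (a - z) := by
    rw [← hqr, hq]
    field_simp
  have hpos : 0 < 1 - q.re := by linarith [hs.1]
  refine h ⟨-q.re / (1 - q.re), 1 / (1 - q.re), div_nonneg (by linarith [hs.1]) hpos.le,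
    by positivity, by field_simp; ring, ?_⟩
  have hpos' : (1 - q.re : ℂ) ≠ 0 := by exact_mod_cast hpos.ne'
  simp only [Complex.real_smul]
  push_cast
  field_simp
  linear_combination h1

theorem continuousAt_arg_div {a b z : ℂ} (h : z ∉ segment ℝ a b) :
    ContinuousAt (fun z => Complex.arg ((b - z) / (a - z))) z := by
  have ha : a - z ≠ 0 := fun h' => h (by rw [← sub_eq_zero.1 h']; exact left_mem_segment _ _ _)
  exact ContinuousAt.comp (g := Complex.arg)
    (Complex.continuousAt_arg (div_mem_slitPlane_of_notMem_segment h))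
    (ContinuousAt.div (by fun_prop) (by fun_prop) ha)

theorem coe_arg_div {a b z : ℂ} (ha : z ≠ a) (hb : z ≠ b) :
    (Complex.arg ((b - z) / (a - z)) : Real.Angle) = Complex.arg (b - z) - Complex.arg (a - z) :=
  Complex.arg_div_coe_angle (sub_ne_zero.2 hb.symm) (sub_ne_zero.2 ha.symm)

theorem tendsto_arg_div (a b : ℂ) :
    Tendsto (fun z => Complex.arg ((b - z) / (a - z))) (cobounded ℂ) (𝓝 0) := by
  have h1 : Tendsto (fun z : ℂ => a - z) (cobounded ℂ) (cobounded ℂ) := by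
    have := (tendsto_const_sub_cobounded a : Tendsto (fun z : ℂ => a - z) _ _)
    exact this
  have h2 : Tendsto (fun z : ℂ => 1 + (b - a) * (a - z)⁻¹) (cobounded ℂ) (𝓝 1) := by
    simpa using ((tendsto_inv₀_cobounded.comp h1).const_mul (b - a)).const_add 1
  have h3 : Tendsto (fun z => (b - z) / (a - z)) (cobounded ℂ) (𝓝 1) := by
    refine h2.congr' ?_
    have hne : ∀ᶠ z : ℂ in cobounded ℂ, z ≠ a := (eventually_ne_cobounded a)
    filter_upwards [hne] with z hz
    have := sub_ne_zero.2 hz.symm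
    field_simp
    ring
  have := (Complex.continuousAt_arg (x := 1) (by simp)).tendsto.comp h3
  simpa [Function.comp_def] using this

theorem eq_zero_of_angle {x : ℝ} (h : (x : Real.Angle) = 0) (hx : |x| < 2 * Real.pi) : x = 0 := by
  obtain ⟨n, rfl⟩ := Real.Angle.coe_eq_zero_iff.1 h
  have hn : n = 0 := by
    by_contra hn
    have h1 : (1 : ℝ) ≤ |(n : ℝ)| := by exact_mod_cast Int.one_le_abs hn
    have h2 : |n • (2 * Real.pi)| = |(n : ℝ)| * (2 * Real.pi) := by
      rw [zsmul_eq_mul, abs_mul, abs_of_pos Real.two_pi_pos]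
    nlinarith [Real.pi_pos]
  simp [hn]

/-- A continuous function whose values are multiples of 2π is constant on a connected set; this
replaces the theory of winding numbers. -/
theorem eq_of_angle_on_preconnected {X : Type*} [TopologicalSpace X] {C : Set X} {W : X → ℝ}
    (hC : IsPreconnected C) (hW : ContinuousOn W C) (h0 : ∀ z ∈ C, (W z : Real.Angle) = 0)
    {x y : X} (hx : x ∈ C) (hy : y ∈ C) : W x = W y := by
  by_contra hne
  wlog hlt : W x < W y generalizing x y
  · exact this hy hx (Ne.symm hne) (lt_of_le_of_ne (not_lt.1 hlt) (Ne.symm hne))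
  have h2 : W x + Real.pi ≤ W y := by
    by_contra h
    push Not at h
    have : W y - W x = 0 := eq_zero_of_angle (by
      rw [Real.Angle.coe_sub, h0 _ hx, h0 _ hy, sub_zero]) (by
      rw [abs_of_pos (by linarith)]; linarith [Real.pi_pos])
    exact hne (by linarith)
  -- Distinct values differ by at least 2π, so a value half a turn above `W x` would be attained,
  -- which is not a multiple of 2π.
  obtain ⟨z, hz, hz'⟩ := hC.intermediate_value hx hy hW
    (show W x + Real.pi ∈ Set.Icc _ _ from ⟨by linarith [Real.pi_pos], h2⟩)
  have h3 := h0 z hz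
  rw [hz', Real.Angle.coe_add, h0 x hx, zero_add] at h3
  exact Real.Angle.pi_ne_zero h3

theorem eq_zero_on_unbounded {C : Set ℂ} {W : ℂ → ℝ}
    (hC : IsPreconnected C) (hb : ¬ IsBounded C) (hW : ContinuousOn W C)
    (h0 : ∀ z ∈ C, (W z : Real.Angle) = 0) (hlim : Tendsto W (cobounded ℂ) (𝓝 0))
    {x : ℂ} (hx : x ∈ C) : W x = 0 := by
  by_contra hne
  have h1 : ∀ᶠ z in cobounded ℂ, |W z| < |W x| :=
    hlim.abs.eventually_lt_const (by simpa using hne)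
  have h2 : IsBounded {z | ¬ |W z| < |W x|} := by
    rw [isBounded_def]
    filter_upwards [h1] with z hz
    simpa using hz
  refine hb (h2.subset fun z hz => ?_)
  simp [eq_of_angle_on_preconnected hC hW h0 hz hx]

end AngleSums

/-! ### The jump of the angle across a segment. -/

section JumpLemma

open Filter Topology

theorem exp_mul_I_eq_iff {θ η : ℝ} (h : |θ - η| < 2 * Real.pi)
    (he : Complex.exp (θ * Complex.I) = Complex.exp (η * Complex.I)) : θ = η := by
  have h1 : (θ : Real.Angle) = η := by
    have h2 := congrArg Complex.re he
    have h3 := congrArg Complex.im he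
    rw [Complex.exp_ofReal_mul_I_re, Complex.exp_ofReal_mul_I_re] at h2
    rw [Complex.exp_ofReal_mul_I_im, Complex.exp_ofReal_mul_I_im] at h3
    exact Real.Angle.cos_sin_inj h2 h3
  have := eq_zero_of_angle (x := θ - η) (by rw [Real.Angle.coe_sub, h1, sub_self]) h
  linarith

/-- The angle under which the segment from `0` to `β` is seen from the point with polar
coordinates `s`, `θ`. -/
noncomputable def sightAngle (β : ℂ) (s θ : ℝ) : ℝ :=
  Complex.arg (1 - β / (s * Complex.exp (θ * Complex.I)))

/-- The circle of radius `s` meets the segment from the origin in a single direction, and only there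
can the principal argument jump. -/
theorem continuousAt_sightAngle {ρ η s θ : ℝ} (hs : 0 < s) (hρ : s < ρ)
    (h : Complex.exp (θ * Complex.I) ≠ Complex.exp (η * Complex.I)) :
    ContinuousAt (sightAngle (ρ * Complex.exp (η * Complex.I)) s) θ := by
  have hs' : (s : ℂ) ≠ 0 := by exact_mod_cast hs.ne'
  have hne : ∀ θ : ℝ, (s : ℂ) * Complex.exp (θ * Complex.I) ≠ 0 := fun θ =>
    mul_ne_zero hs' (Complex.exp_ne_zero _)
  refine ContinuousAt.comp (g := Complex.arg) (Complex.continuousAt_arg ?_)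
    (ContinuousAt.sub (by fun_prop) (ContinuousAt.div (by fun_prop) (by fun_prop) (hne θ)))
  rw [Complex.mem_slitPlane_iff]
  by_contra hcon
  rw [not_or, not_lt, not_not] at hcon
  have key : (ρ * Complex.exp (η * Complex.I)) / (s * Complex.exp (θ * Complex.I)) =
      ((ρ / s : ℝ) : ℂ) * Complex.exp ((η - θ : ℝ) * Complex.I) := by
    push_cast
    rw [sub_mul, Complex.exp_sub]
    field_simp
  rw [key] at hcon
  have him := hcon.2
  rw [Complex.sub_im, Complex.im_ofReal_mul, Complex.exp_ofReal_mul_I_im] at him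
  have hre := hcon.1
  rw [Complex.sub_re, Complex.re_ofReal_mul, Complex.exp_ofReal_mul_I_re] at hre
  have hpos : 0 < ρ / s := by have : 0 < ρ := hs.trans hρ; positivity
  have hsin : Real.sin (η - θ) = 0 := by
    simp only [Complex.one_im, zero_sub, neg_eq_zero, mul_eq_zero] at him
    exact him.resolve_left hpos.ne'
  have hcos : 0 < Real.cos (η - θ) := by
    simp only [Complex.one_re] at hre
    by_contra hc
    nlinarith
  have hcos1 : Real.cos (η - θ) = 1 := by
    have := Real.sin_sq_add_cos_sq (η - θ)
    rw [hsin] at this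
    nlinarith
  apply h
  have h1 : Complex.exp ((η - θ : ℝ) * Complex.I) = 1 := by
    apply Complex.ext
    · rw [Complex.exp_ofReal_mul_I_re, hcos1, Complex.one_re]
    · rw [Complex.exp_ofReal_mul_I_im, hsin, Complex.one_im]
  push_cast at h1
  rw [sub_mul, Complex.exp_sub, div_eq_one_iff_eq (Complex.exp_ne_zero _)] at h1
  exact h1.symm

theorem sightAngle_one_eq (s θ : ℝ) :
    (1 : ℂ) - 1 / (s * Complex.exp (θ * Complex.I)) =
      ⟨1 - s⁻¹ * Real.cos θ, s⁻¹ * Real.sin θ⟩ := by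
  have : (1 : ℂ) / (s * Complex.exp (θ * Complex.I)) =
      ((s⁻¹ : ℝ) : ℂ) * Complex.exp ((-θ : ℝ) * Complex.I) := by
    push_cast
    rw [neg_mul, Complex.exp_neg, one_div, mul_inv]
  rw [this]
  apply Complex.ext
  · rw [Complex.sub_re, Complex.re_ofReal_mul, Complex.exp_ofReal_mul_I_re, Real.cos_neg]
    simp
  · rw [Complex.sub_im, Complex.im_ofReal_mul, Complex.exp_ofReal_mul_I_im, Real.sin_neg]
    simp

/-- As the unit segment is approached from above, the argument approaches the negative real axis
through the upper half-plane. From below the limit is the opposite one, so the jump is a full turn.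
-/
theorem tendsto_sightAngle_right {s : ℝ} (hs : 0 < s) (hs1 : s < 1) :
    Tendsto (sightAngle 1 s) (𝓝[>] 0) (𝓝 Real.pi) := by
  have hz : (1 : ℝ) - s⁻¹ < 0 := by
    have := (one_lt_inv₀ hs).2 hs1
    linarith
  have h1 := Complex.tendsto_arg_nhdsWithin_im_nonneg_of_re_neg_of_im_zero
    (z := ((1 - s⁻¹ : ℝ) : ℂ)) (by simpa using hz) (by simp)
  have hc : Continuous fun θ : ℝ =>
      (⟨1 - s⁻¹ * Real.cos θ, s⁻¹ * Real.sin θ⟩ : ℂ) := by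
    have : (fun θ : ℝ => (⟨1 - s⁻¹ * Real.cos θ, s⁻¹ * Real.sin θ⟩ : ℂ)) = fun θ : ℝ =>
      ((1 - s⁻¹ * Real.cos θ : ℝ) : ℂ) + ((s⁻¹ * Real.sin θ : ℝ) : ℂ) * Complex.I := by
      funext θ
      exact Complex.mk_eq_add_mul_I _ _
    rw [this]
    fun_prop
  have h2 : sightAngle 1 s = fun θ => Complex.arg ⟨1 - s⁻¹ * Real.cos θ, s⁻¹ * Real.sin θ⟩ := by
    funext θ
    rw [sightAngle, sightAngle_one_eq]
  rw [h2]
  refine h1.comp (tendsto_nhdsWithin_iff.2 ⟨?_, ?_⟩)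
  · have := (hc.tendsto 0).mono_left (nhdsWithin_le_nhds (s := Set.Ioi 0))
    convert this using 2
    apply Complex.ext <;> simp
  · filter_upwards [Ioo_mem_nhdsGT Real.pi_pos] with θ hθ
    exact mul_nonneg (inv_nonneg.2 hs.le) (Real.sin_pos_of_pos_of_lt_pi hθ.1 hθ.2).le

theorem tendsto_sightAngle_left {s : ℝ} (hs : 0 < s) (hs1 : s < 1) :
    Tendsto (sightAngle 1 s) (𝓝[<] 0) (𝓝 (-Real.pi)) := by
  have hz : (1 : ℝ) - s⁻¹ < 0 := by
    have := (one_lt_inv₀ hs).2 hs1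
    linarith
  have h0 : Tendsto (fun θ : ℝ => -θ) (𝓝[<] 0) (𝓝[>] 0) := by
    simpa using tendsto_neg_nhdsLT (a := (0 : ℝ))
  have h1 := (tendsto_sightAngle_right hs hs1).neg.comp h0
  refine h1.congr' ?_
  filter_upwards [Ioo_mem_nhdsLT (show -Real.pi < (0 : ℝ) by linarith [Real.pi_pos])] with θ hθ
  simp only [Function.comp, sightAngle, sightAngle_one_eq]
  have h3 : (⟨1 - s⁻¹ * Real.cos (-θ), s⁻¹ * Real.sin (-θ)⟩ : ℂ) =
      (starRingEnd ℂ) ⟨1 - s⁻¹ * Real.cos θ, s⁻¹ * Real.sin θ⟩ := by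
    apply Complex.ext <;> simp
  rw [h3, Complex.arg_conj, if_neg, neg_neg]
  rw [Complex.arg_eq_pi_iff]
  rintro ⟨-, h4⟩
  have h5 : Real.sin θ < 0 := Real.sin_neg_of_neg_of_neg_pi_lt hθ.2 hθ.1
  have : s⁻¹ * Real.sin θ < 0 := mul_neg_of_pos_of_neg (inv_pos.2 hs) h5
  exact this.ne h4

theorem sightAngle_periodic (β : ℂ) (s : ℝ) : Function.Periodic (sightAngle β s) (2 * Real.pi) := by
  intro θ
  simp only [sightAngle]
  push_cast
  rw [add_mul, Complex.exp_add, Complex.exp_two_pi_mul_I, mul_one]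

/-- Three angle functions around a small circle cannot all vanish as three closed curves through
its centre would make them. -/
theorem false_of_circle_angles {s ρ₂ ρ₃ θ₂ θ₃ : ℝ} (hs : 0 < s) (hs1 : s < 1) (hρ₂ : s < ρ₂)
    (hρ₃ : s < ρ₃) (h₂ : 0 < θ₂) (h₂₃ : θ₂ < θ₃) (h₃ : θ₃ < 2 * Real.pi)
    {f₁₂ f₂₃ f₃₁ γ₂ γ₃ : ℝ → ℝ}
    (hγ₂ : γ₂ = sightAngle (ρ₂ * Complex.exp (θ₂ * Complex.I)) s)
    (hγ₃ : γ₃ = sightAngle (ρ₃ * Complex.exp (θ₃ * Complex.I)) s)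
    (c₁₂ : Continuous f₁₂) (c₂₃ : Continuous f₂₃) (c₃₁ : Continuous f₃₁)
    (p₁₂ : Function.Periodic f₁₂ (2 * Real.pi))
    (a₁₂ : ∀ θ, ((f₁₂ θ + sightAngle 1 s θ - γ₂ θ : ℝ) : Real.Angle) = 0)
    (a₂₃ : ∀ θ, ((f₂₃ θ + γ₂ θ - γ₃ θ : ℝ) : Real.Angle) = 0)
    (a₃₁ : ∀ θ, ((f₃₁ θ + γ₃ θ - sightAngle 1 s θ : ℝ) : Real.Angle) = 0)
    (hsum : ∀ θ, f₁₂ θ + f₂₃ θ + f₃₁ θ = 0)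
    (z₂₃ : f₂₃ 0 + γ₂ 0 - γ₃ 0 = 0) (z₃₁ : f₃₁ θ₂ + γ₃ θ₂ - sightAngle 1 s θ₂ = 0)
    (z₁₂ : f₁₂ θ₃ + sightAngle 1 s θ₃ - γ₂ θ₃ = 0) : False := by
  have hγ1 : ∀ θ : ℝ, 0 < θ → θ < 2 * Real.pi → ContinuousAt (sightAngle 1 s) θ := by
    intro θ h0 h1
    have := continuousAt_sightAngle (ρ := 1) (η := 0) (θ := θ) hs hs1 (fun he => by
      have := exp_mul_I_eq_iff (θ := θ) (η := 0) (by rw [sub_zero, abs_of_pos h0]; exact h1) he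
      linarith)
    simpa using this
  have hγ2 : ∀ θ : ℝ, |θ - θ₂| < 2 * Real.pi → θ ≠ θ₂ → ContinuousAt γ₂ θ := fun θ h h' =>
    hγ₂ ▸ continuousAt_sightAngle hs hρ₂ fun he => h' (exp_mul_I_eq_iff h he)
  have hγ3 : ∀ θ : ℝ, |θ - θ₃| < 2 * Real.pi → θ ≠ θ₃ → ContinuousAt γ₃ θ := fun θ h h' =>
    hγ₃ ▸ continuousAt_sightAngle hs hρ₃ fun he => h' (exp_mul_I_eq_iff h he)
  -- the second curve pair near the direction `0`
  have hW23 : ∀ᶠ θ in 𝓝 (0 : ℝ), f₂₃ θ + γ₂ θ - γ₃ θ = 0 := by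
    have hc : ContinuousAt (fun θ => f₂₃ θ + γ₂ θ - γ₃ θ) 0 :=
      (c₂₃.continuousAt.add (hγ2 0 (by rw [zero_sub, abs_neg, abs_of_pos h₂]; linarith)
        h₂.ne)).sub (hγ3 0 (by rw [zero_sub, abs_neg, abs_of_pos (h₂.trans h₂₃)]; linarith)
        (h₂.trans h₂₃).ne)
    have h1 : Tendsto (fun θ => |f₂₃ θ + γ₂ θ - γ₃ θ|) (𝓝 0) (𝓝 0) := by
      have := hc.abs.tendsto
      rwa [z₂₃, abs_zero] at this
    filter_upwards [h1.eventually (gt_mem_nhds Real.two_pi_pos)] with θ hθ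
    exact eq_zero_of_angle (a₂₃ θ) hθ
  -- This pair jumps only in the directions `0` and `θ₃`, so its zero at `θ₂` spreads back to `0`.
  have hW31 : ∀ θ ∈ Set.Ioc 0 θ₂, f₃₁ θ + γ₃ θ - sightAngle 1 s θ = 0 := by
    intro θ hθ
    rw [← z₃₁]
    refine eq_of_angle_on_preconnected isPreconnected_Ioc (fun x hx => ?_) (fun x _ => a₃₁ x)
      hθ (Set.right_mem_Ioc.2 h₂)
    exact ((c₃₁.continuousAt.add (hγ3 x (by rw [abs_lt]; constructor <;> linarith [hx.1, hx.2])
      (by linarith [hx.2] : x < θ₃).ne)).sub (hγ1 x hx.1 (by linarith [hx.2]))).continuousWithinAt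
  have hW12 : ∀ θ ∈ Set.Ico θ₃ (2 * Real.pi), f₁₂ θ + sightAngle 1 s θ - γ₂ θ = 0 := by
    intro θ hθ
    rw [← z₁₂]
    refine eq_of_angle_on_preconnected isPreconnected_Ico (fun x hx => ?_) (fun x _ => a₁₂ x)
      hθ (Set.left_mem_Ico.2 h₃)
    exact ((c₁₂.continuousAt.add (hγ1 x (by linarith [hx.1]) hx.2)).sub
      (hγ2 x (by rw [abs_lt]; constructor <;> linarith [hx.1, hx.2])
      (by linarith [hx.1] : θ₂ < x).ne')).continuousWithinAt
  have hcont : ContinuousAt (fun θ => γ₂ θ - f₁₂ θ) 0 :=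
    (hγ2 0 (by rw [zero_sub, abs_neg, abs_of_pos h₂]; linarith) h₂.ne).sub c₁₂.continuousAt
  -- To the right of `0` two of the pairs vanish, hence also the third, because all three add up to
  -- zero.
  have hright : Tendsto (sightAngle 1 s) (𝓝[>] 0) (𝓝 (γ₂ 0 - f₁₂ 0)) := by
    refine (hcont.tendsto.mono_left nhdsWithin_le_nhds).congr' ?_
    filter_upwards [hW23.filter_mono nhdsWithin_le_nhds, Ioc_mem_nhdsGT h₂] with θ h1 h2
    have := hW31 θ h2
    have := hsum θ
    linarith
  -- To the left of `0`, the first pair vanishes by its values just below a full turn.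
  have hleft : Tendsto (sightAngle 1 s) (𝓝[<] 0) (𝓝 (γ₂ 0 - f₁₂ 0)) := by
    refine (hcont.tendsto.mono_left nhdsWithin_le_nhds).congr' ?_
    filter_upwards [Ico_mem_nhdsLT (show θ₃ - 2 * Real.pi < 0 by linarith)] with θ h1
    have h2 := hW12 (θ + 2 * Real.pi) ⟨by linarith [h1.1], by linarith [h1.2]⟩
    rw [p₁₂, hγ₂, sightAngle_periodic, sightAngle_periodic] at h2
    rw [hγ₂]
    linarith
  have e1 := tendsto_nhds_unique hright (tendsto_sightAngle_right hs hs1)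
  have e2 := tendsto_nhds_unique hleft (tendsto_sightAngle_left hs hs1)
  linarith [Real.pi_pos]

end JumpLemma

/-! ### Drawings with all vertices on the outer face contain no tripods. -/

section OuterDrawing

open Filter Topology Bornology

variable {V : Type*}

/-- `z` is off the drawing of the subgraph of `G` induced by `A`. -/
structure Avoids (G : SimpleGraph V) (P : V → ℂ) (A : Set V) (z : ℂ) : Prop where
  vertex : ∀ s ∈ A, z ≠ P s
  edge : ∀ s ∈ A, ∀ t ∈ A, G.Adj s t → z ∉ segment ℝ (P s) (P t)

theorem Avoids.mono {G : SimpleGraph V} {P : V → ℂ} {A B : Set V} {z : ℂ} (h : Avoids G P B z)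
    (hA : A ⊆ B) : Avoids G P A z :=
  ⟨fun s hs => h.vertex s (hA hs), fun s hs t ht => h.edge s (hA hs) t (hA ht)⟩

theorem Avoids.eventually [Finite V] {G : SimpleGraph V} {P : V → ℂ} {A : Set V} {z : ℂ}
    (h : Avoids G P A z) : ∀ᶠ w in 𝓝 z, Avoids G P A w := by
  have h1 : ∀ᶠ w in 𝓝 z, ∀ s, s ∈ A → w ≠ P s := eventually_all.2 fun s => by
    by_cases hs : s ∈ A
    · filter_upwards [isOpen_ne.mem_nhds (h.vertex s hs)] with w hw _ using hw
    · exact .of_forall fun w h => (hs h).elim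
  have h2 : ∀ᶠ w in 𝓝 z, ∀ s t, s ∈ A → t ∈ A → G.Adj s t → w ∉ segment ℝ (P s) (P t) :=
    eventually_all.2 fun s => eventually_all.2 fun t => by
      by_cases hst : s ∈ A ∧ t ∈ A ∧ G.Adj s t
      · have hclosed : IsClosed (segment ℝ (P s) (P t)) := by
          rw [← convexHull_pair (𝕜 := ℝ)]
          exact ((Set.toFinite {P s, P t}).isCompact_convexHull ℝ).isClosed
        filter_upwards [hclosed.isOpen_compl.mem_nhds (h.edge s hst.1 t hst.2.1 hst.2.2)]
          with w hw _ _ _ using hw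
      · exact .of_forall fun w h1 h2 h3 => (hst ⟨h1, h2, h3⟩).elim
  filter_upwards [h1, h2] with w hw1 hw2
  exact ⟨hw1, fun s hs t ht hst => hw2 s t hs ht hst⟩

/-- `f` is the angle under which a walk from `x` to `y` inside `A` is seen. -/
structure IsPathAngle (G : SimpleGraph V) (P : V → ℂ) (A : Set V) (x y : V) (f : ℂ → ℝ) :
    Prop where
  lim : Tendsto f (cobounded ℂ) (𝓝 0)
  cont : ∀ z, Avoids G P A z → ContinuousAt f z
  angle : ∀ z, Avoids G P A z →
    (f z : Real.Angle) = Complex.arg (P y - z) - Complex.arg (P x - z)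

/-- The principal angles of the successive edges are added. The sum is an honest real number, while
only its class modulo 2π is determined by the ends. -/
theorem Joined.exists_isPathAngle {G : SimpleGraph V} (P : V → ℂ) {A : Set V} {x y : V}
    (h : Joined G A x y) : ∃ f, IsPathAngle G P A x y f := by
  obtain ⟨hx, h⟩ := h
  induction h with
  | refl => exact ⟨fun _ => 0, tendsto_const_nhds, fun _ _ => continuousAt_const, by simp⟩
  | @tail s t hs hst ih =>
    obtain ⟨f, hf⟩ := ih
    have hsA : s ∈ A := Joined.mem_right ⟨hx, hs⟩
    refine ⟨fun z => f z + Complex.arg ((P t - z) / (P s - z)), ?_, fun z hz => ?_,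
      fun z hz => ?_⟩
    · simpa using hf.lim.add (tendsto_arg_div (P s) (P t))
    · exact (hf.cont z hz).add (continuousAt_arg_div (hz.edge s hsA t hst.2 hst.1))
    · rw [Real.Angle.coe_add, hf.angle z hz,
        coe_arg_div (hz.vertex s hsA) (hz.vertex t hst.2)]
      abel

/-- A planar straight-line drawing in the complex plane, with a set `O` of points outside whose
closure contains all vertices. -/
structure OuterDrawing (G : SimpleGraph V) (P : V → ℂ) (O : Set ℂ) : Prop where
  inj : Function.Injective P
  vertex_edge : ∀ u v w, G.Adj u v → P w ∈ segment ℝ (P u) (P v) → w = u ∨ w = v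
  edge_edge : ∀ u v x y, G.Adj u v → G.Adj x y → s(u, v) ≠ s(x, y) →
    ∀ z ∈ segment ℝ (P u) (P v), z ∈ segment ℝ (P x) (P y) →
    ∃ w, (w = u ∨ w = v) ∧ (w = x ∨ w = y) ∧ P w = z
  outer : ∀ x ∈ O, ∃ C, IsPreconnected C ∧ x ∈ C ∧ ¬ IsBounded C ∧
    ∀ z ∈ C, Avoids G P Set.univ z
  closure : ∀ v, P v ∈ closure O

namespace OuterDrawing

variable {G : SimpleGraph V} {P : V → ℂ} {O : Set ℂ}

theorem eq_zero_of_closure {v : V} (h : OuterDrawing G P O) {W : ℂ → ℝ}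
    (hc : ContinuousAt W (P v)) (h0 : ∀ z ∈ O, W z = 0) : W (P v) = 0 := by
  by_contra hne
  have h1 := hc.eventually_ne hne
  have h2 := mem_closure_iff_frequently.1 (h.closure v)
  obtain ⟨z, hz, hz'⟩ := (h2.and_eventually h1).exists
  exact hz' (h0 z hz)

theorem edge_inter (h : OuterDrawing G P O) {u b c : V} (hb : G.Adj u b) (hc : G.Adj u c)
    (hbc : b ≠ c) {z : ℂ} (hz : z ∈ segment ℝ (P u) (P b)) (hz' : z ∈ segment ℝ (P u) (P c)) :
    z = P u := by
  obtain ⟨w, h1, h2, rfl⟩ := h.edge_edge u b u c hb hc (by simp [hbc, hc.ne]) z hz hz'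
  congr 1
  have := hb.ne; have := hc.ne
  grind

theorem avoids_of_mem (h : OuterDrawing G P O) {u b : V} (hb : G.Adj u b) {z : ℂ}
    (hz : z ∈ segment ℝ (P u) (P b)) : Avoids G P (Set.univ \ {u, b}) z := by
  refine ⟨?_, ?_⟩
  · rintro s hs rfl
    have := h.vertex_edge u b s hb hz
    grind
  · intro s hs t ht hst hz'
    have hne : s(u, b) ≠ s(s, t) := by
      rw [Ne, Sym2.eq_iff]
      grind
    obtain ⟨w, h1, h2, -⟩ := h.edge_edge u b s t hb hst hne z hz hz'
    grind

theorem avoids_vertex (h : OuterDrawing G P O) (u : V) : Avoids G P (Set.univ \ {u}) (P u) := by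
  refine ⟨fun s hs hsu => hs.2 (h.inj hsu).symm, fun s hs t ht hst hz => ?_⟩
  have := h.vertex_edge s t u hst hz
  grind

section Pair

variable {u b c d : V} {f : ℂ → ℝ}

/-- The angle of the closed walk `u c … d u`. -/
noncomputable def loopAngle (P : V → ℂ) (u c d : V) (f : ℂ → ℝ) (z : ℂ) : ℝ :=
  f z + Complex.arg ((P c - z) / (P u - z)) - Complex.arg ((P d - z) / (P u - z))

theorem loopAngle_angle {A : Set V} (hf : IsPathAngle G P A c d f) (hc : c ∈ A) (hd : d ∈ A)
    {z : ℂ} (hz : Avoids G P A z) (hu : z ≠ P u) :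
    (loopAngle P u c d f z : Real.Angle) = 0 := by
  rw [loopAngle, Real.Angle.coe_sub, Real.Angle.coe_add, hf.angle z hz,
    coe_arg_div hu (hz.vertex c hc), coe_arg_div hu (hz.vertex d hd)]
  abel

theorem loopAngle_cont {A : Set V} (hf : IsPathAngle G P A c d f)
    {z : ℂ} (hz : Avoids G P A z) (h1 : z ∉ segment ℝ (P u) (P c))
    (h2 : z ∉ segment ℝ (P u) (P d)) : ContinuousAt (loopAngle P u c d f) z :=
  ((hf.cont z hz).add (continuousAt_arg_div h1)).sub (continuousAt_arg_div h2)

/-- A closed walk is seen under a multiple of 2π, which is constant on an unbounded connected set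
off the drawing and tends to 0 far away. -/
theorem loopAngle_outer (h : OuterDrawing G P O) {A : Set V} (hf : IsPathAngle G P A c d f)
    (hcA : c ∈ A) (hdA : d ∈ A) (hc : G.Adj u c) (hd : G.Adj u d) {z : ℂ} (hz : z ∈ O) :
    loopAngle P u c d f z = 0 := by
  obtain ⟨C, hC, hzC, hb, hav⟩ := h.outer z hz
  refine eq_zero_on_unbounded hC hb (fun w hw => ?_) (fun w hw => ?_) ?_ hzC
  · exact (loopAngle_cont hf ((hav w hw).mono (Set.subset_univ _))
      ((hav w hw).edge u trivial c trivial hc)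
      ((hav w hw).edge u trivial d trivial hd)).continuousWithinAt
  · exact loopAngle_angle hf hcA hdA ((hav w hw).mono (Set.subset_univ _))
      ((hav w hw).vertex u trivial)
  · show Tendsto (fun z => f z + Complex.arg ((P c - z) / (P u - z)) -
      Complex.arg ((P d - z) / (P u - z))) _ _
    simpa using (hf.lim.add (tendsto_arg_div (P u) (P c))).sub
      (tendsto_arg_div (P u) (P d))

/-- The closed walk meets the edge `ub` at most in `u`. So its angle is constant along the rest of
the edge, and it is 0 at the end `b`, which is a limit of points of the outer face. -/
theorem loopAngle_segment (h : OuterDrawing G P O)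
    (hf : IsPathAngle G P (Set.univ \ {u, b}) c d f) (hb : G.Adj u b) (hc : G.Adj u c)
    (hd : G.Adj u d) (hbc : b ≠ c) (hbd : b ≠ d) {z : ℂ} (hz : z ∈ segment ℝ (P u) (P b))
    (hzu : z ≠ P u) : loopAngle P u c d f z = 0 := by
  have hcA : c ∈ Set.univ \ {u, b} := by have := hc.ne; grind
  have hdA : d ∈ Set.univ \ {u, b} := by have := hd.ne; grind
  -- The part of the edge beyond `z` does not return to `u`.
  have hu : ∀ w ∈ segment ℝ z (P b), w ∈ segment ℝ (P u) (P b) ∧ w ≠ P u := by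
    intro w hw
    refine ⟨(convex_segment _ _).segment_subset hz (right_mem_segment _ _ _) hw, ?_⟩
    rintro rfl
    obtain ⟨α, β, hα, hβ, hαβ, rfl⟩ := hz
    obtain ⟨α', β', hα', hβ', hαβ', he⟩ := hw
    have hub : P b - P u ≠ 0 := sub_ne_zero.2 fun h' => hb.ne (h.inj h').symm
    have e1 : α = 1 - β := by linarith
    have e2 : α' = 1 - β' := by linarith
    subst e1 e2
    have h3 : ((((1 - β') * β + β' : ℝ)) : ℂ) * (P b - P u) = 0 := by
      simp only [Complex.real_smul] at he
      push_cast at he ⊢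
      linear_combination he
    have h4 : (1 - β') * β + β' = 0 := by
      exact_mod_cast (mul_eq_zero.1 h3).resolve_right hub
    have h5 : β' = 0 := by nlinarith [mul_nonneg hα' hβ]
    have h6 : β = 0 := by rw [h5] at h4; linarith
    exact hzu (by rw [h6]; simp)
  have hcont : ∀ w ∈ segment ℝ z (P b), ContinuousAt (loopAngle P u c d f) w := by
    intro w hw
    obtain ⟨h1, h2⟩ := hu w hw
    exact loopAngle_cont hf (h.avoids_of_mem hb h1)
      (fun h' => h2 (h.edge_inter hb hc hbc h1 h')) fun h' => h2 (h.edge_inter hb hd hbd h1 h')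
  have hb0 : loopAngle P u c d f (P b) = 0 :=
    h.eq_zero_of_closure (hcont _ (right_mem_segment _ _ _)) fun w hw =>
      loopAngle_outer h hf hcA hdA hc hd hw
  rw [← hb0]
  refine eq_of_angle_on_preconnected (convex_segment z (P b)).isPreconnected
    (fun w hw => (hcont w hw).continuousWithinAt) (fun w hw => ?_) (left_mem_segment _ _ _)
    (right_mem_segment _ _ _)
  obtain ⟨h1, h2⟩ := hu w hw
  exact loopAngle_angle hf hcA hdA (h.avoids_of_mem hb h1) h2

end Pair

/-- Two edges leaving `u` in the same direction would put the end of the shorter one on the other.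
-/
theorem not_parallel (h : OuterDrawing G P O) {u c d : V} (hc : G.Adj u c) (hd : G.Adj u d)
    (hcd : c ≠ d) {t : ℝ} (ht : 0 < t) : P c - P u ≠ t * (P d - P u) := by
  wlog ht1 : t ≤ 1 generalizing c d t
  · intro he
    refine this hd hc hcd.symm (inv_pos.2 ht) (inv_le_one_of_one_le₀ (by linarith)) ?_
    have : (t : ℂ) ≠ 0 := by exact_mod_cast ht.ne'
    rw [he]
    push_cast
    field_simp
  intro he
  have : P c ∈ segment ℝ (P u) (P d) := by
    refine ⟨1 - t, t, by linarith, ht.le, by ring, ?_⟩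
    simp only [Complex.real_smul]
    push_cast
    linear_combination -he
  have := h.vertex_edge u d c hd this
  have := hc.ne
  grind

theorem exists_polar {β : ℂ} (hβ : β ≠ 0) (h : ∀ t : ℝ, 0 < t → β ≠ t) :
    ∃ ρ θ : ℝ, 0 < ρ ∧ 0 < θ ∧ θ < 2 * Real.pi ∧ β = ρ * Complex.exp (θ * Complex.I) := by
  have hn : 0 < ‖β‖ := norm_pos_iff.2 hβ
  have h1 := Complex.norm_mul_exp_arg_mul_I β
  have h0 : Complex.arg β ≠ 0 := by
    intro h0
    rw [h0] at h1
    simp only [Complex.ofReal_zero, zero_mul, Complex.exp_zero, mul_one] at h1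
    exact h _ hn h1.symm
  have h2 := Complex.neg_pi_lt_arg β
  have h3 := Complex.arg_le_pi β
  rcases lt_or_gt_of_ne h0 with h4 | h4
  · refine ⟨‖β‖, Complex.arg β + 2 * Real.pi, hn, by linarith, by linarith, ?_⟩
    push_cast
    rw [add_mul, Complex.exp_add, Complex.exp_two_pi_mul_I, mul_one, h1]
  · exact ⟨‖β‖, Complex.arg β, hn, h4, by linarith [Real.pi_pos], h1.symm⟩

/-- The three closed walks of a tripod are compared on a small circle around `u`. Each of them has
angle 0 in the direction of the neighbour that it omits, and their sum is 0 on the circle. This is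
what `false_of_circle_angles` excludes. -/
theorem tripodFree [Finite V] (h : OuterDrawing G P O) : TripodFree G Set.univ := by
  intro u b₁ b₂ b₃ _ a₁ a₂ a₃ n₁₂ n₂₃ n₃₁ j₁₂ j₂₃ j₃₁
  obtain ⟨f₁₂, hf₁₂⟩ := j₁₂.exists_isPathAngle P
  obtain ⟨f₂₃, hf₂₃⟩ := j₂₃.exists_isPathAngle P
  obtain ⟨f₃₁, hf₃₁⟩ := j₃₁.exists_isPathAngle P
  set A : Set V := Set.univ \ {u} with hA
  have hsub : ∀ b, (Set.univ \ {u, b} : Set V) ⊆ A := fun b x hx => by grind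
  have hsum : ∀ z, loopAngle P u b₁ b₂ f₁₂ z + loopAngle P u b₂ b₃ f₂₃ z +
      loopAngle P u b₃ b₁ f₃₁ z = f₁₂ z + f₂₃ z + f₃₁ z := fun z => by
    simp only [loopAngle]; ring
  -- The edges at `u` cancel in the sum of the three closed walks. What remains avoids `u`, hence is
  -- continuous there, and vanishes since `u` is a limit of outer points.
  have hF0 : f₁₂ (P u) + f₂₃ (P u) + f₃₁ (P u) = 0 := by
    refine h.eq_zero_of_closure (W := fun z => f₁₂ z + f₂₃ z + f₃₁ z) ?_ fun z hz => ?_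
    · have := h.avoids_vertex u
      exact ((hf₁₂.cont _ (this.mono (hsub _))).add (hf₂₃.cont _ (this.mono (hsub _)))).add
        (hf₃₁.cont _ (this.mono (hsub _)))
    · show f₁₂ z + f₂₃ z + f₃₁ z = 0
      rw [← hsum, loopAngle_outer h hf₁₂ j₁₂.mem_left j₁₂.mem_right a₁ a₂ hz,
        loopAngle_outer h hf₂₃ j₂₃.mem_left j₂₃.mem_right a₂ a₃ hz,
        loopAngle_outer h hf₃₁ j₃₁.mem_left j₃₁.mem_right a₃ a₁ hz]
      simp
  have hnear : ∀ᶠ z in 𝓝 (P u), Avoids G P A z ∧ |f₁₂ z + f₂₃ z + f₃₁ z| < 2 * Real.pi := by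
    have := h.avoids_vertex u
    refine this.eventually.and ?_
    have hc : ContinuousAt (fun z => |f₁₂ z + f₂₃ z + f₃₁ z|) (P u) :=
      (((hf₁₂.cont _ (this.mono (hsub _))).add (hf₂₃.cont _ (this.mono (hsub _)))).add
        (hf₃₁.cont _ (this.mono (hsub _)))).abs
    exact hc.eventually_lt_const (by simpa [hF0] using Real.pi_pos)
  obtain ⟨ε, hε, hball⟩ := Metric.eventually_nhds_iff.1 hnear
  -- The edge to `b₁` serves as unit of length and as direction 0.
  set e := P b₁ - P u with he
  have he0 : e ≠ 0 := sub_ne_zero.2 fun h' => a₁.ne (h.inj h').symm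
  have polar : ∀ b, G.Adj u b → b ≠ b₁ → ∃ ρ θ : ℝ, 0 < ρ ∧ 0 < θ ∧ θ < 2 * Real.pi ∧
      P b - P u = e * (ρ * Complex.exp (θ * Complex.I)) := by
    intro b hb hbb
    have hb0 : P b - P u ≠ 0 := sub_ne_zero.2 fun h' => hb.ne (h.inj h').symm
    obtain ⟨ρ, θ, h1, h2, h3, h4⟩ := exists_polar (β := (P b - P u) / e)
      (div_ne_zero hb0 he0) (fun t ht h' => h.not_parallel hb a₁ hbb ht (by
        rw [div_eq_iff he0] at h'
        exact h'))
    exact ⟨ρ, θ, h1, h2, h3, by rw [← h4]; field_simp⟩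
  obtain ⟨ρ₂, θ₂, hρ₂, hθ₂, hθ₂', hb₂⟩ := polar b₂ a₂ n₁₂.symm
  obtain ⟨ρ₃, θ₃, hρ₃, hθ₃, hθ₃', hb₃⟩ := polar b₃ a₃ n₃₁
  have hne : θ₂ ≠ θ₃ := by
    rintro rfl
    refine h.not_parallel a₂ a₃ n₂₃ (div_pos hρ₂ hρ₃) ?_
    have : (ρ₃ : ℂ) ≠ 0 := by exact_mod_cast hρ₃.ne'
    rw [hb₂, hb₃]
    push_cast
    field_simp
  -- The circle must cross all three edges and stay where the sum of the angles is less than a full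
  -- turn.
  obtain ⟨s, hs, hs1, hs2, hs3, hsε⟩ : ∃ s : ℝ, 0 < s ∧ s < 1 ∧ s < ρ₂ ∧ s < ρ₃ ∧ ‖e‖ * s < ε := by
    have hpos : 0 < ‖e‖ := norm_pos_iff.2 he0
    refine ⟨min (min 1 (ε / ‖e‖)) (min ρ₂ ρ₃) / 2, by positivity, ?_, ?_, ?_, ?_⟩
    · have := min_le_left (min 1 (ε / ‖e‖)) (min ρ₂ ρ₃); have := min_le_left 1 (ε / ‖e‖)
      linarith
    · have := min_le_right (min 1 (ε / ‖e‖)) (min ρ₂ ρ₃); have := min_le_left ρ₂ ρ₃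
      linarith
    · have := min_le_right (min 1 (ε / ‖e‖)) (min ρ₂ ρ₃); have := min_le_right ρ₂ ρ₃
      linarith
    · have h1 := min_le_left (min 1 (ε / ‖e‖)) (min ρ₂ ρ₃)
      have h2 := min_le_right 1 (ε / ‖e‖)
      have h3 : min (min 1 (ε / ‖e‖)) (min ρ₂ ρ₃) / 2 < ε / ‖e‖ := by
        have : 0 < ε / ‖e‖ := by positivity
        linarith
      rwa [lt_div_iff₀ hpos, mul_comm] at h3
  set c : ℝ → ℂ := fun θ => P u + e * (s * Complex.exp (θ * Complex.I)) with hc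
  have hs0 : (s : ℂ) ≠ 0 := by exact_mod_cast hs.ne'
  have hcu : ∀ θ, c θ ≠ P u := fun θ h' => by
    simp [hc, he0, hs0] at h'
  have hcn : ∀ θ, Avoids G P A (c θ) ∧ |f₁₂ (c θ) + f₂₃ (c θ) + f₃₁ (c θ)| < 2 * Real.pi := by
    intro θ
    apply hball
    simp only [hc, dist_eq_norm, add_sub_cancel_left, norm_mul, Complex.norm_exp_ofReal_mul_I,
      Complex.norm_real, Real.norm_eq_abs, abs_of_pos hs, mul_one]
    exact hsε
  have hcc : Continuous c := by fun_prop
  have hcp : Function.Periodic c (2 * Real.pi) := by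
    intro θ
    simp only [hc]
    push_cast
    rw [add_mul, Complex.exp_add, Complex.exp_two_pi_mul_I, mul_one]
  have sight : ∀ b β θ, P b - P u = e * β →
      Complex.arg ((P b - c θ) / (P u - c θ)) = sightAngle β s θ := by
    intro b β θ hb
    rw [sightAngle]
    congr 1
    have h1 : P b - c θ = e * (β - s * Complex.exp (θ * Complex.I)) := by
      simp only [hc]; linear_combination hb
    have h2 : P u - c θ = -(e * (s * Complex.exp (θ * Complex.I))) := by
      simp only [hc]; ring
    have := Complex.exp_ne_zero (θ * Complex.I)
    rw [h1, h2]
    field_simp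
    ring
  have sight₁ := fun θ => sight b₁ 1 θ (by rw [mul_one])
  have sight₂ := fun θ => sight b₂ _ θ hb₂
  have sight₃ := fun θ => sight b₃ _ θ hb₃
  have on_edge : ∀ (b : V) (ρ θ : ℝ), 0 < ρ → s < ρ → P b - P u = e * (ρ * Complex.exp (θ * Complex.I)) →
      c θ ∈ segment ℝ (P u) (P b) := by
    intro b ρ θ hρ hsρ hb
    have hρ0 : (ρ : ℂ) ≠ 0 := by exact_mod_cast hρ.ne'
    refine ⟨1 - s / ρ, s / ρ, by rw [sub_nonneg, div_le_one hρ]; exact hsρ.le, by positivity,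
      by ring, ?_⟩
    have h1 : P b = P u + e * (ρ * Complex.exp (θ * Complex.I)) := by linear_combination hb
    simp only [Complex.real_smul, hc, h1]
    push_cast
    field_simp
    ring
  have cont : ∀ {f x y b}, IsPathAngle G P (Set.univ \ {u, b}) x y f → Continuous fun θ => f (c θ) :=
    fun {f x y b} hf => continuous_iff_continuousAt.2 fun θ =>
      ContinuousAt.comp (g := f) (hf.cont _ ((hcn θ).1.mono (hsub b))) hcc.continuousAt
  have e₁₂ := fun θ => loopAngle_angle hf₁₂ j₁₂.mem_left j₁₂.mem_right
    ((hcn θ).1.mono (hsub _)) (hcu θ)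
  have e₂₃ := fun θ => loopAngle_angle hf₂₃ j₂₃.mem_left j₂₃.mem_right
    ((hcn θ).1.mono (hsub _)) (hcu θ)
  have e₃₁ := fun θ => loopAngle_angle hf₃₁ j₃₁.mem_left j₃₁.mem_right
    ((hcn θ).1.mono (hsub _)) (hcu θ)
  have z₂₃ := loopAngle_segment h hf₂₃ a₁ a₂ a₃ n₁₂ n₃₁.symm
    (on_edge b₁ 1 0 one_pos hs1 (by simp [he])) (hcu 0)
  have z₃₁ := loopAngle_segment h hf₃₁ a₂ a₃ a₁ n₂₃ n₁₂.symm
    (on_edge b₂ ρ₂ θ₂ hρ₂ hs2 hb₂) (hcu θ₂)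
  have z₁₂ := loopAngle_segment h hf₁₂ a₃ a₁ a₂ n₃₁ n₂₃.symm
    (on_edge b₃ ρ₃ θ₃ hρ₃ hs3 hb₃) (hcu θ₃)
  have hzero : ∀ θ, f₁₂ (c θ) + f₂₃ (c θ) + f₃₁ (c θ) = 0 := by
    intro θ
    refine eq_zero_of_angle ?_ (hcn θ).2
    rw [← hsum, Real.Angle.coe_add, Real.Angle.coe_add, e₁₂, e₂₃, e₃₁]
    simp
  simp only [loopAngle, sight₁, sight₂, sight₃] at e₁₂ e₂₃ e₃₁ z₁₂ z₂₃ z₃₁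
  rcases lt_or_gt_of_ne hne with hlt | hlt
  · exact false_of_circle_angles hs hs1 hs2 hs3 hθ₂ hlt hθ₃' rfl rfl (cont hf₁₂) (cont hf₂₃)
      (cont hf₃₁) (fun θ => congrArg f₁₂ (hcp θ)) e₁₂ e₂₃ e₃₁ hzero z₂₃ z₃₁ z₁₂
  -- In the other cyclic order `b₂` and `b₃` exchange roles. The walks are then run backwards, which
  -- negates the angles.
  · have neg : ∀ {x y : ℝ}, y = -x → (x : Real.Angle) = 0 → (y : Real.Angle) = 0 := by
      rintro x y rfl hx
      rw [Real.Angle.coe_neg, hx, neg_zero]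
    exact false_of_circle_angles hs hs1 hs3 hs2 hθ₃ hlt hθ₂' rfl rfl (f₁₂ := fun θ => -f₃₁ (c θ))
      (f₂₃ := fun θ => -f₂₃ (c θ)) (f₃₁ := fun θ => -f₁₂ (c θ)) (cont hf₃₁).neg
      (cont hf₂₃).neg (cont hf₁₂).neg (fun θ => congrArg (fun z => -f₃₁ z) (hcp θ))
      (fun θ => neg (by ring) (e₃₁ θ)) (fun θ => neg (by ring) (e₂₃ θ))
      (fun θ => neg (by ring) (e₁₂ θ)) (fun θ => by linarith [hzero θ])
      (by linarith) (by linarith) (by linarith)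

end OuterDrawing

/-- The coordinates of the plane as complex numbers. -/
noncomputable def planeEquiv : Plane ≃ₗᵢ[ℝ] ℂ := Complex.orthonormalBasisOneI.repr.symm

theorem planeEquiv_mem_segment {x y z : Plane} :
    planeEquiv z ∈ segment ℝ (planeEquiv x) (planeEquiv y) ↔ z ∈ segment ℝ x y := by
  have := image_segment ℝ planeEquiv.toLinearEquiv.toLinearMap.toAffineMap x y
  have h : segment ℝ (planeEquiv x) (planeEquiv y) = planeEquiv '' segment ℝ x y := this.symm
  rw [h, planeEquiv.injective.mem_set_image]

theorem IsPlanarDrawing.outerDrawing {G : SimpleGraph V} {p : V → Plane}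
    (h : IsPlanarDrawing G p) (hout : ∀ v, p v ∈ closure (outerFace G p)) :
    OuterDrawing G (fun v => planeEquiv (p v)) (planeEquiv '' outerFace G p) where
  inj := planeEquiv.injective.comp h.injective
  vertex_edge u v w huv hw := h.vertex_edge u v w huv (planeEquiv_mem_segment.1 hw)
  edge_edge u v x y huv hxy hne z hz hz' := by
    obtain ⟨z, rfl⟩ := planeEquiv.surjective z
    obtain ⟨w, ⟨h1, h2⟩, rfl⟩ := h.edge_edge u v x y huv hxy hne
      ⟨planeEquiv_mem_segment.1 hz, planeEquiv_mem_segment.1 hz'⟩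
    exact ⟨w, h1, h2, rfl⟩
  outer := by
    rintro _ ⟨x, hx, rfl⟩
    refine ⟨planeEquiv '' connectedComponentIn (drawingSet G p)ᶜ x,
      isPreconnected_connectedComponentIn.image _ planeEquiv.continuous.continuousOn,
      ⟨x, mem_connectedComponentIn hx.1, rfl⟩, fun hb => hx.2 ?_, ?_⟩
    · have := planeEquiv.symm.lipschitz.isBounded_image hb
      rwa [← Set.image_comp, show (planeEquiv.symm ∘ planeEquiv : Plane → Plane) = id from
        funext fun z => planeEquiv.symm_apply_apply z, Set.image_id] at this
    · rintro _ ⟨z, hz, rfl⟩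
      have hz := connectedComponentIn_subset _ _ hz
      refine ⟨fun s _ h' => hz (.inl ⟨s, (planeEquiv.injective h').symm⟩),
        fun s _ t _ hst h' => hz (.inr ?_)⟩
      simp only [Set.mem_iUnion]
      exact ⟨s, t, hst, planeEquiv_mem_segment.1 h'⟩
  closure v := image_closure_subset_closure_image planeEquiv.continuous ⟨p v, hout v, rfl⟩

/-- The vertices of an outerplanar graph can be ranked so that no two edges cross. -/
theorem IsOuterplanar.exists_noncrossingOn [Finite V] {G : SimpleGraph V} (h : IsOuterplanar G) :
    ∃ ρ, NoncrossingOn G Set.univ ρ := by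
  obtain ⟨p, hp, hout⟩ := h
  exact (IsPlanarDrawing.outerDrawing hp hout).tripodFree.exists_noncrossingOn

end OuterDrawing

/-! ### Drawing a noncrossing ranking on a parabola. -/

section Parabola

open Filter Topology Bornology

theorem mem_segment_plane {x y z : Plane} : z ∈ segment ℝ x y ↔
    ∃ t : ℝ, 0 ≤ t ∧ t ≤ 1 ∧ z 0 = x 0 + t * (y 0 - x 0) ∧ z 1 = x 1 + t * (y 1 - x 1) := by
  rw [segment_eq_image']
  constructor
  · rintro ⟨t, ⟨h0, h1⟩, rfl⟩
    exact ⟨t, h0, h1, by simp, by simp⟩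
  · rintro ⟨t, h0, h1, e0, e1⟩
    refine ⟨t, ⟨h0, h1⟩, ?_⟩
    ext i
    fin_cases i
    · simp [e0]
    · simp [e1]

theorem plane_ext {x y : Plane} (h0 : x 0 = y 0) (h1 : x 1 = y 1) : x = y := by
  ext i
  fin_cases i
  exacts [h0, h1]

/-- The point of the parabola `y = x ^ 2` over `x = t`. -/
noncomputable def parabola (t : ℝ) : Plane := !₂[t, t ^ 2]

theorem mem_parabola_chord {s t : ℝ} (hst : s ≤ t) {z : Plane}
    (hz : z ∈ segment ℝ (parabola s) (parabola t)) :
    s ≤ z 0 ∧ z 0 ≤ t ∧ z 1 = z 0 ^ 2 + (z 0 - s) * (t - z 0) := by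
  obtain ⟨a, h0, h1, e0, e1⟩ := mem_segment_plane.1 hz
  simp only [parabola, PiLp.toLp_apply, Matrix.cons_val_zero, Matrix.cons_val_one] at e0 e1
  refine ⟨by nlinarith, by nlinarith, ?_⟩
  rw [e1, e0]
  ring

/-- Over a common abscissa `x` the heights of the chords above the parabola are `(x - s) * (t - x)`
and `(x - a) * (b - x)`. For nested or disjoint intervals these agree only at common ends, unless
the chords coincide. -/
theorem parabola_chords {s t a b : ℕ} (hst : s < t) (hab : a < b)
    (h1 : ¬ (s < a ∧ a < t ∧ t < b)) (h2 : ¬ (a < s ∧ s < b ∧ b < t)) {z : Plane}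
    (hz : z ∈ segment ℝ (parabola s) (parabola t))
    (hz' : z ∈ segment ℝ (parabola a) (parabola b)) :
    (∃ c, (c = s ∨ c = t) ∧ (c = a ∨ c = b) ∧ z = parabola c) ∨ s = a ∧ t = b := by
  obtain ⟨x1, x2, x3⟩ := mem_parabola_chord (Nat.cast_le.2 hst.le) hz
  obtain ⟨y1, y2, y3⟩ := mem_parabola_chord (Nat.cast_le.2 hab.le) hz'
  set x := z 0
  have e : (x - s) * (t - x) = (x - a) * (b - x) := by linarith
  have key : (x = s ∨ x = t) ∨ s = a ∧ t = b := by
    rcases le_or_gt t a with h | h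
    · have : (t : ℝ) ≤ a := by exact_mod_cast h
      exact .inl (.inr (by linarith))
    rcases le_or_gt b s with h' | h'
    · have : (b : ℝ) ≤ s := by exact_mod_cast h'
      exact .inl (.inl (by linarith))
    rcases lt_trichotomy s a with h3 | h3 | h3
    · have h4 : (b : ℝ) ≤ t := by exact_mod_cast (by omega : b ≤ t)
      have h5 : (s : ℝ) < a := by exact_mod_cast h3
      have : (a - s) * (t - x) ≤ 0 := by nlinarith
      exact .inl (.inr (by nlinarith))
    · subst h3
      rcases eq_or_ne t b with rfl | h4
      · exact .inr ⟨rfl, rfl⟩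
      · have h5 : (t : ℝ) - b ≠ 0 := sub_ne_zero.2 (by exact_mod_cast h4)
        have : (x - s) * (t - b) = 0 := by linarith
        exact .inl (.inl (by rcases mul_eq_zero.1 this with h | h; linarith; exact (h5 h).elim))
    · have h4 : (t : ℝ) ≤ b := by exact_mod_cast (by omega : t ≤ b)
      have h5 : (a : ℝ) < s := by exact_mod_cast h3
      have : (s - a) * (b - x) ≤ 0 := by nlinarith
      exact .inl (.inr (by nlinarith))
  refine key.imp_left fun hx => ?_
  have h0 : (x - s) * (t - x) = 0 := by
    rcases hx with h | h <;> simp [h]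
  have hz1 : ∀ c : ℕ, x = c → z = parabola c := fun c hc =>
    plane_ext (by simpa [parabola] using hc) (by rw [x3, h0, hc]; simp [parabola])
  have hx' : x = a ∨ x = b := by
    rw [e] at h0
    rcases mul_eq_zero.1 h0 with h | h
    · exact .inl (by linarith)
    · exact .inr (by linarith)
  rcases hx with h | h
  · exact ⟨s, .inl rfl, by rw [h] at hx'; exact_mod_cast hx', hz1 s h⟩
  · exact ⟨t, .inr rfl, by rw [h] at hx'; exact_mod_cast hx', hz1 t h⟩

variable {V : Type*} {G : SimpleGraph V} {ρ : V → ℕ}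

theorem parabola_injective : Function.Injective parabola := fun s t h => by
  have := congrArg (fun z : Plane => z 0) h
  simpa [parabola] using this

theorem NoncrossingOn.isPlanarDrawing (h : NoncrossingOn G Set.univ ρ) :
    IsPlanarDrawing G fun v => parabola (ρ v) := by
  have hinj : ∀ x y, ρ x = ρ y → x = y := fun x y => h.inj x trivial y trivial
  have main : ∀ u v x y, ρ u < ρ v → ρ x < ρ y → G.Adj u v → G.Adj x y → s(u, v) ≠ s(x, y) →
      segment ℝ (parabola (ρ u)) (parabola (ρ v)) ∩
        segment ℝ (parabola (ρ x)) (parabola (ρ y)) ⊆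
          (fun v => parabola (ρ v)) '' ({u, v} ∩ {x, y}) := by
    rintro u v x y h1 h2 huv hxy hne z ⟨hz, hz'⟩
    rcases parabola_chords h1 h2
      (fun h' => h.not_cross u trivial x trivial v trivial y trivial h'.1 h'.2.1 h'.2.2 huv hxy)
      (fun h' => h.not_cross x trivial u trivial y trivial v trivial h'.1 h'.2.1 h'.2.2 hxy huv)
      hz hz' with ⟨c, hc, hc', rfl⟩ | ⟨h3, h4⟩
    · rcases hc with rfl | rfl
      · refine ⟨u, ⟨.inl rfl, ?_⟩, rfl⟩
        exact hc'.imp (hinj _ _) (hinj _ _)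
      · refine ⟨v, ⟨.inr rfl, ?_⟩, rfl⟩
        exact hc'.imp (hinj _ _) (hinj _ _)
    · rw [hinj _ _ h3, hinj _ _ h4] at hne
      exact (hne rfl).elim
  have hne : ∀ u v, G.Adj u v → ρ u ≠ ρ v := fun u v huv h' => huv.ne (hinj _ _ h')
  refine ⟨fun x y hxy => hinj _ _ (by exact_mod_cast parabola_injective hxy), ?_, ?_⟩
  · intro u v w huv hw
    wlog hlt : ρ u < ρ v generalizing u v
    · rw [segment_symm] at hw
      exact (this v u huv.symm hw (lt_of_le_of_ne (not_lt.1 hlt) (hne _ _ huv).symm)).symm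
    obtain ⟨-, -, h3⟩ := mem_parabola_chord (Nat.cast_le.2 hlt.le) hw
    simp only [parabola, PiLp.toLp_apply, Matrix.cons_val_zero, Matrix.cons_val_one] at h3
    have h4 : ((ρ w : ℝ) - ρ u) * (ρ v - ρ w) = 0 := by linarith
    rcases mul_eq_zero.1 h4 with h5 | h5
    · exact .inl (hinj _ _ (by exact_mod_cast sub_eq_zero.1 h5))
    · exact .inr (hinj _ _ (by exact_mod_cast (sub_eq_zero.1 h5).symm))
  · intro u v x y huv hxy hs
    rcases lt_or_gt_of_ne (hne _ _ huv) with h1 | h1 <;>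
      rcases lt_or_gt_of_ne (hne _ _ hxy) with h2 | h2
    · exact main u v x y h1 h2 huv hxy hs
    · rw [segment_symm ℝ (parabola (ρ x)), Set.pair_comm x]
      exact main u v y x h1 h2 huv hxy.symm (by rwa [Sym2.eq_swap (a := y)])
    · rw [segment_symm ℝ (parabola (ρ u)), Set.pair_comm u]
      exact main v u x y h1 h2 huv.symm hxy (by rwa [Sym2.eq_swap (a := v)])
    · rw [segment_symm ℝ (parabola (ρ u)), Set.pair_comm u, segment_symm ℝ (parabola (ρ x)),
        Set.pair_comm x]
      exact main v u y x h1 h2 huv.symm hxy.symm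
        (by rwa [Sym2.eq_swap (a := v), Sym2.eq_swap (a := y)])

/-- All chords lie above the parabola, so the vertical ray below a vertex avoids the drawing and
leads to infinity. -/
theorem parabola_outer (v : V) :
    parabola (ρ v) ∈ closure (outerFace G fun v => parabola (ρ v)) := by
  set t : ℝ := ((ρ v : ℕ) : ℝ)
  let q : ℝ → Plane := fun η => !₂[t, t ^ 2 - η]
  have hq : Continuous q := by
    refine (PiLp.continuous_toLp 2 _).comp (continuous_pi fun i => ?_)
    fin_cases i <;> simp <;> fun_prop
  have above : ∀ z ∈ drawingSet G (fun v => parabola (ρ v)), z 0 ^ 2 ≤ z 1 := by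
    have chord : ∀ x y, ρ x ≤ ρ y → ∀ z ∈ segment ℝ (parabola (ρ x)) (parabola (ρ y)),
        z 0 ^ 2 ≤ z 1 := by
      intro x y hxy z hz
      obtain ⟨h1, h2, h3⟩ := mem_parabola_chord (Nat.cast_le.2 hxy) hz
      nlinarith
    rintro z (⟨x, rfl⟩ | hz)
    · simp [parabola]
    · simp only [Set.mem_iUnion] at hz
      obtain ⟨x, y, -, hz⟩ := hz
      rcases le_total (ρ x) (ρ y) with hxy | hxy
      · exact chord x y hxy z hz
      · exact chord y x hxy z (by rwa [segment_symm])
  have hray : q '' Set.Ioi 0 ⊆ (drawingSet G fun v => parabola (ρ v))ᶜ := by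
    rintro _ ⟨η, hη, rfl⟩ hz
    have := above _ hz
    simp only [q, Matrix.cons_val_zero, Matrix.cons_val_one] at this
    exact absurd hη (by simpa using this)
  have hout : ∀ η ∈ Set.Ioi (0 : ℝ), q η ∈ outerFace G fun v => parabola (ρ v) := by
    intro η hη
    refine ⟨hray ⟨η, hη, rfl⟩, fun hb => ?_⟩
    have hsub := (isPreconnected_Ioi.image q hq.continuousOn).subset_connectedComponentIn
      ⟨η, hη, rfl⟩ hray
    obtain ⟨C, hC⟩ := (hb.subset hsub).exists_norm_le
    have h1 := hC (q (|C| + t ^ 2 + 1)) ⟨_, by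
      show (0 : ℝ) < |C| + t ^ 2 + 1
      positivity, rfl⟩
    have h2 := PiLp.norm_apply_le (q (|C| + t ^ 2 + 1)) 1
    simp only [q, Matrix.cons_val_one, Real.norm_eq_abs, Matrix.cons_val_zero]
      at h1 h2
    have h3 : |t ^ 2 - (|C| + t ^ 2 + 1)| = |C| + 1 := by
      rw [abs_of_neg] <;> linarith [abs_nonneg C]
    have h4 := le_abs_self C
    linarith
  refine mem_closure_of_tendsto (f := q) (b := 𝓝[>] 0) ?_ ?_
  · have := (hq.tendsto 0).mono_left (nhdsWithin_le_nhds (s := Set.Ioi 0))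
    simpa [q, parabola] using this
  · filter_upwards [self_mem_nhdsWithin] with η hη using hout η hη

theorem NoncrossingOn.isOuterplanar (h : NoncrossingOn G Set.univ ρ) : IsOuterplanar G :=
  ⟨_, h.isPlanarDrawing, parabola_outer⟩

end Parabola

/-! ## Trees of triangles -/

/-- A triangulated polygon hung on an edge with ends `u`, `v`. In `unit w l r` the triangle `u v w`
carries `l` on `uw` and `r` on `vw`; in `long w l r` it carries `l` on `uw` and `r` on `wv`. -/
inductive Hang (V : Type*) : Bool → Type _
  | leaf (b : Bool) : Hang V b
  | unit (w : V) (l : Hang V true) (r : Hang V false) : Hang V false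
  | long (w : V) (l r : Hang V false) : Hang V true

namespace Hang

variable {V : Type*}

/-- The vertices other than the ends of the root edge. -/
def nodes : {b : Bool} → Hang V b → List V
  | _, leaf _ => []
  | _, unit w l r => w :: (l.nodes ++ r.nodes)
  | _, long w l r => w :: (l.nodes ++ r.nodes)

/-- The edges, when hung on `uv`. -/
def edges [DecidableEq V] : {b : Bool} → Hang V b → V → V → Finset (Sym2 V)
  | _, leaf _, u, v => {s(u, v)}
  | _, unit w l r, u, v => insert s(u, v) (l.edges u w ∪ r.edges v w)
  | _, long w l r, u, v => insert s(u, v) (l.edges u w ∪ r.edges w v)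

variable [DecidableEq V]

theorem root_mem_edges {b : Bool} (T : Hang V b) (u v : V) : s(u, v) ∈ T.edges u v := by
  cases T <;> simp [edges]

theorem mem_of_mem_edges {b : Bool} (T : Hang V b) {u v x : V} {e : Sym2 V}
    (he : e ∈ T.edges u v) (hx : x ∈ e) : x = u ∨ x = v ∨ x ∈ T.nodes := by
  induction T generalizing u v with
  | leaf b =>
    simp only [edges, Finset.mem_singleton] at he
    subst he
    simpa [nodes] using hx
  | unit w l r ihl ihr =>
    simp only [edges, Finset.mem_insert, Finset.mem_union] at he
    simp only [nodes, List.mem_cons, List.mem_append]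
    rcases he with rfl | he | he
    · rw [Sym2.mem_iff] at hx
      tauto
    · have := ihl he
      tauto
    · have := ihr he
      tauto
  | long w l r ihl ihr =>
    simp only [edges, Finset.mem_insert, Finset.mem_union] at he
    simp only [nodes, List.mem_cons, List.mem_append]
    rcases he with rfl | he | he
    · rw [Sym2.mem_iff] at hx
      tauto
    · have := ihl he
      tauto
    · have := ihr he
      tauto

theorem not_isDiag_of_mem_edges {b : Bool} (T : Hang V b) {u v : V}
    (h : (u :: v :: T.nodes).Nodup) {e : Sym2 V} (he : e ∈ T.edges u v) : ¬ e.IsDiag := by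
  induction T generalizing u v with
  | leaf b =>
    simp only [edges, Finset.mem_singleton] at he
    subst he
    simp only [nodes] at h
    simp only [Sym2.mk_isDiag_iff]
    grind
  | unit w l r ihl ihr =>
    simp only [edges, Finset.mem_insert, Finset.mem_union] at he
    simp only [nodes] at h
    rcases he with rfl | he | he
    · simp only [Sym2.mk_isDiag_iff]
      grind
    · exact ihl (by grind) he
    · exact ihr (by grind) he
  | long w l r ihl ihr =>
    simp only [edges, Finset.mem_insert, Finset.mem_union] at he
    simp only [nodes] at h
    rcases he with rfl | he | he
    · simp only [Sym2.mk_isDiag_iff]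
      grind
    · exact ihl (by grind) he
    · exact ihr (by grind) he

/-- The two parts share only the vertex `w`, so a common edge would be a loop; and neither part
contains both `u` and `v`. Leaving open the orientation of the second root edge covers both kinds of
triangles. -/
theorem card_edges_aux {b c : Bool} (l : Hang V b) (r : Hang V c) {u v w u' v' : V}
    (h : (u :: v :: w :: (l.nodes ++ r.nodes)).Nodup) (huv : s(u', v') = s(v, w))
    (hl : (l.edges u w).card = 2 * l.nodes.length + 1)
    (hr : (r.edges u' v').card = 2 * r.nodes.length + 1) :
    (insert s(u, v) (l.edges u w ∪ r.edges u' v')).card =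
      2 * (w :: (l.nodes ++ r.nodes)).length + 1 := by
  have hmem : ∀ e ∈ r.edges u' v', ∀ x ∈ e, x = v ∨ x = w ∨ x ∈ r.nodes := by
    intro e he x hx
    have := r.mem_of_mem_edges he hx
    rw [Sym2.eq_iff] at huv
    grind
  have hd : Disjoint (l.edges u w) (r.edges u' v') := by
    rw [Finset.disjoint_left]
    intro e he he'
    refine l.not_isDiag_of_mem_edges (by grind) he ?_
    induction e with | _ x y => ?_
    have h1 := l.mem_of_mem_edges he (Sym2.mem_mk_left x y)
    have h2 := l.mem_of_mem_edges he (Sym2.mem_mk_right x y)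
    have h3 := hmem _ he' x (Sym2.mem_mk_left x y)
    have h4 := hmem _ he' y (Sym2.mem_mk_right x y)
    have hx : x = w := by grind
    have hy : y = w := by grind
    simp [hx, hy]
  have h1 : s(u, v) ∉ l.edges u w ∪ r.edges u' v' := by
    rw [Finset.mem_union]
    rintro (he | he)
    · have := l.mem_of_mem_edges he (Sym2.mem_mk_right u v)
      grind
    · have := hmem _ he u (Sym2.mem_mk_left u v)
      grind
  rw [Finset.card_insert_of_notMem h1, Finset.card_union_of_disjoint hd, hl, hr]
  simp only [List.length_cons, List.length_append]
  ring

theorem card_edges {b : Bool} (T : Hang V b) {u v : V} (h : (u :: v :: T.nodes).Nodup) :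
    (T.edges u v).card = 2 * T.nodes.length + 1 := by
  induction T generalizing u v with
  | leaf b => simp [edges, nodes]
  | unit w l r ihl ihr =>
    simp only [nodes] at h
    exact card_edges_aux l r h rfl (ihl (by grind)) (ihr (by grind))
  | long w l r ihl ihr =>
    simp only [nodes] at h
    exact card_edges_aux l r h Sym2.eq_swap (ihl (by grind)) (ihr (by grind))

end Hang

/-! ### Completing a noncrossing ranking to a triangulated polygon. -/

section Triangulation

variable {V : Type*}

/-- `x` is ranked strictly between `u` and `v`. -/
def Between (ρ : V → ℕ) (u v x : V) : Prop :=
  ρ u < ρ x ∧ ρ x < ρ v ∨ ρ v < ρ x ∧ ρ x < ρ u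

theorem Between.symm_iff {ρ : V → ℕ} {u v x : V} : Between ρ u v x ↔ Between ρ v u x := or_comm

/-- The third corner is the neighbour of `u` farthest towards `v`: an edge passing over it would
cross its edge to `u`. If `u` has no neighbour in between, the vertex next to `u` leaves nothing to
be passed over. -/
theorem NoncrossingOn.exists_third [Finite V] {G : SimpleGraph V} {ρ : V → ℕ}
    (h : NoncrossingOn G Set.univ ρ) {u v : V} (hne : ∃ x, Between ρ u v x) :
    ∃ w, Between ρ u v w ∧ (∀ c, G.Adj u c → ¬ Between ρ w v c) ∧
      ∀ x y, Between ρ u w x → (y = v ∨ Between ρ w v y) → ¬ G.Adj x y := by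
  let d : V → ℕ := fun x => (ρ x - ρ u) + (ρ u - ρ x)
  by_cases hN : {c | G.Adj u c ∧ Between ρ u v c}.Nonempty
  · obtain ⟨w, ⟨huw, hw⟩, hmax⟩ := Set.exists_max_image _ d (Set.toFinite _) hN
    refine ⟨w, hw, fun c huc hc => ?_, fun x y hx hy hxy => ?_⟩
    · have := hmax c ⟨huc, by unfold Between at *; omega⟩
      unfold Between at *
      simp only [d] at this
      omega
    · have c1 := h.not_cross u trivial x trivial w trivial y trivial
      have c2 := h.not_cross y trivial w trivial x trivial u trivial
      have c3 := hxy.symm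
      have c4 := huw.symm
      unfold Between at *
      rcases hy with rfl | hy
      · rcases hx with hx | hx
        · exact c1 hx.1 hx.2 (by omega) huw hxy
        · exact c2 (by omega) hx.1 hx.2 c3 c4
      · rcases hx with hx | hx
        · exact c1 hx.1 hx.2 (by omega) huw hxy
        · exact c2 (by omega) hx.1 hx.2 c3 c4
  · obtain ⟨w, hw, hmin⟩ := Set.exists_min_image {x | Between ρ u v x} d (Set.toFinite _) hne
    refine ⟨w, hw, fun c huc hc => hN ⟨c, huc, ?_⟩, fun x y hx hy hxy => ?_⟩
    · simp only [Set.mem_ofPred_eq] at hw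
      unfold Between at *
      omega
    · have hx' : Between ρ u v x := by
        simp only [Set.mem_ofPred_eq] at hw
        unfold Between at *
        omega
      have := hmin x hx'
      simp only [Set.mem_ofPred_eq] at hw
      unfold Between at *
      simp only [d] at this
      omega

variable [DecidableEq V]

/-- `T` triangulates the vertices ranked between `u` and `v`, with all edges of `G` among them. -/
structure Triangulates (G : SimpleGraph V) (ρ : V → ℕ) {b : Bool} (T : Hang V b) (u v : V) :
    Prop where
  nodup : T.nodes.Nodup
  mem_nodes : ∀ x, x ∈ T.nodes ↔ Between ρ u v x
  adj : ∀ x y, G.Adj x y → (x = u ∨ x = v ∨ Between ρ u v x) →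
    (y = u ∨ y = v ∨ Between ρ u v y) → s(x, y) ∈ T.edges u v
  not_cross : ∀ p q r s, ρ p < ρ q → ρ q < ρ r → ρ r < ρ s → s(p, r) ∈ T.edges u v →
    s(q, s) ∈ T.edges u v → False

/-- The ranks in `E` and those in `F` fill two intervals that overlap only in the rank of `w`, and
the root edge spans both. -/
theorem not_cross_insert_union {ρ : V → ℕ} {E F : Finset (Sym2 V)} {u v w : V}
    (hw : Between ρ u v w) (hE : ∀ e ∈ E, ∀ x ∈ e, x = u ∨ x = w ∨ Between ρ u w x)
    (hF : ∀ e ∈ F, ∀ x ∈ e, x = w ∨ x = v ∨ Between ρ w v x)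
    (cE : ∀ p q r s, ρ p < ρ q → ρ q < ρ r → ρ r < ρ s → s(p, r) ∈ E → s(q, s) ∈ E → False)
    (cF : ∀ p q r s, ρ p < ρ q → ρ q < ρ r → ρ r < ρ s → s(p, r) ∈ F → s(q, s) ∈ F → False)
    (p q r s : V) (e1 : ρ p < ρ q) (e2 : ρ q < ρ r) (e3 : ρ r < ρ s)
    (m1 : s(p, r) ∈ insert s(u, v) (E ∪ F)) (m2 : s(q, s) ∈ insert s(u, v) (E ∪ F)) : False := by
  have inE : ∀ x y, s(x, y) ∈ E → (min (ρ u) (ρ w) ≤ ρ x ∧ ρ x ≤ max (ρ u) (ρ w)) ∧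
      min (ρ u) (ρ w) ≤ ρ y ∧ ρ y ≤ max (ρ u) (ρ w) := by
    have : ∀ x, (x = u ∨ x = w ∨ Between ρ u w x) →
        min (ρ u) (ρ w) ≤ ρ x ∧ ρ x ≤ max (ρ u) (ρ w) := by
      rintro x (rfl | rfl | (h | h)) <;> omega
    exact fun x y h => ⟨this x (hE _ h x (Sym2.mem_mk_left x y)),
      this y (hE _ h y (Sym2.mem_mk_right x y))⟩
  have inF : ∀ x y, s(x, y) ∈ F → (min (ρ w) (ρ v) ≤ ρ x ∧ ρ x ≤ max (ρ w) (ρ v)) ∧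
      min (ρ w) (ρ v) ≤ ρ y ∧ ρ y ≤ max (ρ w) (ρ v) := by
    have : ∀ x, (x = w ∨ x = v ∨ Between ρ w v x) →
        min (ρ w) (ρ v) ≤ ρ x ∧ ρ x ≤ max (ρ w) (ρ v) := by
      rintro x (rfl | rfl | (h | h)) <;> omega
    exact fun x y h => ⟨this x (hF _ h x (Sym2.mem_mk_left x y)),
      this y (hF _ h y (Sym2.mem_mk_right x y))⟩
  have root : ∀ x y, s(x, y) = s(u, v) → ρ x = ρ u ∧ ρ y = ρ v ∨ ρ x = ρ v ∧ ρ y = ρ u := by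
    intro x y h
    rw [Sym2.eq_iff] at h
    rcases h with ⟨rfl, rfl⟩ | ⟨rfl, rfl⟩
    · exact .inl ⟨rfl, rfl⟩
    · exact .inr ⟨rfl, rfl⟩
  rw [Finset.mem_insert, Finset.mem_union] at m1 m2
  have hw' : ρ u < ρ w ∧ ρ w < ρ v ∨ ρ v < ρ w ∧ ρ w < ρ u := hw
  clear hE hF hw
  rcases m1 with m1 | m1 | m1 <;> rcases m2 with m2 | m2 | m2
  · have := root _ _ m1; have := root _ _ m2
    omega
  · have := root _ _ m1; have := inE _ _ m2
    omega
  · have := root _ _ m1; have := inF _ _ m2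
    omega
  · have := inE _ _ m1; have := root _ _ m2
    omega
  · exact cE p q r s e1 e2 e3 m1 m2
  · have := inE _ _ m1; have := inF _ _ m2
    omega
  · have := inF _ _ m1; have := root _ _ m2
    omega
  · have := inF _ _ m1; have := inE _ _ m2
    omega
  · exact cF p q r s e1 e2 e3 m1 m2

/-- By `h1` and `h2` no edge other than `uv` passes over `w`, so each remaining edge belongs to one
of the two parts. The pair `u'`, `v'` allows either orientation of the second root edge. -/
theorem Triangulates.glue {G : SimpleGraph V} {ρ : V → ℕ} {b c : Bool} {l : Hang V b}
    {r : Hang V c} {u v w u' v' : V} (hinj : Function.Injective ρ)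
    (hl : Triangulates G ρ l u w) (hr : Triangulates G ρ r u' v')
    (huv : u' = v ∧ v' = w ∨ u' = w ∧ v' = v) (hw : Between ρ u v w)
    (h1 : ∀ c, G.Adj u c → ¬ Between ρ w v c)
    (h2 : ∀ x y, Between ρ u w x → (y = v ∨ Between ρ w v y) → ¬ G.Adj x y) :
    (w :: (l.nodes ++ r.nodes)).Nodup ∧
    (∀ x, x ∈ w :: (l.nodes ++ r.nodes) ↔ Between ρ u v x) ∧
    (∀ x y, G.Adj x y → (x = u ∨ x = v ∨ Between ρ u v x) →
      (y = u ∨ y = v ∨ Between ρ u v y) →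
      s(x, y) ∈ insert s(u, v) (l.edges u w ∪ r.edges u' v')) ∧
    ∀ p q s t, ρ p < ρ q → ρ q < ρ s → ρ s < ρ t →
      s(p, s) ∈ insert s(u, v) (l.edges u w ∪ r.edges u' v') →
      s(q, t) ∈ insert s(u, v) (l.edges u w ∪ r.edges u' v') → False := by
  have hb : ∀ x, Between ρ u' v' x ↔ Between ρ w v x := by
    rcases huv with ⟨rfl, rfl⟩ | ⟨rfl, rfl⟩
    · exact fun _ => Between.symm_iff
    · exact fun _ => Iff.rfl
  have hlm := hl.mem_nodes
  have hrm : ∀ x, x ∈ r.nodes ↔ Between ρ w v x := fun x => (hr.mem_nodes x).trans (hb x)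
  have eqs : ∀ x y, ρ x = ρ y → x = y := fun x y h => hinj h
  refine ⟨?_, ?_, ?_, ?_⟩
  · rw [List.nodup_cons, List.mem_append, hlm, hrm, List.nodup_append]
    refine ⟨by unfold Between; omega, hl.nodup, hr.nodup, ?_⟩
    rintro x hx _ hy rfl
    rw [hlm] at hx
    rw [hrm] at hy
    unfold Between at *
    omega
  · intro x
    rw [List.mem_cons, List.mem_append, hlm, hrm]
    have := eqs x w
    unfold Between at *
    constructor
    · rintro (rfl | h | h) <;> omega
    · intro h
      by_cases hx : ρ x = ρ w
      · exact .inl (this hx)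
      · omega
  · have key : ∀ x y, G.Adj x y → (x = u ∨ Between ρ u w x) → (y = v ∨ Between ρ w v y) →
        s(x, y) = s(u, v) := by
      intro x y hxy hx hy
      rcases hx with rfl | hx
      · rcases hy with rfl | hy
        · rfl
        · exact (h1 _ hxy hy).elim
      · exact (h2 x y hx hy hxy).elim
    have loc : ∀ x, (x = u ∨ x = v ∨ Between ρ u v x) →
        x = w ∨ (x = u ∨ Between ρ u w x) ∨ x = v ∨ Between ρ w v x := by
      intro x hx
      by_cases hxw : ρ x = ρ w
      · exact .inl (eqs _ _ hxw)
      · unfold Between at *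
        rcases hx with rfl | rfl | hx
        · exact .inr (.inl (.inl rfl))
        · exact .inr (.inr (.inl rfl))
        · rcases lt_or_gt_of_ne hxw with h | h <;> omega
    have inl : ∀ x y, G.Adj x y → (x = w ∨ x = u ∨ Between ρ u w x) →
        (y = w ∨ y = u ∨ Between ρ u w y) → s(x, y) ∈ l.edges u w := fun x y hxy hx hy =>
      hl.adj x y hxy (or_left_comm.1 hx) (or_left_comm.1 hy)
    have inr : ∀ x y, G.Adj x y → (x = w ∨ x = v ∨ Between ρ w v x) →
        (y = w ∨ y = v ∨ Between ρ w v y) → s(x, y) ∈ r.edges u' v' := by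
      intro x y hxy hx hy
      have : ∀ x, (x = w ∨ x = v ∨ Between ρ w v x) → x = u' ∨ x = v' ∨ Between ρ u' v' x := by
        intro x hx
        rw [hb]
        rcases huv with ⟨rfl, rfl⟩ | ⟨rfl, rfl⟩
        · exact or_left_comm.1 hx
        · exact hx
      exact hr.adj x y hxy (this x hx) (this y hy)
    intro x y hxy hx hy
    rw [Finset.mem_insert, Finset.mem_union]
    rcases loc x hx with hx | hx | hx <;> rcases loc y hy with hy | hy | hy
    · exact .inr (.inl (inl x y hxy (.inl hx) (.inl hy)))
    · exact .inr (.inl (inl x y hxy (.inl hx) (.inr hy)))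
    · exact .inr (.inr (inr x y hxy (.inl hx) (.inr hy)))
    · exact .inr (.inl (inl x y hxy (.inr hx) (.inl hy)))
    · exact .inr (.inl (inl x y hxy (.inr hx) (.inr hy)))
    · exact .inl (key x y hxy hx hy)
    · exact .inr (.inr (inr x y hxy (.inr hx) (.inl hy)))
    · exact .inl (Sym2.eq_swap.trans (key y x hxy.symm hy hx))
    · exact .inr (.inr (inr x y hxy (.inr hx) (.inr hy)))
  · refine not_cross_insert_union hw (fun e he x hx => ?_) (fun e he x hx => ?_) hl.not_cross
      hr.not_cross
    · rcases l.mem_of_mem_edges he hx with rfl | rfl | hx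
      · exact .inl rfl
      · exact .inr (.inl rfl)
      · exact .inr (.inr ((hlm x).1 hx))
    · rcases r.mem_of_mem_edges he hx with hx | hx | hx
      · rcases huv with ⟨rfl, rfl⟩ | ⟨rfl, rfl⟩
        · exact .inr (.inl hx)
        · exact .inl hx
      · rcases huv with ⟨rfl, rfl⟩ | ⟨rfl, rfl⟩
        · exact .inl hx
        · exact .inr (.inl hx)
      · exact .inr (.inr ((hrm x).1 hx))

theorem NoncrossingOn.exists_triangulates [Finite V] {G : SimpleGraph V} {ρ : V → ℕ}
    (h : NoncrossingOn G Set.univ ρ) (k : ℕ) (b : Bool) (u v : V) (huv : u ≠ v)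
    (hk : {x | Between ρ u v x}.ncard = k) : ∃ T : Hang V b, Triangulates G ρ T u v := by
  have hinj : Function.Injective ρ := fun x y hxy => h.inj x trivial y trivial hxy
  induction k using Nat.strong_induction_on generalizing b u v with
  | _ k ih =>
  by_cases hne : ∃ x, Between ρ u v x
  · obtain ⟨w, hw, h1, h2⟩ := h.exists_third hne
    have lt : ∀ u' v', (∀ x, Between ρ u' v' x → Between ρ u v x) → ¬ Between ρ u' v' w →
        {x | Between ρ u' v' x}.ncard < k := by
      intro u' v' hsub hnot
      rw [← hk]
      exact Set.ncard_lt_ncard ⟨hsub, fun h' => hnot (h' hw)⟩ (Set.toFinite _)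
    have hwu : u ≠ w := by
      rintro rfl
      unfold Between at hw
      omega
    have hwv : v ≠ w := by
      rintro rfl
      unfold Between at hw
      omega
    have lt1 : {x | Between ρ u w x}.ncard < k := lt u w
      (fun x hx => by unfold Between at *; omega) (by unfold Between at *; omega)
    have lt2 : {x | Between ρ v w x}.ncard < k := lt v w
      (fun x hx => by unfold Between at *; omega) (by unfold Between at *; omega)
    have lt3 : {x | Between ρ w v x}.ncard < k := lt w v
      (fun x hx => by unfold Between at *; omega) (by unfold Between at *; omega)
    cases b with
    | false =>
      obtain ⟨l, hl⟩ := ih _ lt1 true u w hwu rfl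
      obtain ⟨r, hr⟩ := ih _ lt2 false v w hwv rfl
      obtain ⟨a1, a2, a3, a4⟩ := hl.glue hinj hr (.inl ⟨rfl, rfl⟩) hw h1 h2
      exact ⟨.unit w l r, a1, a2, a3, a4⟩
    | true =>
      obtain ⟨l, hl⟩ := ih _ lt1 false u w hwu rfl
      obtain ⟨r, hr⟩ := ih _ lt3 false w v hwv.symm rfl
      obtain ⟨a1, a2, a3, a4⟩ := hl.glue hinj hr (.inr ⟨rfl, rfl⟩) hw h1 h2
      exact ⟨.long w l r, a1, a2, a3, a4⟩
  · push Not at hne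
    refine ⟨.leaf b, by simp [Hang.nodes], fun x => by simp [Hang.nodes, hne], ?_, ?_⟩
    · intro x y hxy hx hy
      have := hxy.ne
      have := hne x
      have := hne y
      rw [Hang.edges, Finset.mem_singleton, Sym2.eq_iff]
      grind
    · intro p q r s e1 e2 e3 m1 m2
      simp only [Hang.edges, Finset.mem_singleton, Sym2.eq_iff] at m1 m2
      grind

/-- An outerplanar graph extends to a triangulated polygon, which is outerplanar. -/
theorem IsOuterplanar.exists_hang [Fintype V] {G : SimpleGraph V} (h : IsOuterplanar G)
    (hcard : 2 ≤ Fintype.card V) : ∃ (u v : V) (T : Hang V false),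
      (u :: v :: T.nodes).Nodup ∧ (∀ x, x ∈ u :: v :: T.nodes) ∧
      (∀ x y, G.Adj x y → s(x, y) ∈ T.edges u v) ∧
      IsOuterplanar (SimpleGraph.fromEdgeSet (T.edges u v : Set (Sym2 V))) := by
  obtain ⟨ρ, hρ⟩ := IsOuterplanar.exists_noncrossingOn h
  have hinj : Function.Injective ρ := fun x y hxy => hρ.inj x trivial y trivial hxy
  have : Nontrivial V := Fintype.one_lt_card_iff_nontrivial.1 hcard
  obtain ⟨u, -, hu⟩ := Set.exists_min_image Set.univ ρ Set.finite_univ Set.univ_nonempty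
  obtain ⟨v, -, hv⟩ := Set.exists_max_image Set.univ ρ Set.finite_univ Set.univ_nonempty
  have huv : u ≠ v := by
    rintro rfl
    obtain ⟨x, hx⟩ := exists_ne u
    exact hx (hinj (le_antisymm (hv x trivial) (hu x trivial)))
  obtain ⟨T, hT⟩ := hρ.exists_triangulates _ false u v huv rfl
  have hall : ∀ x, x = u ∨ x = v ∨ Between ρ u v x := by
    intro x
    by_cases hxu : ρ x = ρ u
    · exact .inl (hinj hxu)
    by_cases hxv : ρ x = ρ v
    · exact .inr (.inl (hinj hxv))
    have := hu x trivial
    have := hv x trivial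
    unfold Between
    omega
  refine ⟨u, v, T, ?_, fun x => ?_, fun x y hxy => hT.adj x y hxy (hall x) (hall y), ?_⟩
  · rw [List.nodup_cons, List.nodup_cons, List.mem_cons, hT.mem_nodes, hT.mem_nodes]
    refine ⟨?_, ?_, hT.nodup⟩
    · unfold Between
      have := huv
      grind
    · unfold Between
      omega
  · rw [List.mem_cons, List.mem_cons, hT.mem_nodes]
    exact hall x
  · refine NoncrossingOn.isOuterplanar (ρ := ρ)
      ⟨fun x _ y _ hxy => hinj hxy, fun p _ q _ r _ s _ e1 e2 e3 m1 m2 => ?_⟩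
    rw [SimpleGraph.fromEdgeSet_adj] at m1 m2
    exact hT.not_cross p q r s e1 e2 e3 m1.1 m2.1

end Triangulation

/-! ## Drawing trees of triangles -/

section Wedge

/-- The region to which a triangulated polygon is confined that hangs on the unit segment from the
origin to `(c, φ * c)`: a wedge cut by a line of slope `a` through the right end, below the line
of slope `a + 6 * d` through the origin. -/
def Wedge (φ a d c x y : ℝ) : Prop :=
  φ * x ≤ y ∧ a * (x - c) ≤ y - φ * c ∧ y ≤ (a + 6 * d) * x

variable {φ a d c e x y t : ℝ}

/-- The slopes from `a` to `a + 6 * d` are shared out as follows. The polygon on the right side uses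
`a` to `a + d`, the far right one `a + 2 * d` to `a + 3 * d`, the new side of the rhombus has slope
`a + 4 * d`, and the far left polygon uses `a + 5 * d` to `a + 6 * d`. The gaps between them make
the wedges meet only at corners of the rhombus. The right polygon lies on the lower side of its
edge, whence the negated slopes. -/
theorem Wedge.right_subset (ha : φ < a) (hd : 0 < d) (hc : 0 < c)
    (h : Wedge (-(a + 4 * d)) (-(a + d)) (d / 6) e (x - c) (-(y - φ * c))) :
    Wedge φ a d c x y := by
  obtain ⟨h1, h2, h3⟩ := h
  have hx : 0 ≤ x - c := by by_contra!; nlinarith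
  refine ⟨by nlinarith, by nlinarith, by nlinarith⟩

theorem Wedge.far_left_subset (ha : φ < a) (hd : 0 < d) (hc : 0 < c)
    (h : Wedge (a + 4 * d) (a + 5 * d) (d / 6) e x y) : Wedge φ a d c x y := by
  obtain ⟨h1, h2, h3⟩ := h
  have hx : 0 ≤ x := by by_contra!; nlinarith
  refine ⟨by nlinarith, by nlinarith, by nlinarith⟩

theorem Wedge.far_right_subset (ha : φ < a) (hd : 0 < d) (he : 0 < e)
    (h : Wedge φ (a + 2 * d) (d / 6) c (x - e) (y - (a + 4 * d) * e)) : Wedge φ a d c x y := by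
  obtain ⟨h1, h2, h3⟩ := h
  have hx : 0 ≤ x - e := by by_contra!; nlinarith
  refine ⟨by nlinarith, ?_, by nlinarith⟩
  rcases le_total (x - e) c with h4 | h4
  · nlinarith [mul_nonneg (sub_nonneg.2 ha.le) (sub_nonneg.2 h4), mul_pos hd he]
  · nlinarith [mul_nonneg hd.le (sub_nonneg.2 h4), mul_pos hd he]

theorem Wedge.side (ha : φ < a) (hd : 0 < d) (hc : 0 < c) (h0 : 0 ≤ t) (h1 : t ≤ 1) :
    Wedge φ a d c (t * c) (t * (φ * c)) := by
  have := mul_nonneg h0 hc.le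
  have := mul_nonneg (sub_nonneg.2 h1) hc.le
  refine ⟨by nlinarith, by nlinarith, by nlinarith⟩

theorem Wedge.diagonal (ha : φ < a) (hd : 0 < d) (hc : 0 < c) (he : 0 < e) (h0 : 0 ≤ t)
    (h1 : t ≤ 1) : Wedge φ a d c (t * (c + e)) (t * (φ * c + (a + 4 * d) * e)) := by
  have h2 := mul_nonneg h0 hc.le
  have h3 := mul_nonneg (sub_nonneg.2 h1) hc.le
  have h4 := mul_nonneg h0 he.le
  have h5 := mul_nonneg hd.le h4
  have h6 := mul_nonneg hd.le h2
  have h7 := mul_nonneg (sub_nonneg.2 ha.le) h2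
  have h8 := mul_nonneg (sub_nonneg.2 ha.le) h3
  have h9 := mul_nonneg (sub_nonneg.2 ha.le) h4
  refine ⟨by nlinarith, by nlinarith, by nlinarith⟩

theorem Wedge.far_left_right (ha : φ < a) (hd : 0 < d) (hc : 0 < c)
    (h : Wedge (a + 4 * d) (a + 5 * d) (d / 6) e x y)
    (h' : Wedge (-(a + 4 * d)) (-(a + d)) (d / 6) e (x - c) (-(y - φ * c))) : False := by
  have h1 := h.1
  have h2 := h'.1
  nlinarith

theorem Wedge.far_left_far_right (ha : φ < a) (hd : 0 < d)
    (h : Wedge (a + 4 * d) (a + 5 * d) (d / 6) e x y)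
    (h' : Wedge φ (a + 2 * d) (d / 6) c (x - e) (y - (a + 4 * d) * e)) :
    x = e ∧ y = (a + 4 * d) * e := by
  obtain ⟨-, h2, -⟩ := h
  obtain ⟨h1', -, h3'⟩ := h'
  have h4 : 0 ≤ x - e := by by_contra!; nlinarith
  have h5 : x - e ≤ 0 := by by_contra!; nlinarith
  obtain rfl : x = e := by linarith
  exact ⟨rfl, by nlinarith⟩

theorem Wedge.far_right_right (ha : φ < a) (hd : 0 < d)
    (h : Wedge φ (a + 2 * d) (d / 6) c (x - e) (y - (a + 4 * d) * e))
    (h' : Wedge (-(a + 4 * d)) (-(a + d)) (d / 6) e (x - c) (-(y - φ * c))) :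
    x = c + e ∧ y = φ * c + (a + 4 * d) * e := by
  obtain ⟨h1, h2, -⟩ := h
  obtain ⟨h1', h2', h3'⟩ := h'
  have h4 : x - c - e ≤ 0 := by by_contra!; nlinarith
  have h5 : 0 ≤ x - c - e := by by_contra!; nlinarith
  obtain rfl : x = c + e := by linarith
  exact ⟨rfl, by nlinarith⟩

theorem Wedge.diagonal_far_left (ha : φ < a) (hd : 0 < d) (hc : 0 < c) (h0 : 0 ≤ t)
    (h : Wedge (a + 4 * d) (a + 5 * d) (d / 6) e (t * (c + e))
      (t * (φ * c + (a + 4 * d) * e))) : t = 0 := by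
  have h1 := h.1
  by_contra h2
  have h3 : 0 < t * c := mul_pos (lt_of_le_of_ne h0 (Ne.symm h2)) hc
  nlinarith

theorem Wedge.diagonal_far_right (ha : φ < a) (hd : 0 < d) (he : 0 < e) (h0 : t ≤ 1)
    (h : Wedge φ (a + 2 * d) (d / 6) c (t * (c + e) - e)
      (t * (φ * c + (a + 4 * d) * e) - (a + 4 * d) * e)) : t = 1 := by
  have h1 := h.1
  obtain ⟨-, h2, h3⟩ := h
  by_contra h4
  have h5 : 0 < (1 - t) * e := mul_pos (sub_pos.2 (lt_of_le_of_ne h0 h4)) he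
  nlinarith

theorem Wedge.diagonal_right (ha : φ < a) (hd : 0 < d) (hc : 0 < c) (h0 : t ≤ 1)
    (h : Wedge (-(a + 4 * d)) (-(a + d)) (d / 6) e (t * (c + e) - c)
      (-(t * (φ * c + (a + 4 * d) * e) - φ * c))) : t = 1 := by
  obtain ⟨h1, h2, h3⟩ := h
  by_contra h4
  have h5 : 0 < (1 - t) * c := mul_pos (sub_pos.2 (lt_of_le_of_ne h0 h4)) hc
  nlinarith

theorem Wedge.side_far_left (ha : φ < a) (hd : 0 < d) (hc : 0 < c) (h0 : 0 ≤ t)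
    (h : Wedge (a + 4 * d) (a + 5 * d) (d / 6) e (t * c) (t * (φ * c))) : t = 0 := by
  have h1 := h.1
  by_contra h2
  have h3 : 0 < t * c := mul_pos (lt_of_le_of_ne h0 (Ne.symm h2)) hc
  nlinarith

theorem Wedge.side_far_right (ha : φ < a) (hd : 0 < d) (he : 0 < e)
    (h : Wedge φ (a + 2 * d) (d / 6) c (t * c - e) (t * (φ * c) - (a + 4 * d) * e)) : False := by
  have h1 := h.1
  nlinarith

theorem Wedge.side_right (ha : φ < a) (hd : 0 < d) (hc : 0 < c) (h0 : t ≤ 1)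
    (h : Wedge (-(a + 4 * d)) (-(a + d)) (d / 6) e (t * c - c) (-(t * (φ * c) - φ * c))) :
    t = 1 := by
  obtain ⟨h1, h2, h3⟩ := h
  by_contra h4
  have h5 : 0 < (1 - t) * c := mul_pos (sub_pos.2 (lt_of_le_of_ne h0 h4)) hc
  nlinarith

end Wedge

/-! ### Complexes of segments -/

section Complex

variable {V : Type*}

/-- The segment drawn for a pair of vertices. -/
def hull (p : V → Plane) (e : Sym2 V) : Set Plane :=
  e.lift ⟨fun x y => segment ℝ (p x) (p y), fun x y => segment_symm ℝ (p x) (p y)⟩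

theorem hull_mk (p : V → Plane) (x y : V) : hull p s(x, y) = segment ℝ (p x) (p y) := rfl

/-- Distinct segments meet in common ends only, and all lengths lie in `[1, 2)`. -/
structure IsComplex (p : V → Plane) (K : Set (Sym2 V)) : Prop where
  length : ∀ x y, s(x, y) ∈ K → 1 ≤ dist (p x) (p y) ∧ dist (p x) (p y) < 2
  inter : ∀ e ∈ K, ∀ e' ∈ K, ∀ z, z ∈ hull p e → z ∈ hull p e' →
    e = e' ∨ ∃ x, x ∈ e ∧ x ∈ e' ∧ p x = z

variable {p : V → Plane} {K K' : Set (Sym2 V)}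

theorem IsComplex.ne (h : IsComplex p K) {x y : V} (he : s(x, y) ∈ K) : p x ≠ p y := fun hxy => by
  have := (h.length x y he).1
  rw [hxy, dist_self] at this
  linarith

theorem IsComplex.eq_of_mem (h : IsComplex p K) {e : Sym2 V} {x y : V} (he : e ∈ K) (hx : x ∈ e)
    (hy : y ∈ e) (hxy : p x = p y) : x = y := by
  by_contra hne
  rw [(Sym2.mem_and_mem_iff hne).1 ⟨hx, hy⟩] at he
  exact h.ne he hxy

theorem mem_hull (p : V → Plane) {e : Sym2 V} {x : V} (hx : x ∈ e) : p x ∈ hull p e := by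
  induction e with | _ a b => ?_
  rcases Sym2.mem_iff.1 hx with rfl | rfl
  · exact left_mem_segment ℝ _ _
  · exact right_mem_segment ℝ _ _

theorem IsComplex.mem_of_mem_hull (h : IsComplex p K) {e e' : Sym2 V} {x : V} (he : e ∈ K)
    (he' : e' ∈ K) (hx : x ∈ e) (hz : p x ∈ hull p e') : x ∈ e' := by
  rcases h.inter e he e' he' _ (mem_hull p hx) hz with rfl | ⟨y, hy, hy', hxy⟩
  · exact hx
  · rwa [← h.eq_of_mem he hy hx hxy]

/-- It suffices to know that common points are vertices occurring on both sides; within each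
complex, a vertex lying on a segment is already one of its ends. -/
theorem IsComplex.union (h : IsComplex p K) (h' : IsComplex p K')
    (hKK : ∀ e ∈ K, ∀ e' ∈ K', ∀ z, z ∈ hull p e → z ∈ hull p e' →
      ∃ x, p x = z ∧ (∃ k ∈ K, x ∈ k) ∧ ∃ k ∈ K', x ∈ k) : IsComplex p (K ∪ K') := by
  have main : ∀ e ∈ K, ∀ e' ∈ K', ∀ z, z ∈ hull p e → z ∈ hull p e' →
      ∃ x, x ∈ e ∧ x ∈ e' ∧ p x = z := by
    intro e he e' he' z hz hz'
    obtain ⟨x, rfl, ⟨k, hk, hx⟩, k', hk', hx'⟩ := hKK e he e' he' z hz hz'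
    exact ⟨x, h.mem_of_mem_hull hk he hx hz, h'.mem_of_mem_hull hk' he' hx' hz', rfl⟩
  refine ⟨fun x y hxy => hxy.elim (h.length x y) (h'.length x y), ?_⟩
  rintro e (he | he) e' (he' | he') z hz hz'
  · exact h.inter e he e' he' z hz hz'
  · exact .inr (main e he e' he' z hz hz')
  · obtain ⟨x, h1, h2, h3⟩ := main e' he' e he z hz' hz
    exact .inr ⟨x, h2, h1, h3⟩
  · exact h'.inter e he e' he' z hz hz'

theorem IsComplex.singleton {x y : V} (h1 : 1 ≤ dist (p x) (p y)) (h2 : dist (p x) (p y) < 2) :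
    IsComplex p {s(x, y)} := by
  refine ⟨fun a b hab => ?_, ?_⟩
  · rcases Sym2.eq_iff.1 hab with ⟨rfl, rfl⟩ | ⟨rfl, rfl⟩
    · exact ⟨h1, h2⟩
    · rw [dist_comm]
      exact ⟨h1, h2⟩
  · rintro e rfl e' rfl z - -
    exact .inl rfl

theorem IsComplex.isPlanarDrawing (h : IsComplex p K) (hK : ∀ x, ∃ e ∈ K, x ∈ e)
    {G : SimpleGraph V} (hG : ∀ x y, G.Adj x y → s(x, y) ∈ K) : IsPlanarDrawing G p := by
  have inj : Function.Injective p := by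
    intro x y hxy
    obtain ⟨e, he, hx⟩ := hK x
    obtain ⟨e', he', hy⟩ := hK y
    exact h.eq_of_mem he hx (h.mem_of_mem_hull he' he hy (hxy ▸ mem_hull p hx)) hxy
  refine ⟨inj, fun u v w huv hw => ?_, ?_⟩
  · obtain ⟨e, he, hx⟩ := hK w
    exact Sym2.mem_iff.1 (h.mem_of_mem_hull he (hG u v huv) hx hw)
  · rintro u v x y huv hxy hne z ⟨hz, hz'⟩
    rcases h.inter _ (hG u v huv) _ (hG x y hxy) z hz hz' with h1 | ⟨c, h1, h2, rfl⟩
    · exact (hne h1).elim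
    · exact ⟨c, ⟨Sym2.mem_iff.1 h1, Sym2.mem_iff.1 h2⟩, rfl⟩

theorem IsComplex.drawingRatio_lt [Finite V] (h : IsComplex p K) {G : SimpleGraph V}
    (hG : ∀ x y, G.Adj x y → s(x, y) ∈ K) : drawingRatio G p < 2 := by
  rcases (Set.univ : Set (V × V)).eq_empty_or_nonempty with hV | hV
  · have : ∀ u : V, False := fun u => by
      have : (u, u) ∈ (Set.univ : Set (V × V)) := trivial
      rw [hV] at this
      exact this
    have : drawingRatio G p ≤ 0 := iSup_le fun u => (this u).elim
    exact this.trans_lt (by norm_num)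
  -- Cutting off at 2 discards long distances between non-neighbours, so the maximum over all pairs
  -- is below 2 and still bounds all edges.
  let len : V × V → ℝ := fun q => if dist (p q.1) (p q.2) < 2 then dist (p q.1) (p q.2) else 0
  obtain ⟨q, -, hq⟩ := Set.exists_max_image _ len Set.finite_univ hV
  have hq2 : len q < 2 := by
    simp only [len]
    split_ifs <;> linarith
  refine lt_of_le_of_lt (b := ENNReal.ofReal (len q)) ?_ ?_
  · refine iSup_le fun u => iSup_le fun v => iSup_le fun huv => iSup_le fun x => iSup_le fun y =>
      iSup_le fun hxy => ?_
    have h1 : dist (p u) (p v) ≤ len q := by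
      have := hq (u, v) trivial
      simpa only [len, if_pos (h.length u v (hG u v huv)).2] using this
    have h2 := (h.length x y (hG x y hxy)).1
    refine ENNReal.div_le_of_le_mul ?_
    rw [edist_dist, edist_dist, ← ENNReal.ofReal_mul (dist_nonneg.trans h1)]
    refine ENNReal.ofReal_le_ofReal ?_
    nlinarith [dist_nonneg.trans h1]
  · rw [ENNReal.ofReal_lt_iff_lt_toReal _ (by norm_num)]
    · simpa using hq2
    · simp only [len]
      split_ifs
      exacts [dist_nonneg, le_rfl]

end Complex

/-- The unit vector of slope `t` pointing to the right. -/
noncomputable def dir (t : ℝ) : Plane := !₂[(√(1 + t ^ 2))⁻¹, t * (√(1 + t ^ 2))⁻¹]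

theorem dir_zero (t : ℝ) : dir t 0 = (√(1 + t ^ 2))⁻¹ := rfl

theorem dir_one (t : ℝ) : dir t 1 = t * dir t 0 := rfl

theorem dir_pos (t : ℝ) : 0 < dir t 0 := by
  rw [dir_zero]
  positivity

theorem dir_sq (t : ℝ) : dir t 0 ^ 2 * (1 + t ^ 2) = 1 := by
  have : 0 < 1 + t ^ 2 := by positivity
  rw [dir_zero, inv_pow, Real.sq_sqrt this.le]
  field_simp

theorem norm_dir (t : ℝ) : ‖dir t‖ = 1 := by
  rw [EuclideanSpace.norm_eq, Fin.sum_univ_two, Real.norm_eq_abs, Real.norm_eq_abs, sq_abs, sq_abs,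
    Real.sqrt_eq_one, dir_one, ← dir_sq t]
  ring

/-- The squared length is 2 plus twice the cosine of the enclosed angle. Nonnegative slopes make the
cosine nonnegative, and distinct slopes make it less than 1. -/
theorem norm_dir_add_dir {s t : ℝ} (hs : 0 ≤ s) (ht : 0 ≤ t) (hst : s ≠ t) :
    1 ≤ ‖dir s + dir t‖ ∧ ‖dir s + dir t‖ < 2 := by
  have e : ‖dir s + dir t‖ ^ 2 = 2 + 2 * (dir s 0 * dir t 0 * (1 + s * t)) := by
    rw [EuclideanSpace.norm_sq_eq, Fin.sum_univ_two, Real.norm_eq_abs, Real.norm_eq_abs, sq_abs,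
      sq_abs]
    simp only [PiLp.add_apply, dir_one]
    linear_combination dir_sq s + dir_sq t
  have hx := dir_pos s
  have hy := dir_pos t
  have h0 : 0 ≤ dir s 0 * dir t 0 * (1 + s * t) := by positivity
  have h1 : dir s 0 * dir t 0 * (1 + s * t) < 1 := by
    -- Cosine and sine of the angle between the two unit vectors.
    have h2 : (dir s 0 * dir t 0 * (1 + s * t)) ^ 2 + (dir s 0 * dir t 0) ^ 2 * (s - t) ^ 2 = 1 := by
      calc _ = (dir s 0 ^ 2 * (1 + s ^ 2)) * (dir t 0 ^ 2 * (1 + t ^ 2)) := by ring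
        _ = 1 := by rw [dir_sq, dir_sq, one_mul]
    have h3 : 0 < (dir s 0 * dir t 0) ^ 2 * (s - t) ^ 2 := by
      have : s - t ≠ 0 := sub_ne_zero.2 hst
      positivity
    nlinarith
  have hn := norm_nonneg (dir s + dir t)
  constructor <;> nlinarith

namespace Hang

variable {V : Type*}

/-- The positions of the nodes when hung on an edge with left end `q`: either the segment from `q`
to `q + dir φ`, or the one from `q` to `q + dir φ + dir (a + 4 * d)`. -/
noncomputable def layout : {b : Bool} → Hang V b → Plane → ℝ → ℝ → ℝ → List (V × Plane)
  | _, leaf _, _, _, _, _ => []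
  | _, unit w l r, q, φ, a, d => (w, q + dir φ + dir (a + 4 * d)) ::
      (l.layout q φ a d ++ r.layout (q + dir φ) (a + 4 * d) (a + d) (-d / 6))
  | _, long w l r, q, φ, a, d => (w, q + dir (a + 4 * d)) ::
      (l.layout q (a + 4 * d) (a + 5 * d) (d / 6) ++
        r.layout (q + dir (a + 4 * d)) φ (a + 2 * d) (d / 6))

theorem layout_fst {b : Bool} (T : Hang V b) (q : Plane) (φ a d : ℝ) :
    (T.layout q φ a d).map Prod.fst = T.nodes := by
  induction T generalizing q φ a d with
  | leaf b => rfl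
  | unit w l r ihl ihr => simp [layout, nodes, ihl, ihr]
  | long w l r ihl ihr => simp [layout, nodes, ihl, ihr]

/-- The right end of the root edge. -/
noncomputable def rightEnd (b : Bool) (q : Plane) (φ a d : ℝ) : Plane :=
  if b then q + dir φ + dir (a + 4 * d) else q + dir φ

end Hang

/-- Admissible slopes, ordered according to the sign `s`. -/
structure Slopes (s φ a d : ℝ) : Prop where
  sign : s = 1 ∨ s = -1
  lt : s * φ < s * a
  pos : 0 < s * d
  nonneg_left : 0 ≤ φ
  nonneg : 0 ≤ a
  nonneg_right : 0 ≤ a + 6 * d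

namespace Slopes

variable {s φ a d : ℝ}

/-- The right polygon is a mirror image, so its slopes run backwards, from `a + d` to `a`. -/
theorem right (h : Slopes s φ a d) : Slopes (-s) (a + 4 * d) (a + d) (-d / 6) :=
  ⟨by rcases h.sign with h | h <;> simp [h], by linarith [h.pos], by linarith [h.pos],
    by linarith [h.nonneg, h.nonneg_right], by linarith [h.nonneg, h.nonneg_right],
    by linarith [h.nonneg]⟩

theorem far_left (h : Slopes s φ a d) : Slopes s (a + 4 * d) (a + 5 * d) (d / 6) :=
  ⟨h.sign, by linarith [h.pos], by linarith [h.pos],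
    by linarith [h.nonneg, h.nonneg_right], by linarith [h.nonneg, h.nonneg_right],
    by linarith [h.nonneg_right]⟩

theorem far_right (h : Slopes s φ a d) : Slopes s φ (a + 2 * d) (d / 6) :=
  ⟨h.sign, by linarith [h.pos, h.lt], by linarith [h.pos], h.nonneg_left,
    by linarith [h.nonneg, h.nonneg_right], by linarith [h.nonneg, h.nonneg_right]⟩

theorem ne (h : Slopes s φ a d) : φ ≠ a + 4 * d := by
  rintro rfl
  linarith [h.lt, h.pos]

theorem sign_ne (h : Slopes s φ a d) : s ≠ 0 := by
  rcases h.sign with h | h <;> simp [h]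

end Slopes

/-- The region of the plane reserved for a polygon hung on the segment from `q` to `q + dir φ`. -/
def region (s : ℝ) (q : Plane) (φ a d : ℝ) : Set Plane :=
  {z | Wedge (s * φ) (s * a) (s * d) (dir φ 0) (z 0 - q 0) (s * (z 1 - q 1))}

/-! ### Regions of the plane reserved for polygons. -/

section Region

variable {s φ a d t : ℝ} {q z : Plane}

/-- Coordinates relative to `q`, reflected by `s`, bring all regions of one rhombus into the normal
form of the wedge lemmas. -/
theorem region_right : z ∈ region (-s) (q + dir φ) (a + 4 * d) (a + d) (-d / 6) ↔
    Wedge (-(s * a + 4 * (s * d))) (-(s * a + s * d)) (s * d / 6) (dir (a + 4 * d) 0)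
      (z 0 - q 0 - dir φ 0) (-(s * (z 1 - q 1) - s * φ * dir φ 0)) := by
  simp only [region, Set.mem_ofPred_eq, PiLp.add_apply, dir_one φ]
  ring_nf

theorem region_far_left : z ∈ region s q (a + 4 * d) (a + 5 * d) (d / 6) ↔
    Wedge (s * a + 4 * (s * d)) (s * a + 5 * (s * d)) (s * d / 6) (dir (a + 4 * d) 0)
      (z 0 - q 0) (s * (z 1 - q 1)) := by
  simp only [region, Set.mem_ofPred_eq]
  ring_nf

theorem region_far_right : z ∈ region s (q + dir (a + 4 * d)) φ (a + 2 * d) (d / 6) ↔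
    Wedge (s * φ) (s * a + 2 * (s * d)) (s * d / 6) (dir φ 0)
      (z 0 - q 0 - dir (a + 4 * d) 0)
      (s * (z 1 - q 1) - (s * a + 4 * (s * d)) * dir (a + 4 * d) 0) := by
  simp only [region, Set.mem_ofPred_eq, PiLp.add_apply, dir_one (a + 4 * d)]
  ring_nf

theorem eq_of_relative (hs : s ≠ 0) {z' : Plane} (h0 : z 0 - q 0 = z' 0 - q 0)
    (h1 : s * (z 1 - q 1) = s * (z' 1 - q 1)) : z = z' :=
  plane_ext (by linarith) (by linarith [mul_left_cancel₀ hs h1])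

theorem mem_side : z ∈ segment ℝ q (q + dir φ) ↔ ∃ t : ℝ, 0 ≤ t ∧ t ≤ 1 ∧
    z 0 - q 0 = t * dir φ 0 ∧ z 1 - q 1 = t * (φ * dir φ 0) := by
  rw [mem_segment_plane]
  simp only [PiLp.add_apply, ← dir_one, add_sub_cancel_left, sub_eq_iff_eq_add']

theorem mem_diagonal : z ∈ segment ℝ q (q + dir φ + dir (a + 4 * d)) ↔
    ∃ t : ℝ, 0 ≤ t ∧ t ≤ 1 ∧ z 0 - q 0 = t * (dir φ 0 + dir (a + 4 * d) 0) ∧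
    z 1 - q 1 = t * (φ * dir φ 0 + (a + 4 * d) * dir (a + 4 * d) 0) := by
  rw [mem_segment_plane]
  simp only [PiLp.add_apply, ← dir_one, add_sub_cancel_left, sub_eq_iff_eq_add', add_assoc]

/-- The region of a polygon hung on the diagonal of the rhombus with sides `dir φ` and
`dir (a + 4 * d)`. -/
def longRegion (s : ℝ) (q : Plane) (φ a d : ℝ) : Set Plane :=
  segment ℝ q (q + dir φ + dir (a + 4 * d)) ∪ region s q (a + 4 * d) (a + 5 * d) (d / 6) ∪
    region s (q + dir (a + 4 * d)) φ (a + 2 * d) (d / 6)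

theorem longRegion_subset (h : Slopes s φ a d) : longRegion s q φ a d ⊆ region s q φ a d := by
  rintro z ((hz | hz) | hz)
  · obtain ⟨t, h0, h1, e0, e1⟩ := mem_diagonal.1 hz
    have := Wedge.diagonal h.lt h.pos (dir_pos φ) (dir_pos (a + 4 * d)) h0 h1
    rw [region, Set.mem_ofPred_eq, e0, e1]
    convert this using 1
    ring
  · exact Wedge.far_left_subset h.lt h.pos (dir_pos φ) (region_far_left.1 hz)
  · exact Wedge.far_right_subset h.lt h.pos (dir_pos _) (region_far_right.1 hz)

theorem region_right_subset (h : Slopes s φ a d) :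
    region (-s) (q + dir φ) (a + 4 * d) (a + d) (-d / 6) ⊆ region s q φ a d :=
  fun _ hz => Wedge.right_subset h.lt h.pos (dir_pos φ) (region_right.1 hz)

theorem side_subset (h : Slopes s φ a d) : segment ℝ q (q + dir φ) ⊆ region s q φ a d := fun z hz => by
  obtain ⟨t, h0, h1, e0, e1⟩ := mem_side.1 hz
  have := Wedge.side h.lt h.pos (dir_pos φ) h0 h1
  rw [region, Set.mem_ofPred_eq, e0, e1]
  convert this using 1
  ring

theorem side_inter_longRegion (h : Slopes s φ a d)
    (h1 : z ∈ segment ℝ q (q + dir φ)) (h2 : z ∈ longRegion s q φ a d) :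
    z = q := by
  obtain ⟨t, t0, t1, e0, e1⟩ := mem_side.1 h1
  have key : t = 0 := by
    rcases h2 with (hz | hz) | hz
    · obtain ⟨t', t0', t1', e0', e1'⟩ := mem_diagonal.1 hz
      have h3 : t' * (dir (a + 4 * d) 0 * (a + 4 * d - φ)) = 0 := by
        linear_combination φ * (e0' - e0) + (e1 - e1')
      have h4 : dir (a + 4 * d) 0 * (a + 4 * d - φ) ≠ 0 :=
        mul_ne_zero (dir_pos _).ne' (sub_ne_zero.2 h.ne.symm)
      have h5 : t' = 0 := (mul_eq_zero.1 h3).resolve_right h4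
      rw [e0, h5, zero_mul] at e0'
      exact (mul_eq_zero.1 e0').resolve_right (dir_pos _).ne'
    · refine Wedge.side_far_left h.lt h.pos (dir_pos φ) t0 ?_ (e := dir (a + 4 * d) 0)
      have := region_far_left.1 hz
      rw [e0, e1] at this
      convert this using 1
      ring
    · refine (Wedge.side_far_right h.lt h.pos (dir_pos (a + 4 * d)) (t := t) (c := dir φ 0) ?_).elim
      have := region_far_right.1 hz
      rw [e0, e1] at this
      convert this using 1
      ring
  rw [key, zero_mul] at e0 e1
  exact plane_ext (by linarith) (by linarith)

theorem side_inter_right (h : Slopes s φ a d)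
    (h1 : z ∈ segment ℝ q (q + dir φ))
    (h2 : z ∈ region (-s) (q + dir φ) (a + 4 * d) (a + d) (-d / 6)) : z = q + dir φ := by
  obtain ⟨t, t0, t1, e0, e1⟩ := mem_side.1 h1
  have key : t = 1 := by
    refine Wedge.side_right h.lt h.pos (dir_pos φ) t1 (e := dir (a + 4 * d) 0) ?_
    have := region_right.1 h2
    rw [e0, e1] at this
    convert this using 1
    ring
  rw [key, one_mul] at e0 e1
  exact plane_ext (by rw [PiLp.add_apply]; linarith)
    (by rw [PiLp.add_apply, dir_one]; linarith)

theorem longRegion_inter_right (h : Slopes s φ a d)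
    (h1 : z ∈ longRegion s q φ a d)
    (h2 : z ∈ region (-s) (q + dir φ) (a + 4 * d) (a + d) (-d / 6)) :
    z = q + dir φ + dir (a + 4 * d) := by
  have h2' := region_right.1 h2
  rcases h1 with (hz | hz) | hz
  · obtain ⟨t, t0, t1, e0, e1⟩ := mem_diagonal.1 hz
    have key : t = 1 := by
      refine Wedge.diagonal_right h.lt h.pos (dir_pos φ) t1 (e := dir (a + 4 * d) 0) ?_
      rw [e0, e1] at h2'
      convert h2' using 1
      ring
    rw [key, one_mul] at e0 e1
    exact plane_ext (by simp only [PiLp.add_apply]; linarith)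
      (by simp only [PiLp.add_apply, dir_one]; linarith)
  · exact (Wedge.far_left_right h.lt h.pos (dir_pos φ) (region_far_left.1 hz) h2').elim
  · obtain ⟨e0, e1⟩ := Wedge.far_right_right h.lt h.pos (region_far_right.1 hz) h2'
    refine eq_of_relative h.sign_ne (q := q) ?_ ?_
    · simp only [PiLp.add_apply, e0]
      ring
    · simp only [PiLp.add_apply, e1, dir_one]
      ring

theorem diagonal_inter_far_left (h : Slopes s φ a d)
    (h1 : z ∈ segment ℝ q (q + dir φ + dir (a + 4 * d)))
    (h2 : z ∈ region s q (a + 4 * d) (a + 5 * d) (d / 6)) : z = q := by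
  obtain ⟨t, t0, t1, e0, e1⟩ := mem_diagonal.1 h1
  have key : t = 0 := by
    refine Wedge.diagonal_far_left h.lt h.pos (dir_pos φ) t0 (e := dir (a + 4 * d) 0) ?_
    have := region_far_left.1 h2
    rw [e0, e1] at this
    convert this using 1
    ring
  rw [key, zero_mul] at e0 e1
  exact plane_ext (by linarith) (by linarith)

theorem diagonal_inter_far_right (h : Slopes s φ a d)
    (h1 : z ∈ segment ℝ q (q + dir φ + dir (a + 4 * d)))
    (h2 : z ∈ region s (q + dir (a + 4 * d)) φ (a + 2 * d) (d / 6)) :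
    z = q + dir φ + dir (a + 4 * d) := by
  obtain ⟨t, t0, t1, e0, e1⟩ := mem_diagonal.1 h1
  have key : t = 1 := by
    refine Wedge.diagonal_far_right h.lt h.pos (dir_pos (a + 4 * d)) t1 (c := dir φ 0) ?_
    have := region_far_right.1 h2
    rw [e0, e1] at this
    convert this using 1
    ring
  rw [key, one_mul] at e0 e1
  exact plane_ext (by simp only [PiLp.add_apply]; linarith)
    (by simp only [PiLp.add_apply, dir_one]; linarith)

theorem far_left_inter_far_right (h : Slopes s φ a d)
    (h1 : z ∈ region s q (a + 4 * d) (a + 5 * d) (d / 6))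
    (h2 : z ∈ region s (q + dir (a + 4 * d)) φ (a + 2 * d) (d / 6)) :
    z = q + dir (a + 4 * d) := by
  obtain ⟨e0, e1⟩ := Wedge.far_left_far_right h.lt h.pos (region_far_left.1 h1)
    (region_far_right.1 h2)
  refine eq_of_relative h.sign_ne (q := q) ?_ ?_
  · simp only [PiLp.add_apply, e0]
    ring
  · simp only [PiLp.add_apply, e1, dir_one]
    ring

end Region

section Drawing

variable {V : Type*} [DecidableEq V]

/-- Planarity and confinement are proved together, because two parts of a polygon are kept apart
only by their regions. A long edge inherits the parameters of the unit edge below it and completes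
the rhombus begun there. -/
theorem Hang.isComplex {b : Bool} (T : Hang V b) {u v : V} {s φ a d : ℝ} {q : Plane}
    (h : Slopes s φ a d) {p : V → Plane} (hu : p u = q) (hv : p v = Hang.rightEnd b q φ a d)
    (hT : ∀ x ∈ T.layout q φ a d, p x.1 = x.2) :
    IsComplex p (T.edges u v : Set (Sym2 V)) ∧
      ∀ e ∈ T.edges u v, hull p e ⊆ if b then longRegion s q φ a d else region s q φ a d := by
  have side : ∀ {q : Plane} {φ : ℝ} {x y : V}, p x = q → p y = q + dir φ →
      IsComplex p {s(x, y)} := by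
    intro q φ x y hx hy
    have : dist (p x) (p y) = 1 := by rw [hx, hy, dist_self_add_right, norm_dir]
    exact IsComplex.singleton this.ge (by rw [this]; norm_num)
  have diag : ∀ {s φ a d : ℝ} {q : Plane} {x y : V}, Slopes s φ a d → p x = q →
      p y = q + dir φ + dir (a + 4 * d) → IsComplex p {s(x, y)} := by
    intro s φ a d q x y h hx hy
    have h1 : dist (p x) (p y) = ‖dir φ + dir (a + 4 * d)‖ := by
      rw [hx, hy, add_assoc, dist_self_add_right]
    obtain ⟨h2, h3⟩ := norm_dir_add_dir h.nonneg_left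
      (by linarith [h.nonneg, h.nonneg_right] : 0 ≤ a + 4 * d) h.ne
    exact IsComplex.singleton (h1 ▸ h2) (h1 ▸ h3)
  induction T generalizing u v s φ a d q with
  | leaf b =>
    simp only [Hang.edges, Finset.coe_singleton, Finset.mem_singleton, forall_eq]
    cases b with
    | false =>
      replace hv : p v = q + dir φ := hv
      refine ⟨side hu hv, ?_⟩
      rw [hull_mk, hu, hv]
      exact side_subset h
    | true =>
      replace hv : p v = q + dir φ + dir (a + 4 * d) := hv
      refine ⟨diag h hu hv, ?_⟩
      rw [hull_mk, hu, hv]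
      exact fun z hz => .inl (.inl hz)
  | unit w l r ihl ihr =>
    replace hv : p v = q + dir φ := hv
    simp only [Hang.layout, List.forall_mem_cons, List.forall_mem_append] at hT
    obtain ⟨hw, hTl, hTr⟩ := hT
    obtain ⟨cl, sl⟩ := ihl h hu hw hTl
    obtain ⟨cr, sr⟩ := ihr h.right hv hw hTr
    simp only [if_true, Bool.false_eq_true, if_false] at sl sr ⊢
    simp only [Hang.edges, Finset.coe_insert, Finset.coe_union, Finset.mem_insert,
      Finset.mem_union]
    constructor
    · rw [Set.insert_eq]
      refine (side hu hv).union (cl.union cr ?_) ?_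
      · intro e he e' he' z hz hz'
        refine ⟨w, ?_, ⟨_, l.root_mem_edges u w, Sym2.mem_mk_right _ _⟩,
          _, r.root_mem_edges v w, Sym2.mem_mk_right _ _⟩
        rw [hw]
        exact (longRegion_inter_right h (sl e he hz) (sr e' he' hz')).symm
      · rintro _ rfl e' he' z hz hz'
        rw [hull_mk, hu, hv] at hz
        rcases he' with he' | he'
        · refine ⟨u, ?_, ⟨_, rfl, Sym2.mem_mk_left _ _⟩, _, .inl (l.root_mem_edges u w),
            Sym2.mem_mk_left _ _⟩
          rw [hu]
          exact (side_inter_longRegion h hz (sl e' he' hz')).symm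
        · refine ⟨v, ?_, ⟨_, rfl, Sym2.mem_mk_right _ _⟩, _, .inr (r.root_mem_edges v w),
            Sym2.mem_mk_left _ _⟩
          rw [hv]
          exact (side_inter_right h hz (sr e' he' hz')).symm
    · rintro e (rfl | he | he)
      · rw [hull_mk, hu, hv]
        exact side_subset h
      · exact (sl e he).trans (longRegion_subset h)
      · exact (sr e he).trans (region_right_subset h)
  | long w l r ihl ihr =>
    replace hv : p v = q + dir φ + dir (a + 4 * d) := hv
    simp only [Hang.layout, List.forall_mem_cons, List.forall_mem_append] at hT
    obtain ⟨hw, hTl, hTr⟩ := hT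
    obtain ⟨cl, sl⟩ := ihl h.far_left hu hw hTl
    obtain ⟨cr, sr⟩ := ihr h.far_right hw (hv.trans (add_right_comm _ _ _)) hTr
    simp only [if_true, Bool.false_eq_true, if_false] at sl sr ⊢
    simp only [Hang.edges, Finset.coe_insert, Finset.coe_union, Finset.mem_insert,
      Finset.mem_union]
    constructor
    · rw [Set.insert_eq]
      refine (diag h hu hv).union (cl.union cr ?_) ?_
      · intro e he e' he' z hz hz'
        refine ⟨w, ?_, ⟨_, l.root_mem_edges u w, Sym2.mem_mk_right _ _⟩,
          _, r.root_mem_edges w v, Sym2.mem_mk_left _ _⟩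
        rw [hw]
        exact (far_left_inter_far_right h (sl e he hz) (sr e' he' hz')).symm
      · rintro _ rfl e' he' z hz hz'
        rw [hull_mk, hu, hv] at hz
        rcases he' with he' | he'
        · refine ⟨u, ?_, ⟨_, rfl, Sym2.mem_mk_left _ _⟩, _, .inl (l.root_mem_edges u w),
            Sym2.mem_mk_left _ _⟩
          rw [hu]
          exact (diagonal_inter_far_left h hz (sl e' he' hz')).symm
        · refine ⟨v, ?_, ⟨_, rfl, Sym2.mem_mk_right _ _⟩, _, .inr (r.root_mem_edges w v),
            Sym2.mem_mk_right _ _⟩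
          rw [hv]
          exact (diagonal_inter_far_right h hz (sr e' he' hz')).symm
    · rintro e (rfl | he | he)
      · rw [hull_mk, hu, hv]
        exact fun z hz => .inl (.inl hz)
      · exact (sl e he).trans fun z hz => .inl (.inr hz)
      · exact (sr e he).trans fun z hz => .inr hz

theorem slopes_root : Slopes 1 0 1 1 := by
  constructor <;> norm_num

theorem Hang.exists_mem_edges {b : Bool} (T : Hang V b) {u v x : V} (hx : x ∈ T.nodes) :
    ∃ e ∈ T.edges u v, x ∈ e := by
  induction T generalizing u v with
  | leaf b => simp [Hang.nodes] at hx
  | unit w l r ihl ihr =>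
    simp only [Hang.nodes, List.mem_cons, List.mem_append] at hx
    simp only [Hang.edges, Finset.mem_insert, Finset.mem_union]
    rcases hx with rfl | hx | hx
    · exact ⟨_, .inr (.inl (l.root_mem_edges u x)), Sym2.mem_mk_right _ _⟩
    · obtain ⟨e, he, hxe⟩ := ihl (u := u) (v := w) hx
      exact ⟨e, .inr (.inl he), hxe⟩
    · obtain ⟨e, he, hxe⟩ := ihr (u := v) (v := w) hx
      exact ⟨e, .inr (.inr he), hxe⟩
  | long w l r ihl ihr =>
    simp only [Hang.nodes, List.mem_cons, List.mem_append] at hx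
    simp only [Hang.edges, Finset.mem_insert, Finset.mem_union]
    rcases hx with rfl | hx | hx
    · exact ⟨_, .inr (.inl (l.root_mem_edges u x)), Sym2.mem_mk_right _ _⟩
    · obtain ⟨e, he, hxe⟩ := ihl (u := u) (v := w) hx
      exact ⟨e, .inr (.inl he), hxe⟩
    · obtain ⟨e, he, hxe⟩ := ihr (u := w) (v := v) hx
      exact ⟨e, .inr (.inr he), hxe⟩

/-- A graph contained in a triangulated polygon is drawn with ratio below 2 by the layout. -/
theorem Hang.drawing [Finite V] (T : Hang V false) {u v : V} (hall : ∀ x, x ∈ u :: v :: T.nodes)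
    {G : SimpleGraph V} (hG : ∀ x y, G.Adj x y → s(x, y) ∈ T.edges u v) {p : V → Plane}
    (hu : p u = 0) (hv : p v = dir 0) (hT : ∀ x ∈ T.layout 0 0 1 1, p x.1 = x.2) :
    IsPlanarDrawing G p ∧ drawingRatio G p < 2 := by
  have h := (T.isComplex slopes_root hu (hv.trans (zero_add _).symm) hT).1
  refine ⟨h.isPlanarDrawing (fun x => ?_) hG, h.drawingRatio_lt hG⟩
  have := hall x
  simp only [List.mem_cons] at this
  rcases this with rfl | rfl | hx
  · exact ⟨_, T.root_mem_edges _ _, Sym2.mem_mk_left _ _⟩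
  · exact ⟨_, T.root_mem_edges _ _, Sym2.mem_mk_right _ _⟩
  · exact T.exists_mem_edges hx

theorem exists_apply_eq (L : List (V × Plane)) (hL : (L.map Prod.fst).Nodup) :
    ∃ p : V → Plane, ∀ x ∈ L, p x.1 = x.2 := by
  induction L with
  | nil => exact ⟨0, by simp⟩
  | cons y L ih =>
    rw [List.map_cons, List.nodup_cons] at hL
    obtain ⟨p, hp⟩ := ih hL.2
    refine ⟨Function.update p y.1 y.2, ?_⟩
    rw [List.forall_mem_cons]
    refine ⟨Function.update_self .., fun x hx => ?_⟩
    rw [Function.update_of_ne, hp x hx]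
    rintro e
    exact hL.1 (e ▸ List.mem_map_of_mem hx)

end Drawing

theorem IsOuterplanar.exists_drawing {V : Type*} [Finite V] {G : SimpleGraph V}
    (h : IsOuterplanar G) : ∃ p : V → Plane, IsPlanarDrawing G p ∧ drawingRatio G p < 2 := by
  classical
  have := Fintype.ofFinite V
  rcases lt_or_ge (Fintype.card V) 2 with hc | hc
  -- With fewer than two vertices there is no root edge, and the ratio is a supremum over nothing.
  · have hs : Subsingleton V := Fintype.card_le_one_iff_subsingleton.1 (by omega)
    have hG : ∀ x y, ¬ G.Adj x y := fun x y hxy => hxy.ne (Subsingleton.elim x y)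
    refine ⟨fun _ => 0, ⟨fun x y _ => Subsingleton.elim x y, fun u v _ huv => (hG u v huv).elim,
      fun u v _ _ huv => (hG u v huv).elim⟩, lt_of_le_of_lt (b := 0) ?_ (by norm_num)⟩
    exact iSup_le fun u => iSup_le fun v => iSup_le fun huv => (hG u v huv).elim
  · obtain ⟨u, v, T, hnd, hall, hG, -⟩ := IsOuterplanar.exists_hang h hc
    obtain ⟨p, hp⟩ := exists_apply_eq ((u, 0) :: (v, dir 0) :: T.layout 0 0 1 1)
      (by simpa [T.layout_fst] using hnd)
    simp only [List.forall_mem_cons] at hp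
    exact ⟨p, T.drawing hall hG hp.1 hp.2.1 hp.2.2⟩

theorem IsOuterplanar.planarEdgeLengthRatio_lt {V : Type*} [Finite V] {G : SimpleGraph V}
    (h : IsOuterplanar G) : planarEdgeLengthRatio G < 2 := by
  obtain ⟨p, h1, h2⟩ := IsOuterplanar.exists_drawing h
  exact (iInf₂_le p h1).trans_lt h2

/-! ### Maximality and the number of edges. -/

section EdgeCount

variable {V : Type*} [Fintype V] {G : SimpleGraph V}

theorem IsOuterplanar.exists_hang_card [DecidableEq V] (h : IsOuterplanar G)
    (hcard : 2 ≤ Fintype.card V) : ∃ (u v : V) (T : Hang V false),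
      (∀ x y, G.Adj x y → s(x, y) ∈ T.edges u v) ∧
      IsOuterplanar (SimpleGraph.fromEdgeSet (T.edges u v : Set (Sym2 V))) ∧
      (∀ e ∈ T.edges u v, ¬ e.IsDiag) ∧ (T.edges u v).card + 3 = 2 * Fintype.card V := by
  obtain ⟨u, v, T, hnd, hall, hG, hout⟩ := IsOuterplanar.exists_hang h hcard
  refine ⟨u, v, T, hG, hout, fun e he => T.not_isDiag_of_mem_edges hnd he, ?_⟩
  have : (u :: v :: T.nodes).toFinset = Finset.univ := by
    ext x
    simpa using hall x
  have := congrArg Finset.card this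
  rw [List.toFinset_card_of_nodup hnd, Finset.card_univ] at this
  rw [T.card_edges hnd, ← this]
  simp only [List.length_cons]
  ring

theorem IsOuterplanar.ncard_edgeSet_add_three_le (h : IsOuterplanar G)
    (hcard : 2 ≤ Fintype.card V) : G.edgeSet.ncard + 3 ≤ 2 * Fintype.card V := by
  classical
  obtain ⟨u, v, T, hG, -, -, hT⟩ := IsOuterplanar.exists_hang_card h hcard
  rw [← hT, ← Set.ncard_coe_finset]
  refine Nat.add_le_add_right (Set.ncard_le_ncard (fun e he => ?_) (Finset.finite_toSet _)) 3
  induction e with | _ x y => exact hG x y he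

/-- The triangulated polygon containing `G` is itself outerplanar, so by maximality it equals `G`.
-/
theorem IsMaximalOuterplanar.ncard_edgeSet_add_three (h : IsMaximalOuterplanar G)
    (hcard : 2 ≤ Fintype.card V) : G.edgeSet.ncard + 3 = 2 * Fintype.card V := by
  classical
  obtain ⟨u, v, T, hG, hout, hd, hT⟩ := IsOuterplanar.exists_hang_card h.prop hcard
  have hle : G ≤ SimpleGraph.fromEdgeSet (T.edges u v : Set (Sym2 V)) := fun x y hxy => by
    rw [SimpleGraph.fromEdgeSet_adj]
    exact ⟨hG x y hxy, hxy.ne⟩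
  have : G.edgeSet = (T.edges u v : Set (Sym2 V)) := by
    rw [h.eq_of_le hout hle, SimpleGraph.edgeSet_fromEdgeSet, sdiff_eq_left,
      Set.disjoint_left]
    exact hd
  rw [← hT, this, Set.ncard_coe_finset]

theorem isMaximalOuterplanar_of_ncard (h : IsOuterplanar G) (hcard : 2 ≤ Fintype.card V)
    (hE : 2 * Fintype.card V ≤ G.edgeSet.ncard + 3) : IsMaximalOuterplanar G := by
  refine ⟨h, fun H hH hGH => ?_⟩
  have h1 := IsOuterplanar.ncard_edgeSet_add_three_le hH hcard
  rw [← SimpleGraph.edgeSet_subset_edgeSet]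
  exact (Set.eq_of_subset_of_ncard_le (SimpleGraph.edgeSet_subset_edgeSet.2 hGH) (by omega)
    (Set.toFinite _)).ge

end EdgeCount

/-! ## Nested triangles with a common corner -/

/-- The signed double area of the triangle `a b c`, multiplied by `s`. -/
def turn (s : ℝ) (a b c : Plane) : ℝ :=
  s * ((b 0 - a 0) * (c 1 - a 1) - (b 1 - a 1) * (c 0 - a 0))

section Turn

variable {s : ℝ} {a b c d h x y z x' y' z' : Plane}

theorem turn_rotate (s : ℝ) (a b c : Plane) : turn s b c a = turn s a b c := by
  unfold turn
  ring

theorem turn_swap (s : ℝ) (a b c : Plane) : turn s a c b = -turn s a b c := by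
  unfold turn
  ring

theorem turn_neg (s : ℝ) (a b c : Plane) : turn (-s) a b c = turn s a c b := by
  unfold turn
  ring

/-- Each segment has its ends on opposite sides of the other line, and quotients of signed areas are
the parameters of the crossing point. -/
theorem segments_meet (h1 : 0 < turn s a b c) (h2 : turn s a b d ≤ 0) (h3 : turn s c d a ≤ 0)
    (h4 : 0 ≤ turn s c d b) : ¬ Disjoint (segment ℝ a b) (segment ℝ c d) := by
  have hP : 0 < turn s a b c - turn s a b d := by linarith
  have e : turn s a b c - turn s a b d = turn s c d b - turn s c d a := by
    unfold turn
    ring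
  set P := turn s a b c - turn s a b d with hPdef
  rw [Set.not_disjoint_iff]
  refine ⟨a + (-turn s c d a / P) • (b - a), mem_segment_plane.2 ⟨-turn s c d a / P,
    div_nonneg (by linarith) hP.le, (div_le_one hP).2 (by linarith), by simp, by simp⟩,
    mem_segment_plane.2 ⟨turn s a b c / P, div_nonneg h1.le hP.le,
      (div_le_one hP).2 (by linarith), ?_, ?_⟩⟩
  · simp only [PiLp.add_apply, PiLp.smul_apply, PiLp.sub_apply, smul_eq_mul]
    field_simp
    rw [hPdef]
    unfold turn
    ring
  · simp only [PiLp.add_apply, PiLp.smul_apply, PiLp.sub_apply, smul_eq_mul]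
    field_simp
    rw [hPdef]
    unfold turn
    ring

theorem mem_segment_of_turn (h0 : 0 < turn s a b c) (h1 : turn s a b z = 0)
    (h2 : 0 ≤ turn s b c z) (h3 : 0 ≤ turn s c a z) : z ∈ segment ℝ a b := by
  have e : turn s b c z + turn s c a z + turn s a b z = turn s a b c := by
    unfold turn
    ring
  refine mem_segment_plane.2 ⟨turn s c a z / turn s a b c, div_nonneg h3 h0.le,
    (div_le_one h0).2 (by linarith), ?_, ?_⟩
  · have : turn s a b c * z 0 = turn s b c z * a 0 + turn s c a z * b 0 + turn s a b z * c 0 := by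
      unfold turn
      ring
    field_simp
    rw [h1] at this e
    linear_combination this + a 0 * e
  · have : turn s a b c * z 1 = turn s b c z * a 1 + turn s c a z * b 1 + turn s a b z * c 1 := by
      unfold turn
      ring
    field_simp
    rw [h1] at this e
    linear_combination this + a 1 * e

/-- `z` is an inner point of the triangle `a b c`. -/
def Inside (s : ℝ) (a b c z : Plane) : Prop :=
  0 < turn s a b z ∧ 0 < turn s b c z ∧ 0 < turn s c a z

theorem Inside.swap (hz : Inside s a b c z) : Inside (-s) a c b z := by
  obtain ⟨h1, h2, h3⟩ := hz
  refine ⟨?_, ?_, ?_⟩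
  · rwa [turn_neg, ← turn_rotate, ← turn_rotate]
  · rwa [turn_neg, ← turn_rotate, ← turn_rotate]
  · rwa [turn_neg, ← turn_rotate, ← turn_rotate]

theorem continuous_turn (s : ℝ) (a b : Plane) : Continuous fun z : Plane => turn s a b z := by
  unfold turn
  fun_prop

/-- A point that is neither strictly inside nor strictly beyond a side lies on the boundary, which
the connected segment `z z'` misses. -/
theorem Inside.of_disjoint (h0 : 0 < turn s a b c) (hz : Inside s a b c z)
    (h1 : Disjoint (segment ℝ z z') (segment ℝ a b))
    (h2 : Disjoint (segment ℝ z z') (segment ℝ b c))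
    (h3 : Disjoint (segment ℝ z z') (segment ℝ c a)) : Inside s a b c z' := by
  have c1 := continuous_turn s a b
  have c2 := continuous_turn s b c
  have c3 := continuous_turn s c a
  have hU : IsOpen {w | Inside s a b c w} :=
    ((isOpen_lt continuous_const c1).inter
      ((isOpen_lt continuous_const c2).inter (isOpen_lt continuous_const c3)))
  have hV : IsOpen {w | turn s a b w < 0 ∨ turn s b c w < 0 ∨ turn s c a w < 0} :=
    ((isOpen_lt c1 continuous_const).union
      ((isOpen_lt c2 continuous_const).union (isOpen_lt c3 continuous_const)))
  have hUV : Disjoint {w | Inside s a b c w}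
      {w | turn s a b w < 0 ∨ turn s b c w < 0 ∨ turn s c a w < 0} := by
    rw [Set.disjoint_left]
    rintro w ⟨e1, e2, e3⟩ (e | e | e) <;> linarith
  refine (convex_segment z z').isPreconnected.subset_left_of_subset_union hU hV hUV ?_
    ⟨z, left_mem_segment ℝ z z', hz⟩ (right_mem_segment ℝ z z')
  intro w hw
  rw [Set.disjoint_left] at h1 h2 h3
  by_contra hn
  simp only [Set.mem_union, Set.mem_ofPred_eq, Inside, not_or, not_and_or, not_lt] at hn
  obtain ⟨hn, e1, e2, e3⟩ := hn
  rcases hn with hn | hn | hn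
  · exact h1 hw (mem_segment_of_turn h0 (le_antisymm hn e1) e2 e3)
  · exact h2 hw (mem_segment_of_turn (by rwa [turn_rotate]) (le_antisymm hn e2) e3 e1)
  · exact h3 hw (mem_segment_of_turn (by rwa [← turn_rotate]) (le_antisymm hn e3) e1 e2)

/-- The triangle `h x' y'` lies inside the triangle `h x y`, apart from the common corner. -/
structure Nested (s : ℝ) (h x y x' y' : Plane) : Prop where
  left : 0 < turn s h x x'
  inside_left : Inside s h x y x'
  inside_right : Inside s h x y y'

/-- Seen from `h`, the point `z` lies between `x` and `y`; if it were on or beyond `xy`, the edge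
`hz` would meet `xy`. -/
theorem inside_of_between (hxy : 0 < turn s h x y) (h1 : 0 < turn s h x z) (h2 : 0 < turn s h z y)
    (hd : Disjoint (segment ℝ x y) (segment ℝ h z)) : Inside s h x y z := by
  refine ⟨h1, ?_, by rwa [← turn_rotate]⟩
  by_contra! hn
  refine segments_meet (s := s) (by rwa [turn_rotate]) hn ?_ h2.le hd
  rw [turn_swap]
  linarith

theorem not_aligned (hxy : 0 < turn s h x y) (hx'y : 0 < turn s h x' y)
    (h1 : x' ∉ segment ℝ h x) (h2 : x ∉ segment ℝ h x') : turn s h x x' ≠ 0 := by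
  intro h0
  rcases le_total (turn s h x' y) (turn s h x y) with hle | hle
  · exact h1 (mem_segment_of_turn hxy h0 (by
      have : turn s x y x' + turn s h x' y + turn s h x x' = turn s h x y := by
        unfold turn
        ring
      linarith) (by rw [← turn_rotate]; exact hx'y.le))
  · exact h2 (mem_segment_of_turn hx'y (by rw [turn_swap, h0, neg_zero]) (by
      have : turn s x' y x + turn s h x y - turn s h x x' = turn s h x' y := by
        unfold turn
        ring
      linarith) (by rw [← turn_rotate]; exact hxy.le))

/-- If the directions from `h` come in the order `x, x', y, y'`, then `x'` and `y` are inner points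
of the other triangle. Linear relations between the areas then place the remaining ends on the far
sides, so `xy` and `x'y'` cross. -/
theorem false_of_interlaced (hxy : 0 < turn s h x y) (hxy' : 0 < turn s h x' y')
    (hx'y : 0 < turn s h x' y) (hx : 0 < turn s h x x') (hy : 0 < turn s h y y')
    (d1 : Disjoint (segment ℝ x y) (segment ℝ h x'))
    (d2 : Disjoint (segment ℝ x' y') (segment ℝ h y))
    (d3 : Disjoint (segment ℝ x y) (segment ℝ x' y')) : False := by
  have i1 := (inside_of_between hxy hx hx'y d1).2.1
  have i2 := (inside_of_between hxy' hx'y hy d2).2.1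
  have e1 : turn s h y y' * turn s x y x' + turn s h x' y * turn s x y y' =
      -(turn s h x y * turn s x' y' y) := by
    unfold turn
    ring
  have e2 : turn s h x' y * turn s x' y' x + turn s h x x' * turn s x' y' y =
      -(turn s h x' y' * turn s x y x') := by
    unfold turn
    ring
  have p1 := mul_pos hy i1
  have p2 := mul_pos hxy i2
  have p3 := mul_pos hx i2
  have p4 := mul_pos hxy' i1
  refine segments_meet (s := s) i1 ?_ ?_ i2.le d3
  · by_contra! hn
    have := mul_pos hx'y hn
    linarith
  · by_contra! hn
    have := mul_pos hx'y hn
    linarith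

/-- The directions are distinct since no vertex lies on another's edge at `h`. Of the four possible
orders two are interlaced, and the other two put one angular sector inside the other. -/
theorem nested_or_nested (hxy : 0 < turn s h x y) (hxy' : 0 < turn s h x' y')
    (hx'y : 0 < turn s h x' y) (hyx' : 0 < turn s h x y')
    (d1 : Disjoint (segment ℝ x y) (segment ℝ h x'))
    (d2 : Disjoint (segment ℝ x y) (segment ℝ h y'))
    (d3 : Disjoint (segment ℝ x' y') (segment ℝ h x))
    (d4 : Disjoint (segment ℝ x' y') (segment ℝ h y))
    (d5 : Disjoint (segment ℝ x y) (segment ℝ x' y'))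
    (n1 : x' ∉ segment ℝ h x) (n2 : x ∉ segment ℝ h x')
    (n3 : y' ∉ segment ℝ h y) (n4 : y ∉ segment ℝ h y') :
    Nested s h x y x' y' ∨ Nested s h x' y' x y := by
  have a1 := not_aligned hxy hx'y n1 n2
  have a2 : turn s h y y' ≠ 0 := by
    have := not_aligned (s := -s) (x := y) (y := x) (x' := y') (by rwa [turn_neg])
      (by rwa [turn_neg]) n3 n4
    rwa [turn_neg, turn_swap, neg_ne_zero] at this
  rcases lt_or_gt_of_ne a1 with b1 | b1 <;> rcases lt_or_gt_of_ne a2 with b2 | b2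
  · refine (false_of_interlaced hxy' hxy hyx' ?_ ?_ d3 d2 d5.symm).elim
    · rw [turn_swap]
      linarith
    · rw [turn_swap]
      linarith
  · have b1' : 0 < turn s h x' x := by
      rw [turn_swap]
      linarith
    exact .inr ⟨b1', inside_of_between hxy' b1' hyx' d3,
      inside_of_between hxy' hx'y b2 d4⟩
  · have b2' : 0 < turn s h y' y := by
      rw [turn_swap]
      linarith
    exact .inl ⟨b1, inside_of_between hxy b1 hx'y d1, inside_of_between hxy hyx' b2' d2⟩
  · exact (false_of_interlaced hxy hxy' hx'y b1 b2 d1 d4 d5).elim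

end Turn

/-! ### Estimates -/

section Estimates

variable {s δ g : ℝ} {a b c h x y z x' y' : Plane}

theorem abs_coord_sub_le (x y : Plane) (i : Fin 2) : |x i - y i| ≤ dist x y := by
  rw [dist_eq_norm, ← PiLp.sub_apply, ← Real.norm_eq_abs]
  exact PiLp.norm_apply_le _ i

theorem abs_turn_le (hs : s = 1 ∨ s = -1) {L M : ℝ} (h1 : dist a b ≤ L) (h2 : dist a c ≤ M) :
    |turn s a b c| ≤ 2 * L * M := by
  have b0 := (abs_coord_sub_le b a 0).trans ((dist_comm b a).le.trans h1)
  have b1 := (abs_coord_sub_le b a 1).trans ((dist_comm b a).le.trans h1)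
  have c0 := (abs_coord_sub_le c a 0).trans ((dist_comm c a).le.trans h2)
  have c1 := (abs_coord_sub_le c a 1).trans ((dist_comm c a).le.trans h2)
  have e : |turn s a b c| = |(b 0 - a 0) * (c 1 - a 1) - (b 1 - a 1) * (c 0 - a 0)| := by
    unfold turn
    rcases hs with rfl | rfl
    · rw [one_mul]
    · rw [neg_one_mul, abs_neg]
  have m1 : |(b 0 - a 0) * (c 1 - a 1)| ≤ L * M := by
    rw [abs_mul]
    exact mul_le_mul b0 c1 (abs_nonneg _) (dist_nonneg.trans h1)
  have m2 : |(b 1 - a 1) * (c 0 - a 0)| ≤ L * M := by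
    rw [abs_mul]
    exact mul_le_mul b1 c0 (abs_nonneg _) (dist_nonneg.trans h1)
  rw [e]
  refine (abs_sub _ _).trans ?_
  linarith

/-- Moving two corners by `δ` changes the area by a bounded multiple of `δ`. -/
theorem abs_turn_sub_turn_le (hs : s = 1 ∨ s = -1) (hx : dist x x' ≤ δ) (hy : dist y y' ≤ δ)
    (hxy : dist z x ≤ 2) (hzy : dist z y' ≤ 3) :
    |turn s x y z - turn s x' y' z| ≤ 10 * δ := by
  have e : turn s x y z - turn s x' y' z = turn s z x y - turn s z x y' + (turn s z x y' -
      turn s z x' y') := by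
    unfold turn
    ring
  have e1 : turn s z x y - turn s z x y' =
      s * ((x 0 - z 0) * (y 1 - y' 1) - (x 1 - z 1) * (y 0 - y' 0)) := by
    unfold turn
    ring
  have e2 : turn s z x y' - turn s z x' y' =
      s * ((x 0 - x' 0) * (y' 1 - z 1) - (x 1 - x' 1) * (y' 0 - z 0)) := by
    unfold turn
    ring
  have key : ∀ {p q r t L M : ℝ}, |p| ≤ L → |q| ≤ M → |r| ≤ L → |t| ≤ M →
      |s * (p * q - r * t)| ≤ 2 * (L * M) := by
    intro p q r t L M hp hq hr ht
    have : |s| = 1 := by rcases hs with rfl | rfl <;> simp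
    rw [abs_mul, this, one_mul]
    have m1 : |p * q| ≤ L * M := by
      rw [abs_mul]
      exact mul_le_mul hp hq (abs_nonneg _) ((abs_nonneg _).trans hp)
    have m2 : |r * t| ≤ L * M := by
      rw [abs_mul]
      exact mul_le_mul hr ht (abs_nonneg _) ((abs_nonneg _).trans hr)
    refine (abs_sub _ _).trans ?_
    linarith
  have xz : ∀ i, |x i - z i| ≤ 2 := fun i =>
    (abs_coord_sub_le x z i).trans ((dist_comm _ _).le.trans hxy)
  have yz : ∀ i, |y' i - z i| ≤ 3 := fun i =>
    (abs_coord_sub_le y' z i).trans ((dist_comm _ _).le.trans hzy)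
  have xx : ∀ i, |x i - x' i| ≤ δ := fun i => (abs_coord_sub_le x x' i).trans hx
  have yy : ∀ i, |y i - y' i| ≤ δ := fun i => (abs_coord_sub_le y y' i).trans hy
  rw [e]
  refine (abs_add_le _ _).trans ?_
  rw [e1, e2]
  have k1 := key (xz 0) (yy 1) (xz 1) (yy 0)
  have k2 := key (xx 0) (yz 1) (xx 1) (yz 0)
  linarith

/-- Triangles with sides in `[1, 2 - g]` have area bounded below. -/
theorem sq_le_abs_turn (hs : s = 1 ∨ s = -1) (hg : 0 < g) (hg' : g ≤ 1 / 2)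
    (h1 : 1 ≤ dist a b) (h2 : dist a b ≤ 2 - g) (h3 : 1 ≤ dist b c) (h4 : dist b c ≤ 2 - g)
    (h5 : 1 ≤ dist c a) (h6 : dist c a ≤ 2 - g) : g ^ 2 ≤ |turn s a b c| := by
  have sq : ∀ u v : Plane, dist u v ^ 2 = (u 0 - v 0) ^ 2 + (u 1 - v 1) ^ 2 := by
    intro u v
    rw [EuclideanSpace.dist_eq, Real.sq_sqrt (by positivity), Fin.sum_univ_two, Real.dist_eq,
      Real.dist_eq, sq_abs, sq_abs]
  -- The formula of Heron, with `turn` as twice the signed area.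
  have heron : 4 * turn s a b c ^ 2 = (dist a b + dist b c + dist c a) *
      ((dist a b + dist b c - dist c a) * (dist b c + dist c a - dist a b) *
        (dist c a + dist a b - dist b c)) := by
    have e1 := sq a b
    have e2 := sq b c
    have e3 := sq c a
    have hs2 : s ^ 2 = 1 := by rcases hs with rfl | rfl <;> norm_num
    calc 4 * turn s a b c ^ 2 = s ^ 2 * (2 * (((a 0 - b 0) ^ 2 + (a 1 - b 1) ^ 2) *
          ((b 0 - c 0) ^ 2 + (b 1 - c 1) ^ 2) + ((b 0 - c 0) ^ 2 + (b 1 - c 1) ^ 2) *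
          ((c 0 - a 0) ^ 2 + (c 1 - a 1) ^ 2) + ((c 0 - a 0) ^ 2 + (c 1 - a 1) ^ 2) *
          ((a 0 - b 0) ^ 2 + (a 1 - b 1) ^ 2)) - (((a 0 - b 0) ^ 2 + (a 1 - b 1) ^ 2) ^ 2 +
          ((b 0 - c 0) ^ 2 + (b 1 - c 1) ^ 2) ^ 2 + ((c 0 - a 0) ^ 2 + (c 1 - a 1) ^ 2) ^ 2)) := by
          unfold turn
          ring
      _ = _ := by
          rw [hs2, ← e1, ← e2, ← e3]
          ring
  -- Two sides are together at least 2 and the third is at most `2 - g`.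
  have k1 : g ≤ dist a b + dist b c - dist c a := by linarith
  have k2 : g ≤ dist b c + dist c a - dist a b := by linarith
  have k3 : g ≤ dist c a + dist a b - dist b c := by linarith
  have k4 : 3 ≤ dist a b + dist b c + dist c a := by linarith
  have k5 : g * g * g ≤ (dist a b + dist b c - dist c a) * (dist b c + dist c a - dist a b) *
      (dist c a + dist a b - dist b c) := by
    have := hg.le.trans k1
    have := hg.le.trans k2
    gcongr
  have k6 : 3 * (g * g * g) ≤ 4 * turn s a b c ^ 2 := by
    rw [heron]
    gcongr
  rw [← abs_of_nonneg (sq_nonneg g)]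
  refine sq_le_sq.1 ?_
  have : g * g * g * g ≤ g * g * g * (1 / 2) := by gcongr
  nlinarith [pow_pos hg 3]

end Estimates

/-! ### Pendant triangles squeezed between nested triangles. -/

section Ears

variable {s c δ : ℝ} {h : Plane}

/-- The segment from `y₂` to `a` crosses the line `h x₃` but not the edge, so it passes beyond `x₃`.
Since it stays inside the outer triangle, it passes close to `x₃`, hence to `x₂`, and the triangle
`x₂ y₂ a` is thin. -/
theorem abs_turn_lt_of_crossing (hs : s = 1 ∨ s = -1) (hc : 0 < c) (hc1 : c ≤ 1)
    (hδ : 2000 * δ ≤ c ^ 2) {x₁ y₁ x₂ y₂ x₃ y₃ a : Plane} (hD : c ≤ turn s h x₁ y₁)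
    (h13 : dist x₁ x₃ ≤ δ) (h13' : dist y₁ y₃ ≤ δ) (h32 : dist x₃ x₂ ≤ δ)
    (l1 : dist h x₃ ≤ 2) (l2 : dist x₃ y₃ ≤ 2) (l3 : 1 ≤ dist x₂ y₂) (l4 : dist x₂ y₂ ≤ 2)
    (l5 : dist y₂ a ≤ 2) (ia : Inside s h x₁ y₁ a) (iy : Inside s h x₁ y₁ y₂)
    (hQ : turn s h x₃ a ≤ 0) (hP : 0 < turn s h x₃ y₂) (hE : 0 < turn s h x₃ y₁)
    (hd : Disjoint (segment ℝ a y₂) (segment ℝ h x₃)) : |turn s x₂ y₂ a| < c := by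
  have hδ0 : 0 ≤ δ := dist_nonneg.trans h13
  set P := turn s h x₃ y₂ with hPdef
  set Q := turn s h x₃ a with hQdef
  have hPQ : 0 < P - Q := by linarith
  set t := P / (P - Q) with ht
  have ht0 : 0 < t := div_pos hP hPQ
  have ht1 : t ≤ 1 := (div_le_one hPQ).2 (by linarith)
  have htP : t * (P - Q) = P := div_mul_cancel₀ _ hPQ.ne'
  -- The crossing point with the line `h x₃`.
  set z := y₂ + t • (a - y₂) with hz
  have z0 : z 0 = y₂ 0 + t * (a 0 - y₂ 0) := by simp [hz]
  have z1 : z 1 = y₂ 1 + t * (a 1 - y₂ 1) := by simp [hz]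
  have aff : ∀ u v, turn s u v z = (1 - t) * turn s u v y₂ + t * turn s u v a := by
    intro u v
    unfold turn
    rw [z0, z1]
    ring
  have pos : ∀ u v, 0 < turn s u v y₂ → 0 < turn s u v a → 0 < turn s u v z := by
    intro u v h1 h2
    rw [aff]
    have := mul_nonneg (sub_nonneg.2 ht1) h1.le
    have := mul_pos ht0 h2
    linarith
  have iz : Inside s h x₁ y₁ z :=
    ⟨pos _ _ iy.1 ia.1, pos _ _ iy.2.1 ia.2.1, pos _ _ iy.2.2 ia.2.2⟩
  have hz0 : turn s h x₃ z = 0 := by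
    rw [aff, ← hPdef, ← hQdef]
    linarith
  have hzy : 0 < turn s h z y₁ := by
    have := iz.2.2
    rwa [turn_rotate, turn_rotate] at this
  -- The position of the crossing point on the ray from `h`, where `x₃` is at parameter 1.
  set τ := turn s h z y₁ / turn s h x₃ y₁ with hτ
  have hτE : τ * turn s h x₃ y₁ = turn s h z y₁ := div_mul_cancel₀ _ hE.ne'
  have hτ0 : 0 < τ := div_pos hzy hE
  have w0 : z 0 = h 0 + τ * (x₃ 0 - h 0) := by
    have : turn s h x₃ y₁ * (z 0 - h 0) =
        turn s h z y₁ * (x₃ 0 - h 0) + turn s h x₃ z * (y₁ 0 - h 0) := by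
      unfold turn
      ring
    rw [hz0, ← hτE] at this
    have h2 : turn s h x₃ y₁ * (z 0 - h 0 - τ * (x₃ 0 - h 0)) = 0 := by linarith
    linarith [(mul_eq_zero.1 h2).resolve_left hE.ne']
  have w1 : z 1 = h 1 + τ * (x₃ 1 - h 1) := by
    have : turn s h x₃ y₁ * (z 1 - h 1) =
        turn s h z y₁ * (x₃ 1 - h 1) + turn s h x₃ z * (y₁ 1 - h 1) := by
      unfold turn
      ring
    rw [hz0, ← hτE] at this
    have h2 : turn s h x₃ y₁ * (z 1 - h 1 - τ * (x₃ 1 - h 1)) = 0 := by linarith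
    linarith [(mul_eq_zero.1 h2).resolve_left hE.ne']
  have hτ1 : 1 < τ := by
    by_contra! hle
    refine Set.disjoint_left.1 hd ?_ (mem_segment_plane.2 ⟨τ, hτ0.le, hle, w0, w1⟩)
    rw [segment_symm]
    exact mem_segment_plane.2 ⟨t, ht0.le, ht1, z0, z1⟩
  have hc2 : c ^ 2 ≤ c := by nlinarith
  have hE3 : |turn s x₁ y₁ x₃| ≤ 10 * δ := by
    have h1 := abs_turn_sub_turn_le (z := x₃) hs h13 h13'
      (by rw [dist_comm]; linarith) (by linarith)
    have h2 : turn s x₃ y₃ x₃ = 0 := by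
      unfold turn
      ring
    rwa [h2, sub_zero] at h1
  -- The area over `x₁ y₁` is affine along the ray: at least `c` at `h`, at most `10 * δ` at `x₃`,
  -- and still positive at `z`.
  have hτc : c * (τ - 1) ≤ 20 * δ := by
    have h1 := iz.2.1
    have h2 : turn s x₁ y₁ z = turn s h x₁ y₁ + τ * (turn s x₁ y₁ x₃ - turn s h x₁ y₁) := by
      unfold turn
      rw [w0, w1]
      ring
    rw [h2] at h1
    have h3 := (abs_le.1 hE3).2
    have h4 : c / 2 ≤ turn s h x₁ y₁ - turn s x₁ y₁ x₃ := by linarith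
    have h5 : c / 2 * (τ - 1) ≤ (turn s h x₁ y₁ - turn s x₁ y₁ x₃) * (τ - 1) :=
      mul_le_mul_of_nonneg_right h4 (by linarith)
    linarith
  have hτ' : τ - 1 ≤ c / 100 := by
    have : c * (τ - 1) ≤ c * (c / 100) := by nlinarith
    exact le_of_mul_le_mul_left this hc
  have hzx : dist x₂ z ≤ 3 * c / 100 := by
    have h1 : dist z x₃ ≤ c / 50 := by
      have : z - x₃ = (τ - 1) • (x₃ - h) := plane_ext
        (by simp only [PiLp.sub_apply, PiLp.smul_apply, smul_eq_mul]; rw [w0]; ring)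
        (by simp only [PiLp.sub_apply, PiLp.smul_apply, smul_eq_mul]; rw [w1]; ring)
      rw [dist_eq_norm, this, norm_smul, ← dist_eq_norm x₃, dist_comm x₃, Real.norm_eq_abs,
        abs_of_pos (by linarith)]
      calc _ ≤ c / 100 * 2 := mul_le_mul hτ' l1 dist_nonneg (by positivity)
        _ = c / 50 := by ring
    have h2 := dist_triangle z x₃ x₂
    rw [dist_comm]
    linarith
  -- The base has length at least 1 and `z` is near `x₂`, so `z` is not near `y₂`, while the whole
  -- segment has length at most 2.
  have ht4 : 1 / 4 ≤ t := by
    have h1 : dist z y₂ = t * dist y₂ a := by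
      have : z - y₂ = t • (a - y₂) := by simp [hz]
      rw [dist_eq_norm, this, norm_smul, ← dist_eq_norm a, dist_comm a, Real.norm_eq_abs,
        abs_of_pos ht0]
    have h2 := dist_triangle x₂ z y₂
    have h3 : t * dist y₂ a ≤ t * 2 := mul_le_mul_of_nonneg_left l5 ht0.le
    linarith
  have h1 := abs_turn_le hs l4 hzx
  have h2 : turn s x₂ y₂ z = t * turn s x₂ y₂ a := by
    rw [aff]
    unfold turn
    ring
  rw [h2, abs_mul, abs_of_pos ht0] at h1
  have h3 : 1 / 4 * |turn s x₂ y₂ a| ≤ t * |turn s x₂ y₂ a| :=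
    mul_le_mul_of_nonneg_right ht4 (abs_nonneg _)
  linarith

/-- Triangles `h x y` and `x y a` with bounded sides and areas. -/
structure Ear (c : ℝ) (h x y a : Plane) : Prop where
  left : dist h x ≤ 2
  right : dist h y ≤ 2
  one_le : 1 ≤ dist x y
  base : dist x y ≤ 2
  apex_left : dist x a ≤ 2
  apex_right : dist y a ≤ 2
  area : c ≤ |turn 1 h x y|
  apex_area : c ≤ |turn 1 x y a|

/-- The edges of `x y a` neither meet the edges of `h x' y'`, nor do the corresponding edges at `h`
contain the ends of one another. -/
structure Apart (h x y a x' y' : Plane) : Prop where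
  base_left : Disjoint (segment ℝ x y) (segment ℝ h x')
  base_right : Disjoint (segment ℝ x y) (segment ℝ h y')
  base_base : Disjoint (segment ℝ x y) (segment ℝ x' y')
  left : x' ∉ segment ℝ h x
  right : y' ∉ segment ℝ h y
  left_left : Disjoint (segment ℝ x a) (segment ℝ h x')
  left_right : Disjoint (segment ℝ x a) (segment ℝ h y')
  left_base : Disjoint (segment ℝ x a) (segment ℝ x' y')
  right_left : Disjoint (segment ℝ y a) (segment ℝ h x')

theorem abs_turn_eq (s : ℝ) (hs : s = 1 ∨ s = -1) (a b c : Plane) :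
    |turn s a b c| = |turn 1 a b c| := by
  unfold turn
  rcases hs with rfl | rfl
  · rfl
  · rw [neg_one_mul, one_mul, abs_neg]

variable {x₁ y₁ a₁ x₂ y₂ a₂ x₃ y₃ a₃ : Plane}

/-- The apex `a₂` is inside the outer triangle and not inside the inner one, because its edge to
`x₂` crosses neither boundary. Beyond the side `h x₃` or `h y₃`, the crossing lemma applies, the
second time after a reflection. Beyond `x₃ y₃`, it lies between two almost equal lines. In each case
the pendant triangle is too small. -/
theorem false_of_nested_nested (hs : s = 1 ∨ s = -1) (hc : 0 < c) (hc1 : c ≤ 1)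
    (hδ : 2000 * δ ≤ c ^ 2) (e₁ : Ear c h x₁ y₁ a₁)
    (e₂ : Ear c h x₂ y₂ a₂) (e₃ : Ear c h x₃ y₃ a₃)
    (p₁ : c ≤ turn s h x₁ y₁) (p₂ : c ≤ turn s h x₂ y₂) (p₃ : c ≤ turn s h x₃ y₃)
    (dx12 : dist x₁ x₂ ≤ δ) (dy12 : dist y₁ y₂ ≤ δ) (dx13 : dist x₁ x₃ ≤ δ) (dy13 : dist y₁ y₃ ≤ δ)
    (dx23 : dist x₂ x₃ ≤ δ) (dy23 : dist y₂ y₃ ≤ δ)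
    (n12 : Nested s h x₁ y₁ x₂ y₂) (n23 : Nested s h x₂ y₂ x₃ y₃)
    (a21 : Apart h x₂ y₂ a₂ x₁ y₁) (a23 : Apart h x₂ y₂ a₂ x₃ y₃) : False := by
  have hδ0 : 0 ≤ δ := dist_nonneg.trans dx12
  have hc2 : c ^ 2 ≤ c := by nlinarith
  have ia : Inside s h x₁ y₁ a₂ := n12.inside_left.of_disjoint (by linarith) a21.left_left
    a21.left_base (segment_symm ℝ h y₁ ▸ a21.left_right)
  have na : ¬ Inside s h x₃ y₃ a₂ := fun hi => by
    have := hi.of_disjoint (z' := x₂) (by linarith) (segment_symm ℝ x₂ a₂ ▸ a23.left_left)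
      (segment_symm ℝ x₂ a₂ ▸ a23.left_base)
      (segment_symm ℝ x₂ a₂ ▸ segment_symm ℝ h y₃ ▸ a23.left_right)
    have h1 := this.1
    rw [turn_swap] at h1
    linarith [n23.left]
  have area : c ≤ |turn s x₂ y₂ a₂| := by
    rw [abs_turn_eq s hs]
    exact e₂.apex_area
  -- Moving corners by `δ` changes an area by at most `10 * δ`, less than `c`, so mixed triangles
  -- keep their orientation.
  have close : ∀ {x y x' y' : Plane}, c ≤ turn s h x' y' → dist x x' ≤ δ → dist y y' ≤ δ →
      dist h x ≤ 2 → dist h y' ≤ 3 → 0 < turn s h x y := by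
    intro x y x' y' hp h1 h2 h3 h4
    have := (abs_le.1 (abs_turn_sub_turn_le hs h1 h2 h3 h4)).1
    rw [turn_rotate s h x y, turn_rotate s h x' y'] at this
    nlinarith
  have c3 := e₃.left
  have c3' := e₃.right
  by_cases q1 : turn s h x₃ a₂ ≤ 0
  · refine absurd area (not_le.2 (abs_turn_lt_of_crossing hs hc hc1 hδ p₁ dx13 dy13
      (by rwa [dist_comm]) e₃.left e₃.base e₂.one_le e₂.base e₂.apex_right ia n12.inside_right q1 ?_ ?_
      (segment_symm ℝ y₂ a₂ ▸ a23.right_left)))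
    · exact close p₃ (by rw [dist_self]; exact hδ0) dy23 c3 (by linarith)
    · exact close p₃ (by rw [dist_self]; exact hδ0) dy13 c3 (by linarith)
  by_cases q2 : turn s y₃ h a₂ ≤ 0
  · have hs' : -s = 1 ∨ -s = -1 := by rcases hs with rfl | rfl <;> simp
    have key := abs_turn_lt_of_crossing (a := a₂) (x₂ := y₂) (y₂ := x₂) hs' hc hc1 hδ
      (by rwa [turn_neg] : c ≤ turn (-s) h y₁ x₁) dy13 dx13 (by rwa [dist_comm]) e₃.right
      (by rw [dist_comm]; exact e₃.base) (by rw [dist_comm]; exact e₂.one_le)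
      (by rw [dist_comm]; exact e₂.base) e₂.apex_left ia.swap n12.inside_left.swap
      (by rwa [turn_neg, ← turn_rotate, ← turn_rotate])
      (by rw [turn_neg]; exact close p₃ dx23 (by rw [dist_self]; exact hδ0) e₂.left (by linarith))
      (by
        rw [turn_neg]
        exact close p₃ dx13 (by rw [dist_self]; exact hδ0) e₁.left (by linarith))
      (segment_symm ℝ x₂ a₂ ▸ a23.left_right)
    rw [turn_neg, turn_rotate] at key
    linarith
  have q3 : turn s x₃ y₃ a₂ ≤ 0 := by
    by_contra! h3
    exact na ⟨not_le.1 q1, h3, not_le.1 q2⟩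
  have i2 := ia.2.1
  have m1 := abs_turn_sub_turn_le (z := a₂) hs (by rwa [dist_comm] : dist x₂ x₁ ≤ δ)
    (by rwa [dist_comm] : dist y₂ y₁ ≤ δ) (by rw [dist_comm]; exact e₂.apex_left) (by
      have := dist_triangle a₂ y₂ y₁
      have := e₂.apex_right
      rw [dist_comm] at this dy12
      nlinarith)
  have m2 := abs_turn_sub_turn_le (z := a₂) hs dx23 dy23 (by rw [dist_comm]; exact e₂.apex_left) (by
      have := dist_triangle a₂ y₂ y₃
      have := e₂.apex_right
      rw [dist_comm] at this
      nlinarith)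
  have m3 : |turn s x₂ y₂ a₂| ≤ 10 * δ := abs_le.2
    ⟨by linarith [(abs_le.1 m1).1], by linarith [(abs_le.1 m2).2]⟩
  nlinarith

end Ears

section ThreeEars

variable {c δ : ℝ} {h : Plane}

/-- Nesting orients each pair of the three triangles, and among three there is always a directed
chain through all of them. -/
theorem false_of_three_ears (hc : 0 < c) (hc1 : c ≤ 1) (hδ : 2000 * δ ≤ c ^ 2)
    {X Y A : Fin 3 → Plane} (ear : ∀ i, Ear c h (X i) (Y i) (A i))
    (apart : ∀ i j, i ≠ j → Apart h (X i) (Y i) (A i) (X j) (Y j))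
    (dX : ∀ i j, dist (X i) (X j) ≤ δ) (dY : ∀ i j, dist (Y i) (Y j) ≤ δ) : False := by
  have hδ0 : 0 ≤ δ := dist_nonneg.trans (dX 0 0)
  obtain ⟨s, hs, h0⟩ : ∃ s : ℝ, (s = 1 ∨ s = -1) ∧ c ≤ turn s h (X 0) (Y 0) := by
    rcases le_abs.1 (ear 0).area with h1 | h1
    · exact ⟨1, .inl rfl, h1⟩
    · exact ⟨-1, .inr rfl, by rwa [turn_neg, turn_swap]⟩
  have close : ∀ i j, 0 < turn s h (X i) (Y j) := by
    intro i j
    have := (abs_le.1 (abs_turn_sub_turn_le hs (dX i 0) (dY j 0) (ear i).left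
      (by linarith [(ear 0).right]))).1
    rw [turn_rotate s h (X i) (Y j), turn_rotate s h (X 0) (Y 0)] at this
    nlinarith
  have pos : ∀ i, c ≤ turn s h (X i) (Y i) := by
    intro i
    have := (ear i).area
    rwa [← abs_turn_eq s hs, abs_of_pos (close i i)] at this
  have nested : ∀ i j, i ≠ j → Nested s h (X i) (Y i) (X j) (Y j) ∨
      Nested s h (X j) (Y j) (X i) (Y i) := fun i j hij =>
    have a := apart i j hij
    have b := apart j i hij.symm
    nested_or_nested (close i i) (close j j) (close j i) (close i j) a.base_left a.base_right
      b.base_left b.base_right a.base_base a.left b.left a.right b.right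
  have chain : ∀ i j l, i ≠ j → j ≠ l → Nested s h (X i) (Y i) (X j) (Y j) →
      Nested s h (X j) (Y j) (X l) (Y l) → False := fun i j l hij hjl n1 n2 =>
    false_of_nested_nested hs hc hc1 hδ (ear i) (ear j) (ear l) (pos i) (pos j) (pos l) (dX i j)
      (dY i j) (dX i l) (dY i l) (dX j l) (dY j l) n1 n2 (apart j i hij.symm) (apart j l hjl)
  rcases nested 0 1 (by decide) with h01 | h10
  · rcases nested 1 2 (by decide) with h12 | h21
    · exact chain 0 1 2 (by decide) (by decide) h01 h12
    · rcases nested 0 2 (by decide) with h02 | h20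
      · exact chain 0 2 1 (by decide) (by decide) h02 h21
      · exact chain 2 0 1 (by decide) (by decide) h20 h01
  · rcases nested 0 2 (by decide) with h02 | h20
    · exact chain 1 0 2 (by decide) (by decide) h10 h02
    · rcases nested 1 2 (by decide) with h12 | h21
      · exact chain 1 2 0 (by decide) (by decide) h12 h20
      · exact chain 2 1 0 (by decide) (by decide) h21 h10

end ThreeEars

/-! ## Fans with pendant triangles -/

section PendantFan

open PendantFanVertex

variable {k : ℕ}

theorem pendantFan_hub_rim (i : Fin (k + 2)) : (pendantFan k).Adj hub (rim i) := by
  simp [pendantFan]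

theorem pendantFan_rim_rim {i j : Fin (k + 2)} (h : (i : ℕ) + 1 = j) :
    (pendantFan k).Adj (rim i) (rim j) := by
  simp only [pendantFan, SimpleGraph.fromRel_adj, ne_eq, rim.injEq]
  exact ⟨fun e => by subst e; omega, .inl h⟩

theorem pendantFan_apex_castSucc (i : Fin (k + 1)) :
    (pendantFan k).Adj (apex i) (rim i.castSucc) := by
  simp [pendantFan]

theorem pendantFan_apex_succ (i : Fin (k + 1)) : (pendantFan k).Adj (apex i) (rim i.succ) := by
  simp [pendantFan]

/-- The vertices in the order in which they appear on the outer face. -/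
def fanRank : PendantFanVertex k → ℕ
  | hub => 0
  | rim i => 2 * i + 1
  | apex i => 2 * i + 2

theorem fanRank_injective : Function.Injective (fanRank (k := k)) := by
  rintro (_ | ⟨i, hi⟩ | ⟨i, hi⟩) (_ | ⟨j, hj⟩ | ⟨j, hj⟩) h <;>
    simp only [fanRank, reduceCtorEq, rim.injEq, apex.injEq, Fin.mk.injEq] at h ⊢ <;> omega

theorem fanRank_of_adj {x y : PendantFanVertex k} (h : (pendantFan k).Adj x y)
    (hlt : fanRank x < fanRank y) : fanRank x = 0 ∧ fanRank y % 2 = 1 ∨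
      fanRank y = fanRank x + 1 ∨ fanRank x % 2 = 1 ∧ fanRank y = fanRank x + 2 := by
  rcases x with _ | ⟨i, hi⟩ | ⟨i, hi⟩ <;> rcases y with _ | ⟨j, hj⟩ | ⟨j, hj⟩ <;>
    simp [pendantFan, fanRank, Fin.ext_iff] at h hlt ⊢ <;> omega

theorem pendantFan_noncrossingOn : NoncrossingOn (pendantFan k) Set.univ fanRank := by
  refine ⟨fun x _ y _ hxy => fanRank_injective hxy, fun p _ q _ r _ s _ e1 e2 e3 h1 h2 => ?_⟩
  have := fanRank_of_adj h1 (e1.trans e2)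
  have := fanRank_of_adj h2 (e2.trans e3)
  omega

instance : Finite (PendantFanVertex k) := by
  have : Function.Injective fun x : PendantFanVertex k =>
      (⟨min (fanRank x) (2 * k + 3), by omega⟩ : Fin (2 * k + 4)) := by
    intro x y h
    apply fanRank_injective
    have hb : ∀ z : PendantFanVertex k, fanRank z ≤ 2 * k + 3 := by
      rintro (_ | ⟨i, hi⟩ | ⟨i, hi⟩) <;> simp only [fanRank] <;> omega
    simpa [hb] using h
  exact Finite.of_injective _ this

theorem card_pendantFanVertex : Nat.card (PendantFanVertex k) = 2 * k + 4 := by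
  have e : PendantFanVertex k ≃ Unit ⊕ Fin (k + 2) ⊕ Fin (k + 1) :=
    { toFun := fun x => match x with
        | hub => .inl ()
        | rim i => .inr (.inl i)
        | apex i => .inr (.inr i)
      invFun := fun x => match x with
        | .inl _ => hub
        | .inr (.inl i) => rim i
        | .inr (.inr i) => apex i
      left_inv := by rintro (_ | i | i) <;> rfl
      right_inv := by rintro (_ | i | i) <;> rfl }
  rw [Nat.card_congr e]
  simp
  ring

theorem le_ncard_pendantFan_edgeSet : 4 * k + 5 ≤ (pendantFan k).edgeSet.ncard := by
  let f : Fin (k + 2) ⊕ Fin (k + 1) ⊕ Fin (k + 1) ⊕ Fin (k + 1) → (pendantFan k).edgeSet := fun x =>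
    match x with
    | .inl i => ⟨s(hub, rim i), pendantFan_hub_rim i⟩
    | .inr (.inl i) => ⟨s(rim i.castSucc, rim i.succ), pendantFan_rim_rim (by simp)⟩
    | .inr (.inr (.inl i)) => ⟨s(apex i, rim i.castSucc), pendantFan_apex_castSucc i⟩
    | .inr (.inr (.inr i)) => ⟨s(apex i, rim i.succ), pendantFan_apex_succ i⟩
  have hf : Function.Injective f := by
    rintro (⟨i, hi⟩ | ⟨i, hi⟩ | ⟨i, hi⟩ | ⟨i, hi⟩) (⟨j, hj⟩ | ⟨j, hj⟩ | ⟨j, hj⟩ | ⟨j, hj⟩) h <;>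
      replace h := congrArg Subtype.val h <;> simp [f, Fin.ext_iff] at h ⊢ <;> omega
  have := Nat.card_le_card_of_injective f hf
  rw [Nat.card_coe_set_eq] at this
  refine le_trans ?_ this
  simp
  omega

/-- With `2 * k + 4` vertices an outerplanar graph has at most `4 * k + 5` edges, and the fan has
that many. -/
theorem isMaximalOuterplanar_pendantFan (k : ℕ) : IsMaximalOuterplanar (pendantFan k) := by
  have := Fintype.ofFinite (PendantFanVertex k)
  have hcard : Fintype.card (PendantFanVertex k) = 2 * k + 4 := by
    rw [← card_pendantFanVertex, Nat.card_eq_fintype_card]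
  refine isMaximalOuterplanar_of_ncard pendantFan_noncrossingOn.isOuterplanar (by omega) ?_
  have := le_ncard_pendantFan_edgeSet (k := k)
  omega

end PendantFan

/-! ### Normalising the shortest edge. -/

section Scaling

variable {V : Type*} {G : SimpleGraph V} {p : V → Plane}

theorem dist_le_of_drawingRatio_lt {r : ℝ} (hr : 0 ≤ r) (h : drawingRatio G p < ENNReal.ofReal r)
    (hp : Function.Injective p) {u v x y : V} (huv : G.Adj u v) (hxy : G.Adj x y) :
    dist (p u) (p v) ≤ r * dist (p x) (p y) := by
  have h1 : edist (p u) (p v) / edist (p x) (p y) ≤ drawingRatio G p :=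
    le_iSup_of_le u <| le_iSup_of_le v <| le_iSup_of_le huv <| le_iSup_of_le x <|
      le_iSup_of_le y <| le_iSup_of_le hxy le_rfl
  have h2 : edist (p x) (p y) ≠ 0 := fun e => hxy.ne (hp (edist_eq_zero.1 e))
  have h3 := (ENNReal.div_le_iff h2 (edist_ne_top _ _)).1 (h1.trans h.le)
  rw [edist_dist, edist_dist, ← ENNReal.ofReal_mul hr] at h3
  exact (ENNReal.ofReal_le_ofReal_iff (mul_nonneg hr dist_nonneg)).1 h3

theorem _root_.IsPlanarDrawing.smul (h : IsPlanarDrawing G p) {m : ℝ} (hm : m ≠ 0) :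
    IsPlanarDrawing G fun v => m • p v := by
  have inj : Function.Injective fun z : Plane => m • z := smul_right_injective _ hm
  have seg : ∀ x y : Plane,
      segment ℝ (m • x) (m • y) = (fun z : Plane => m • z) '' segment ℝ x y := by
    intro x y
    rw [segment_eq_image', segment_eq_image', Set.image_image]
    refine Set.image_congr fun t _ => ?_
    rw [smul_add, smul_comm m t, smul_sub m]
  refine ⟨inj.comp h.injective, fun u v w huv hw => ?_, fun u v x y huv hxy hne => ?_⟩
  · rw [seg, inj.mem_set_image] at hw
    exact h.vertex_edge u v w huv hw
  · rw [seg, seg, ← Set.image_inter inj]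
    refine (Set.image_mono (h.edge_edge u v x y huv hxy hne)).trans ?_
    rw [Set.image_image]

theorem _root_.IsPlanarDrawing.exists_scaled [Finite V] (h : IsPlanarDrawing G p) {r : ℝ}
    (hr : 0 ≤ r) (hlt : drawingRatio G p < ENNReal.ofReal r) : ∃ p' : V → Plane,
      IsPlanarDrawing G p' ∧
      ∀ u v, G.Adj u v → 1 ≤ dist (p' u) (p' v) ∧ dist (p' u) (p' v) ≤ r := by
  by_cases hne : {q : V × V | G.Adj q.1 q.2}.Nonempty
  · obtain ⟨⟨x, y⟩, hxy, hmin⟩ := Set.exists_min_image _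
      (fun q : V × V => dist (p q.1) (p q.2)) (Set.toFinite _) hne
    simp only [Set.mem_ofPred_eq] at hxy hmin
    have hm : 0 < dist (p x) (p y) := dist_pos.2 fun e => hxy.ne (h.injective e)
    refine ⟨_, h.smul (inv_ne_zero hm.ne'), fun u v huv => ?_⟩
    rw [dist_smul₀, norm_inv, Real.norm_of_nonneg hm.le, inv_mul_eq_div, le_div_iff₀ hm,
      div_le_iff₀ hm, one_mul]
    exact ⟨hmin (u, v) huv, dist_le_of_drawingRatio_lt hr hlt h.injective huv hxy⟩
  · exact ⟨p, h, fun u v huv => (hne ⟨(u, v), huv⟩).elim⟩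

theorem _root_.IsPlanarDrawing.disjoint (h : IsPlanarDrawing G p) {u v x y : V} (huv : G.Adj u v)
    (hxy : G.Adj x y) (h1 : u ≠ x) (h2 : u ≠ y) (h3 : v ≠ x) (h4 : v ≠ y) :
    Disjoint (segment ℝ (p u) (p v)) (segment ℝ (p x) (p y)) := by
  rw [Set.disjoint_iff_inter_eq_empty, ← Set.subset_empty_iff]
  refine (h.edge_edge u v x y huv hxy fun e => ?_).trans ?_
  · rcases Sym2.eq_iff.1 e with ⟨e, -⟩ | ⟨e, -⟩
    exacts [h1 e, h2 e]
  · rintro _ ⟨w, ⟨rfl | rfl, hw⟩, -⟩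
    · rcases hw with hw | hw
      exacts [h1 hw, h2 hw]
    · rcases hw with hw | hw
      exacts [h3 hw, h4 hw]

end Scaling

/-! ### Long fans have ratio close to 2. -/

section LowerBound

open PendantFanVertex

/-- Cover the compact ball by `M` balls of radius `δ / 2`; among `2 * M + 1` points some three share
a ball. -/
theorem exists_three_close {δ : ℝ} (hδ : 0 < δ) : ∃ M : ℕ, ∀ f : Fin (2 * M + 1) → Plane × Plane,
    (∀ i, ‖f i‖ ≤ 2) → ∃ e : Fin 3 → Fin (2 * M + 1), Function.Injective e ∧
      ∀ i j, dist (f (e i)) (f (e j)) ≤ δ := by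
  classical
  obtain ⟨t, -, ht, hcov⟩ := (isCompact_closedBall (0 : Plane × Plane) 2).finite_cover_balls
    (half_pos hδ)
  refine ⟨ht.toFinset.card, fun f hf => ?_⟩
  have : ∀ i, ∃ z ∈ t, f i ∈ Metric.ball z (δ / 2) := fun i => by
    have := hcov (mem_closedBall_zero_iff.2 (hf i))
    simpa using this
  choose g hg hball using this
  obtain ⟨z, -, hz⟩ := Finset.exists_lt_card_fiber_of_mul_lt_card_of_maps_to (n := 2)
    (s := Finset.univ) (t := ht.toFinset) (f := g) (fun i _ => ht.mem_toFinset.2 (hg i))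
    (by rw [Finset.card_univ, Fintype.card_fin]; omega)
  obtain ⟨a, b, c, ha, hb, hc, hab, hac, hbc⟩ := Finset.two_lt_card_iff.1 hz
  simp only [Finset.mem_filter, Finset.mem_univ, true_and] at ha hb hc
  refine ⟨![a, b, c], ?_, ?_⟩
  · intro i j hij
    fin_cases i <;> fin_cases j <;> simp_all
  · have key : ∀ i, f (![a, b, c] i) ∈ Metric.ball z (δ / 2) := by
      intro i
      fin_cases i
      · exact ha ▸ hball a
      · exact hb ▸ hball b
      · exact hc ▸ hball c
    intro i j
    have h1 := Metric.mem_ball.1 (key i)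
    have h2 := Metric.mem_ball.1 (key j)
    have := dist_triangle_right (f (![a, b, c] i)) (f (![a, b, c] j)) z
    linarith

theorem exists_le_drawingRatio_pendantFan {g : ℝ} (hg : 0 < g) (hg' : g ≤ 1 / 2) : ∃ k, ∀ p,
    IsPlanarDrawing (pendantFan k) p → ENNReal.ofReal (2 - g) ≤ drawingRatio (pendantFan k) p := by
  have hδ : 0 < (g ^ 2) ^ 2 / 2000 := by positivity
  obtain ⟨M, hM⟩ := exists_three_close hδ
  refine ⟨4 * M, fun p hp => ?_⟩
  by_contra! hlt
  obtain ⟨q, hq, hlen⟩ := hp.exists_scaled (by linarith) hlt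
  -- Every other path edge is used, so that the chosen triangles have only the hub in common.
  let l : Fin (2 * M + 1) → Fin (4 * M + 1) := fun t => ⟨2 * t, by omega⟩
  let x : Fin (2 * M + 1) → PendantFanVertex (4 * M) := fun t => rim (l t).castSucc
  let y : Fin (2 * M + 1) → PendantFanVertex (4 * M) := fun t => rim (l t).succ
  let a : Fin (2 * M + 1) → PendantFanVertex (4 * M) := fun t => apex (l t)
  have hhx : ∀ t, (pendantFan (4 * M)).Adj hub (x t) := fun t => pendantFan_hub_rim _
  have hhy : ∀ t, (pendantFan (4 * M)).Adj hub (y t) := fun t => pendantFan_hub_rim _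
  have hxy : ∀ t, (pendantFan (4 * M)).Adj (x t) (y t) := fun t => pendantFan_rim_rim (by simp)
  have hxa : ∀ t, (pendantFan (4 * M)).Adj (x t) (a t) := fun t =>
    (pendantFan_apex_castSucc (l t)).symm
  have hya : ∀ t, (pendantFan (4 * M)).Adj (y t) (a t) := fun t => (pendantFan_apex_succ (l t)).symm
  have ear : ∀ t, Ear (g ^ 2) (q hub) (q (x t)) (q (y t)) (q (a t)) := by
    intro t
    obtain ⟨a1, a2⟩ := hlen _ _ (hhx t)
    obtain ⟨b1, b2⟩ := hlen _ _ (hhy t)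
    obtain ⟨c1, c2⟩ := hlen _ _ (hxy t)
    obtain ⟨d1, d2⟩ := hlen _ _ (hxa t)
    obtain ⟨e1, e2⟩ := hlen _ _ (hya t)
    refine ⟨by linarith, by linarith, c1, by linarith, by linarith, by linarith, ?_, ?_⟩
    · exact sq_le_abs_turn (.inl rfl) hg hg' a1 a2 c1 c2 (dist_comm (q hub) _ ▸ b1)
        (dist_comm (q hub) _ ▸ b2)
    · exact sq_le_abs_turn (.inl rfl) hg hg' c1 c2 e1 e2 (dist_comm (q (x t)) _ ▸ d1)
        (dist_comm (q (x t)) _ ▸ d2)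
  have apart : ∀ t t', t ≠ t' → Apart (q hub) (q (x t)) (q (y t)) (q (a t)) (q (x t'))
      (q (y t')) := by
    intro t t' htt
    have htt' : (t : ℕ) ≠ t' := fun e => htt (Fin.ext e)
    have xh : ∀ t, x t ≠ hub := fun t => by simp [x]
    have yh : ∀ t, y t ≠ hub := fun t => by simp [y]
    have ah : ∀ t, a t ≠ hub := fun t => by simp [a]
    have ax : ∀ t t', a t ≠ x t' := fun t t' => by simp [x, a]
    have ay : ∀ t t', a t ≠ y t' := fun t t' => by simp [y, a]
    have xx : x t ≠ x t' := by simp [x, l, Fin.ext_iff]; omega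
    have xy : x t ≠ y t' := by simp [x, y, l, Fin.ext_iff]; omega
    have yx : y t ≠ x t' := by simp [x, y, l, Fin.ext_iff]; omega
    have yy : y t ≠ y t' := by simp [y, l, Fin.ext_iff]; omega
    exact
      { base_left := hq.disjoint (hxy t) (hhx t') (xh t) xx (yh t) yx
        base_right := hq.disjoint (hxy t) (hhy t') (xh t) xy (yh t) yy
        base_base := hq.disjoint (hxy t) (hxy t') xx xy yx yy
        left := fun hm => (hq.vertex_edge _ _ _ (hhx t) hm).elim (xh t') xx.symm
        right := fun hm => (hq.vertex_edge _ _ _ (hhy t) hm).elim (yh t') yy.symm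
        left_left := hq.disjoint (hxa t) (hhx t') (xh t) xx (ah t) (ax t t')
        left_right := hq.disjoint (hxa t) (hhy t') (xh t) xy (ah t) (ay t t')
        left_base := hq.disjoint (hxa t) (hxy t') xx xy (ax t t') (ay t t')
        right_left := hq.disjoint (hya t) (hhx t') (yh t) yx (ah t) (ax t t') }
  obtain ⟨e, he, hclose⟩ := hM (fun t => (q (x t) - q hub, q (y t) - q hub)) fun t => by
    rw [Prod.norm_def, max_le_iff]
    dsimp only
    rw [← dist_eq_norm, ← dist_eq_norm, dist_comm _ (q hub), dist_comm _ (q hub)]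
    exact ⟨(ear t).left, (ear t).right⟩
  refine false_of_three_ears (c := g ^ 2) (δ := (g ^ 2) ^ 2 / 2000) (by positivity) (by nlinarith)
    (by linarith) (X := fun i => q (x (e i))) (Y := fun i => q (y (e i)))
    (A := fun i => q (a (e i))) (fun i => ear (e i)) (fun i j hij => apart _ _ (he.ne hij)) ?_ ?_
  · intro i j
    have := (le_max_left _ _).trans ((Prod.dist_eq (x := _) (y := _)).symm.le.trans (hclose i j))
    simpa using this
  · intro i j
    have := (le_max_right _ _).trans ((Prod.dist_eq (x := _) (y := _)).symm.le.trans (hclose i j))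
    simpa using this

theorem exists_lt_planarEdgeLengthRatio_pendantFan {ε : ℝ} (hε : 0 < ε) : ∃ k : ℕ,
    IsMaximalOuterplanar (pendantFan k) ∧
      ENNReal.ofReal (2 - ε) < planarEdgeLengthRatio (pendantFan k) := by
  -- Halving makes the final inequality strict, and the minimum with 1 keeps the gap at most `1 /
  -- 2`.
  have hg : 0 < min ε 1 / 2 := by positivity
  obtain ⟨k, hk⟩ := exists_le_drawingRatio_pendantFan hg (by linarith [min_le_right ε 1])
  refine ⟨k, isMaximalOuterplanar_pendantFan k, lt_of_lt_of_le ?_ (le_iInf₂ hk)⟩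
  refine (ENNReal.ofReal_lt_ofReal_iff ?_).2 ?_
  · linarith [min_le_right ε 1]
  · linarith [min_le_left ε 1]

end LowerBound

/-! ## Outerplanar embeddings of maximal outerplanar graphs -/

section Embedding

theorem connected_eq_univ {V : Type*} {G : SimpleGraph V} (h : G.Connected) {S : Set V} {u : V}
    (hu : u ∈ S) (hS : ∀ x ∈ S, ∀ y, G.Adj x y → y ∈ S) (v : V) : v ∈ S := by
  have := (SimpleGraph.reachable_iff_reflTransGen u v).1 (h.preconnected u v)
  induction this with
  | refl => exact hu
  | tail _ hxy ih => exact hS _ ih _ hxy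

variable {n m f : ℕ} {D : EdgeList n m f} {G : SimpleGraph (Fin n)}

theorem adj_ends (hD : D.IsOuterplanarEmbedding G)
    (h : Fin m) : G.Adj (D.origin h) (D.origin (D.twin h)) :=
  (hD.adj_iff _ _).2 ⟨h, rfl, rfl⟩

theorem face_succ (hD : D.IsOuterplanarEmbedding G)
    (h : Fin m) : D.face (D.succ h) = D.face h :=
  (hD.face_eq_iff _ _).2 (Equiv.Perm.sameCycle_apply_left.2 (Equiv.Perm.SameCycle.refl _ _))

theorem two_le_card (hD : D.IsOuterplanarEmbedding G) :
    2 ≤ n := by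
  have : Nonempty (Fin n) := hD.connected.nonempty
  have v := Classical.arbitrary (Fin n)
  have h1 := (adj_ends hD (D.vertexEdge v)).ne
  by_contra! hn
  exact h1 (Fin.ext (by omega))

theorem two_mul_ncard_edgeSet (hD : D.IsOuterplanarEmbedding G) :
    2 * G.edgeSet.ncard = m := by
  classical
  have e : Fin m ≃ G.Dart :=
    Equiv.ofBijective (fun h => ⟨(D.origin h, D.origin (D.twin h)), adj_ends hD h⟩) <| by
      constructor
      · intro h h' hh
        rw [SimpleGraph.Dart.ext_iff, Prod.ext_iff] at hh
        exact hD.ends_injective h h' hh.1 hh.2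
      · rintro ⟨⟨u, v⟩, huv⟩
        obtain ⟨h, h1, h2⟩ := (hD.adj_iff u v).1 huv
        exact ⟨h, by ext <;> simp [h1, h2]⟩
  have := Fintype.card_congr e
  rw [Fintype.card_fin, SimpleGraph.dart_card_eq_twice_card_edges] at this
  rw [this, ← SimpleGraph.coe_edgeFinset, Set.ncard_coe_finset]

/-- A face with only two sides consists of a half-edge and its twin. Then the rotation fixes both,
both ends have degree 1, and by connectedness there are only two vertices. -/
theorem not_leaf_pair (hD : D.IsOuterplanarEmbedding G)
    (hn : 3 ≤ n) (h : Fin m) : D.succ (D.succ h) ≠ h := by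
  intro hh
  have h1 : D.succ h = D.twin h := hD.ends_injective _ _ (hD.origin_succ h) (by
    rw [hD.twin_twin, ← hD.origin_succ, hh])
  have only : ∀ g, D.succ (D.twin g) = g → ∀ g', D.origin g = D.origin g' → g' = g := by
    intro g hg g' hgg'
    obtain ⟨i, hi⟩ := hD.rotation g g' hgg'
    rw [← hi]
    exact Function.IsFixedPt.perm_zpow (e := D.succ * D.twin) (x := g) hg i
  have o1 := only h (by rw [← h1, hh])
  have o2 := only (D.twin h) (by rw [hD.twin_twin, h1])
  have hall := connected_eq_univ hD.connected (S := {D.origin h, D.origin (D.twin h)})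
    (u := D.origin h) (.inl rfl) (by
      rintro x (rfl | rfl) y hxy
      · obtain ⟨g, hg, rfl⟩ := (hD.adj_iff _ _).1 hxy
        rw [o1 g hg.symm]
        exact .inr rfl
      · obtain ⟨g, hg, rfl⟩ := (hD.adj_iff _ _).1 hxy
        rw [o2 g hg.symm, hD.twin_twin]
        exact .inl rfl)
  have : (Finset.univ : Finset (Fin n)) ⊆ {D.origin h, D.origin (D.twin h)} := fun x _ => by
    simpa using hall x
  have := (Finset.card_le_card this).trans Finset.card_le_two
  rw [Finset.card_univ, Fintype.card_fin] at this
  omega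

theorem succ_ne (hD : D.IsOuterplanarEmbedding G)
    (h : Fin m) : D.succ h ≠ h := fun e => by
  have := (adj_ends hD h).ne
  rw [← hD.origin_succ, e] at this
  exact this rfl

theorem three_le_card_face (hD : D.IsOuterplanarEmbedding G)
    (hn : 3 ≤ n) (h : Fin m) :
    ({h, D.succ h, D.succ (D.succ h)} : Finset (Fin m)).card = 3 := by
  rw [Finset.card_eq_three]
  exact ⟨_, _, _, (succ_ne hD h).symm, (not_leaf_pair hD hn h).symm,
    fun e => succ_ne hD h (D.succ.injective e).symm, rfl⟩

theorem card_faces (hD : D.IsOuterplanarEmbedding G)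
    (hG : IsMaximalOuterplanar G) : f + 1 = n := by
  have h1 := two_mul_ncard_edgeSet hD
  have h2 := IsMaximalOuterplanar.ncard_edgeSet_add_three hG
    (by rw [Fintype.card_fin]; exact two_le_card hD)
  rw [Fintype.card_fin] at h2
  have := hD.euler
  have := two_le_card hD
  omega

theorem card_half_edges (hD : D.IsOuterplanarEmbedding G)
    (hG : IsMaximalOuterplanar G) : m + 6 = 4 * n := by
  have h1 := two_mul_ncard_edgeSet hD
  have h2 := IsMaximalOuterplanar.ncard_edgeSet_add_three hG
    (by rw [Fintype.card_fin]; exact two_le_card hD)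
  rw [Fintype.card_fin] at h2
  omega

/-- The outer face has at least `n` half-edges and each of the `n - 2` inner faces at least 3.
Together this is `4 * n - 6`, the number of all half-edges, so equality holds everywhere. -/
theorem card_face_eq (hD : D.IsOuterplanarEmbedding G)
    (hG : IsMaximalOuterplanar G) : (Finset.univ.filter fun h => D.face h = D.outer).card = n ∧
    ∀ i ≠ D.outer, (Finset.univ.filter fun h => D.face h = i).card = 3 := by
  have hm := card_half_edges hD hG
  have hf := card_faces hD hG
  have hn := two_le_card hD
  have houter : n ≤ (Finset.univ.filter fun h => D.face h = D.outer).card := by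
    calc n = (Finset.univ : Finset (Fin n)).card := by simp
      _ ≤ ((Finset.univ.filter fun h => D.face h = D.outer).image D.origin).card := by
        refine Finset.card_le_card fun v _ => ?_
        obtain ⟨h, h1, h2⟩ := hD.outer_vertex v
        exact Finset.mem_image.2 ⟨h, by simpa using h1, h2⟩
      _ ≤ _ := Finset.card_image_le
  have hinner : ∀ i ∈ Finset.univ.erase D.outer,
      3 ≤ (Finset.univ.filter fun h => D.face h = i).card := by
    intro i hi
    have hn3 : 3 ≤ n := by
      have h1 : 1 < Fintype.card (Fin f) := Fintype.one_lt_card_iff.2 ⟨i, D.outer, by simpa using hi⟩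
      rw [Fintype.card_fin] at h1
      omega
    rw [← three_le_card_face hD hn3 (D.faceEdge i)]
    refine Finset.card_le_card fun h hh => ?_
    simp only [Finset.mem_insert, Finset.mem_singleton] at hh
    rw [Finset.mem_filter]
    rcases hh with rfl | rfl | rfl <;> simp [face_succ hD, hD.face_faceEdge]
  have hsum := Finset.card_eq_sum_card_fiberwise (s := Finset.univ) (t := Finset.univ) (f := D.face)
    (fun _ _ => Finset.mem_coe.2 (Finset.mem_univ _))
  rw [Finset.card_univ, Fintype.card_fin, ← Finset.add_sum_erase _ _ (Finset.mem_univ D.outer)]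
    at hsum
  have hconst : ∑ i ∈ Finset.univ.erase D.outer, 3 = 3 * (f - 1) := by
    rw [Finset.sum_const, Finset.card_erase_of_mem (Finset.mem_univ _), Finset.card_univ,
      Fintype.card_fin, smul_eq_mul, mul_comm]
  have hle := Finset.sum_le_sum hinner
  have heq : ∑ i ∈ Finset.univ.erase D.outer, 3 = ∑ i ∈ Finset.univ.erase D.outer,
      (Finset.univ.filter fun h => D.face h = i).card := by omega
  refine ⟨by omega, fun i hi => ?_⟩
  exact ((Finset.sum_eq_sum_iff_of_le hinner).1 heq i (by simpa using hi)).symm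

theorem origin_injOn_outer (hD : D.IsOuterplanarEmbedding G)
    (hG : IsMaximalOuterplanar G) {h h' : Fin m} (h1 : D.face h = D.outer) (h2 : D.face h' = D.outer)
    (e : D.origin h = D.origin h') : h = h' := by
  have himg : (Finset.univ.filter fun h => D.face h = D.outer).image D.origin = Finset.univ := by
    refine Finset.eq_univ_of_forall fun v => ?_
    obtain ⟨h, h1, h2⟩ := hD.outer_vertex v
    exact Finset.mem_image.2 ⟨h, by simpa using h1, h2⟩
  have hcard := congrArg Finset.card himg
  rw [Finset.card_univ, Fintype.card_fin] at hcard
  have hinj := Finset.card_image_iff.1 (hcard.trans (card_face_eq hD hG).1.symm)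
  exact hinj (by simpa using h1) (by simpa using h2) e

theorem three_le_of_inner (hD : D.IsOuterplanarEmbedding G)
    (hG : IsMaximalOuterplanar G) {h : Fin m} (hi : D.face h ≠ D.outer) : 3 ≤ n := by
  have h1 : 1 < Fintype.card (Fin f) := Fintype.one_lt_card_iff.2 ⟨_, _, hi⟩
  rw [Fintype.card_fin] at h1
  have := card_faces hD hG
  omega

theorem eq_of_face_eq (hD : D.IsOuterplanarEmbedding G)
    (hG : IsMaximalOuterplanar G) {h g : Fin m} (hi : D.face h ≠ D.outer) (hg : D.face g = D.face h) :
    g = h ∨ g = D.succ h ∨ g = D.succ (D.succ h) := by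
  have hsub : ({h, D.succ h, D.succ (D.succ h)} : Finset (Fin m)) ⊆
      Finset.univ.filter fun g => D.face g = D.face h := by
    intro x hx
    simp only [Finset.mem_insert, Finset.mem_singleton] at hx
    rw [Finset.mem_filter]
    rcases hx with rfl | rfl | rfl <;> simp [face_succ hD]
  have := Finset.eq_of_subset_of_card_le hsub (by
    rw [(card_face_eq hD hG).2 _ hi, three_le_card_face hD (three_le_of_inner hD hG hi)])
  have hmem : g ∈ ({h, D.succ h, D.succ (D.succ h)} : Finset (Fin m)) := by
    rw [this]
    simpa using hg
  simpa using hmem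

theorem succ_succ_succ (hD : D.IsOuterplanarEmbedding G)
    (hG : IsMaximalOuterplanar G) {h : Fin m} (hi : D.face h ≠ D.outer) :
    D.succ (D.succ (D.succ h)) = h := by
  rcases eq_of_face_eq hD hG hi (g := D.succ (D.succ (D.succ h))) (by simp [face_succ hD])
    with e | e | e
  · exact e
  · exact (not_leaf_pair hD (three_le_of_inner hD hG hi) h (D.succ.injective e)).elim
  · exact (succ_ne hD h (D.succ.injective (D.succ.injective e))).elim

theorem twin_not_outer (hD : D.IsOuterplanarEmbedding G)
    (hG : IsMaximalOuterplanar G) (hn : 3 ≤ n) {h : Fin m} (hh : D.face h = D.outer) :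
    D.face (D.twin h) ≠ D.outer := by
  intro ht
  have h1 : D.succ h = D.twin h :=
    origin_injOn_outer hD hG (by rw [face_succ hD, hh]) ht (hD.origin_succ h)
  have h2 : D.succ (D.twin h) = h :=
    origin_injOn_outer hD hG (by rw [face_succ hD, ht]) hh (by rw [hD.origin_succ, hD.twin_twin])
  exact not_leaf_pair hD hn h (by rw [h1, h2])

/-- If `W` contains the outer face and, with an inner face, all faces adjacent to it, then all faces
at a vertex belong to `W` as soon as one inner face does. -/
theorem mem_of_rotation (hD : D.IsOuterplanarEmbedding G)
    (hG : IsMaximalOuterplanar G) {W : Finset (Fin f)} (hout : D.outer ∈ W)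
    (hW : ∀ g, D.face g ∈ W → D.face g ≠ D.outer → D.face (D.twin g) ∈ W) {h h' : Fin m}
    (h1 : D.face h ∈ W) (h2 : D.face h ≠ D.outer) (hh' : D.origin h = D.origin h') :
    D.face h' ∈ W := by
  obtain ⟨e, he, heh⟩ := hD.outer_vertex (D.origin h)
  set σ := D.succ * D.twin with hσ
  have hface : ∀ g, D.face (σ g) = D.face (D.twin g) := fun g => face_succ hD _
  have horig : ∀ g, D.origin (σ g) = D.origin g := fun g => by
    rw [hσ, Equiv.Perm.mul_apply, hD.origin_succ, hD.twin_twin]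
  have horig' : ∀ i : ℕ, D.origin ((σ ^ i) e) = D.origin e := by
    intro i
    induction i with
    | zero => rfl
    | succ i ih => rw [pow_succ', Equiv.Perm.mul_apply, horig, ih]
  -- The outer face has only one half-edge `e` at the vertex. So the rotation runs through inner
  -- faces until it returns to `e`, and membership in `W` spreads along this path.
  have inner : ∀ i : ℕ, (σ ^ i) e ≠ e → D.face ((σ ^ i) e) ≠ D.outer := fun i hi ho =>
    hi (origin_injOn_outer hD hG ho he (horig' i))
  have step : ∀ i : ℕ, (∀ j, 0 < j → j ≤ i + 1 → (σ ^ j) e ≠ e) →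
      (D.face ((σ ^ (i + 1)) e) ∈ W ↔ D.face (σ e) ∈ W) := by
    intro i hi
    induction i with
    | zero => simp
    | succ i ih =>
      rw [← ih fun j hj hji => hi j hj (by omega)]
      have n1 := inner (i + 1) (hi _ (by omega) (by omega))
      have n2 := inner (i + 1 + 1) (hi _ (by omega) le_rfl)
      rw [pow_succ', Equiv.Perm.mul_apply, hface] at n2 ⊢
      constructor
      · intro h3
        have := hW _ h3 n2
        rwa [hD.twin_twin] at this
      · exact fun h3 => hW _ h3 n1
  have reach : ∀ g, D.origin g = D.origin h → D.face g ≠ D.outer →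
      (D.face g ∈ W ↔ D.face (σ e) ∈ W) := by
    intro g hg hgo
    have hex : ∃ i : ℕ, (σ ^ i) e = g :=
      (hD.rotation e g (heh.trans hg.symm)).exists_nat_pow_eq
    have hmin := Nat.find_spec hex
    have hlt := fun j => Nat.find_min hex (m := j)
    obtain ⟨i, hi⟩ : ∃ i, Nat.find hex = i + 1 := by
      refine Nat.exists_eq_succ_of_ne_zero fun h0 => hgo ?_
      rw [h0, pow_zero, Equiv.Perm.one_apply] at hmin
      rw [← hmin, he]
    rw [hi] at hmin hlt
    rw [← hmin]
    refine step i fun j hj hji hje => hlt (i + 1 - j) (by omega) ?_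
    calc (σ ^ (i + 1 - j)) e = (σ ^ (i + 1 - j)) ((σ ^ j) e) := by rw [hje]
      _ = g := by rw [← Equiv.Perm.mul_apply, ← pow_add, Nat.sub_add_cancel hji, hmin]
  by_cases ho : D.face h' = D.outer
  · rwa [ho]
  · exact (reach h' hh'.symm ho).2 ((reach h rfl h2).1 h1)

/-- Membership spreads around each vertex by `mem_of_rotation`, and from a vertex to its neighbours
through a face at their common edge. -/
theorem eq_univ_of_closed (hD : D.IsOuterplanarEmbedding G)
    (hG : IsMaximalOuterplanar G) {W : Finset (Fin f)} (hout : D.outer ∈ W) {h : Fin m}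
    (hh : D.face h = D.outer) (hth : D.face (D.twin h) ∈ W)
    (hW : ∀ g, D.face g ∈ W → D.face g ≠ D.outer → D.face (D.twin g) ∈ W) (i : Fin f) : i ∈ W := by
  by_cases hn : n ≤ 2
  · have := card_faces hD hG
    have e : i = D.outer := Fin.ext (by omega)
    rwa [e]
  push Not at hn
  have good : ∀ v, ∀ g, D.origin g = v → D.face g ∈ W := by
    refine connected_eq_univ hD.connected (S := {v | ∀ g, D.origin g = v → D.face g ∈ W})
      (u := D.origin (D.twin h)) (fun g hg => ?_) fun x hx y hxy g hg => ?_
    · exact mem_of_rotation hD hG hout hW hth (twin_not_outer hD hG hn hh) hg.symm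
    · obtain ⟨k, rfl, rfl⟩ := (hD.adj_iff _ _).1 hxy
      by_cases hk : D.face k = D.outer
      · have h1 : D.face (D.twin k) ∈ W := by
          rw [← face_succ hD]
          exact hx _ (by rw [hD.origin_succ, hD.twin_twin])
        exact mem_of_rotation hD hG hout hW h1 (twin_not_outer hD hG hn hk) hg.symm
      · refine mem_of_rotation hD hG hout hW (h := D.succ k) ?_ ?_ ?_
        · rw [face_succ hD]
          exact hx k rfl
        · rwa [face_succ hD]
        · rw [hD.origin_succ, hg]
  rw [← hD.face_faceEdge i]
  exact good _ _ rfl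

end Embedding

/-! ## Traversing the inner faces -/

section Traverse

variable {n m f : ℕ}

/-- The left end of an edge, given by a half-edge that runs to the right iff `o` is true. -/
def leftEnd (D : EdgeList n m f) (o : Bool) (h : Fin m) : Fin n :=
  if o then D.origin h else D.origin (D.twin h)

/-- The right end of an edge, given by a half-edge that runs to the right iff `o` is true. -/
def rightVertex (D : EdgeList n m f) (o : Bool) (h : Fin m) : Fin n :=
  if o then D.origin (D.twin h) else D.origin h

/-- The third corner of a triangle. -/
def corner (D : EdgeList n m f) (h : Fin m) : Fin n := D.origin (D.succ (D.succ h))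

/-- The half-edge behind the left side of a triangle. -/
def leftSide (D : EdgeList n m f) (o : Bool) (h : Fin m) : Fin m :=
  if o then D.twin (D.succ (D.succ h)) else D.twin (D.succ h)

/-- The half-edge behind the right side of a triangle. -/
def rightSide (D : EdgeList n m f) (o : Bool) (h : Fin m) : Fin m :=
  if o then D.twin (D.succ h) else D.twin (D.succ (D.succ h))

/-- `Traverse D W b o h W' T`: starting through the half-edge `h`, a depth-first search of the faces
that avoids the set `W` finds the tree of triangles `T` and ends with the set `W'` of faces. -/
inductive Traverse (D : EdgeList n m f) : Finset (Fin f) → (b : Bool) → Bool → Fin m →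
    Finset (Fin f) → Hang (Fin n) b → Prop
  | skip {W b o h} (hW : D.face h ∈ W) : Traverse D W b o h W (.leaf b)
  | unit {W o h W₁ W₂ l r} (hW : D.face h ∉ W)
      (hl : Traverse D (insert (D.face h) W) true o (leftSide D o h) W₁ l)
      (hr : Traverse D W₁ false (!o) (rightSide D o h) W₂ r) :
      Traverse D W false o h W₂ (.unit (corner D h) l r)
  | long {W o h W₁ W₂ l r} (hW : D.face h ∉ W)
      (hl : Traverse D (insert (D.face h) W) false o (leftSide D o h) W₁ l)
      (hr : Traverse D W₁ false o (rightSide D o h) W₂ r) :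
      Traverse D W true o h W₂ (.long (corner D h) l r)

variable {D : EdgeList n m f} {W W' : Finset (Fin f)} {b o : Bool} {h : Fin m}
  {T : Hang (Fin n) b}

theorem Traverse.subset (t : Traverse D W b o h W' T) : insert (D.face h) W ⊆ W' := by
  induction t with
  | skip hW => rw [Finset.insert_eq_of_mem hW]
  | unit hW hl hr ihl ihr =>
    exact ((Finset.subset_insert _ _).trans ihl).trans ((Finset.subset_insert _ _).trans ihr)
  | long hW hl hr ihl ihr =>
    exact ((Finset.subset_insert _ _).trans ihl).trans ((Finset.subset_insert _ _).trans ihr)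

theorem Traverse.card (t : Traverse D W b o h W' T) : W'.card = W.card + T.nodes.length := by
  induction t with
  | skip hW => rfl
  | unit hW hl hr ihl ihr =>
    rw [ihr, ihl, Finset.card_insert_of_notMem hW, Hang.nodes, List.length_cons, List.length_append]
    ring
  | long hW hl hr ihl ihr =>
    rw [ihr, ihl, Finset.card_insert_of_notMem hW, Hang.nodes, List.length_cons, List.length_append]
    ring

variable {G : SimpleGraph (Fin n)}

/-- The right side has both descriptions: over a unit edge it runs from the old right end to the new
corner, over a long edge from the new corner to the right end. -/
theorem sides (hD : D.IsOuterplanarEmbedding G) (hG : IsMaximalOuterplanar G) (o : Bool)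
    (hi : D.face h ≠ D.outer) :
    leftEnd D o (leftSide D o h) = leftEnd D o h ∧ rightVertex D o (leftSide D o h) = corner D h ∧
    leftEnd D (!o) (rightSide D o h) = rightVertex D o h ∧
    rightVertex D (!o) (rightSide D o h) = corner D h ∧
    leftEnd D o (rightSide D o h) = corner D h ∧
    rightVertex D o (rightSide D o h) = rightVertex D o h := by
  have h3 := succ_succ_succ hD hG hi
  have e1 : D.origin (D.twin (D.succ (D.succ h))) = D.origin h := by rw [← hD.origin_succ, h3]
  have e2 := hD.origin_succ (D.succ h)
  have e3 := hD.origin_succ h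
  cases o <;> simp [leftEnd, rightVertex, leftSide, rightSide, corner, hD.twin_twin, e1, e2, e3]

theorem face_twin_sides (hD : D.IsOuterplanarEmbedding G) (o : Bool) :
    D.face (D.twin (leftSide D o h)) = D.face h ∧
      D.face (D.twin (rightSide D o h)) = D.face h := by
  cases o <;> simp [leftSide, rightSide, hD.twin_twin, face_succ hD]

theorem adj_ends_sides (hD : D.IsOuterplanarEmbedding G) (o : Bool) (h : Fin m) :
    G.Adj (leftEnd D o h) (rightVertex D o h) := by
  cases o
  · exact (adj_ends hD h).symm
  · exact adj_ends hD h

theorem Traverse.edges_subset (hD : D.IsOuterplanarEmbedding G) (hG : IsMaximalOuterplanar G)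
    (t : Traverse D W b o h W' T) (ho : D.outer ∈ W) :
    ∀ e ∈ T.edges (leftEnd D o h) (rightVertex D o h), e ∈ G.edgeSet := by
  induction t with
  | skip hW =>
    intro e he
    rw [Hang.edges, Finset.mem_singleton] at he
    rw [he]
    exact adj_ends_sides hD _ _
  | @unit W o h W₁ W₂ l r hW hl hr ihl ihr =>
    have hi : D.face h ≠ D.outer := fun e => hW (e ▸ ho)
    obtain ⟨e1, e2, e3, e4, -, -⟩ := sides hD hG o hi
    have il := ihl (Finset.mem_insert_of_mem ho)
    have ir := ihr (hl.subset (Finset.mem_insert_of_mem (Finset.mem_insert_of_mem ho)))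
    rw [e1, e2] at il
    rw [e3, e4] at ir
    intro e he
    rw [Hang.edges, Finset.mem_insert, Finset.mem_union] at he
    rcases he with rfl | he | he
    · exact adj_ends_sides hD _ _
    · exact il e he
    · exact ir e he
  | @long W o h W₁ W₂ l r hW hl hr ihl ihr =>
    have hi : D.face h ≠ D.outer := fun e => hW (e ▸ ho)
    obtain ⟨e1, e2, -, -, e3, e4⟩ := sides hD hG o hi
    have il := ihl (Finset.mem_insert_of_mem ho)
    have ir := ihr (hl.subset (Finset.mem_insert_of_mem (Finset.mem_insert_of_mem ho)))
    rw [e1, e2] at il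
    rw [e3, e4] at ir
    intro e he
    rw [Hang.edges, Finset.mem_insert, Finset.mem_union] at he
    rcases he with rfl | he | he
    · exact adj_ends_sides hD _ _
    · exact il e he
    · exact ir e he

theorem origin_mem_triangle (hD : D.IsOuterplanarEmbedding G) (hG : IsMaximalOuterplanar G)
    (o : Bool) (hi : D.face h ≠ D.outer) {g : Fin m} (hg : D.face g = D.face h) :
    D.origin g = leftEnd D o h ∨ D.origin g = rightVertex D o h ∨ D.origin g = corner D h := by
  rcases eq_of_face_eq hD hG hi hg with rfl | rfl | rfl
  · cases o <;> simp [leftEnd, rightVertex]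
  · rw [hD.origin_succ]
    cases o <;> simp [leftEnd, rightVertex]
  · exact .inr (.inr rfl)

theorem Traverse.origin_mem (hD : D.IsOuterplanarEmbedding G) (hG : IsMaximalOuterplanar G)
    (t : Traverse D W b o h W' T) (ho : D.outer ∈ W) {g : Fin m} (h1 : D.face g ∈ W')
    (h2 : D.face g ∉ W) : D.origin g = leftEnd D o h ∨ D.origin g = rightVertex D o h ∨
      D.origin g ∈ T.nodes := by
  induction t with
  | skip hW => exact (h2 h1).elim
  | @unit W o h W₁ W₂ l r hW hl hr ihl ihr =>
    have hi : D.face h ≠ D.outer := fun e => hW (e ▸ ho)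
    obtain ⟨e1, e2, e3, e4, -, -⟩ := sides hD hG o hi
    rw [e1, e2] at ihl
    rw [e3, e4] at ihr
    simp only [Hang.nodes, List.mem_cons, List.mem_append]
    by_cases hg : D.face g = D.face h
    · rcases origin_mem_triangle hD hG o hi hg with e | e | e
      · exact .inl e
      · exact .inr (.inl e)
      · exact .inr (.inr (.inl e))
    by_cases hg1 : D.face g ∈ W₁
    · rcases ihl (Finset.mem_insert_of_mem ho) hg1 (by simp [hg, h2]) with e | e | e
      · exact .inl e
      · exact .inr (.inr (.inl e))
      · exact .inr (.inr (.inr (.inl e)))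
    · rcases ihr (hl.subset (Finset.mem_insert_of_mem (Finset.mem_insert_of_mem ho))) h1 hg1 with e | e | e
      · exact .inr (.inl e)
      · exact .inr (.inr (.inl e))
      · exact .inr (.inr (.inr (.inr e)))
  | @long W o h W₁ W₂ l r hW hl hr ihl ihr =>
    have hi : D.face h ≠ D.outer := fun e => hW (e ▸ ho)
    obtain ⟨e1, e2, -, -, e3, e4⟩ := sides hD hG o hi
    rw [e1, e2] at ihl
    rw [e3, e4] at ihr
    simp only [Hang.nodes, List.mem_cons, List.mem_append]
    by_cases hg : D.face g = D.face h
    · rcases origin_mem_triangle hD hG o hi hg with e | e | e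
      · exact .inl e
      · exact .inr (.inl e)
      · exact .inr (.inr (.inl e))
    by_cases hg1 : D.face g ∈ W₁
    · rcases ihl (Finset.mem_insert_of_mem ho) hg1 (by simp [hg, h2]) with e | e | e
      · exact .inl e
      · exact .inr (.inr (.inl e))
      · exact .inr (.inr (.inr (.inl e)))
    · rcases ihr (hl.subset (Finset.mem_insert_of_mem (Finset.mem_insert_of_mem ho))) h1 hg1 with e | e | e
      · exact .inr (.inr (.inl e))
      · exact .inr (.inl e)
      · exact .inr (.inr (.inr (.inr e)))

theorem closed_insert (hD : D.IsOuterplanarEmbedding G) (hG : IsMaximalOuterplanar G)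
    {W₁ W₂ : Finset (Fin f)} (hi : D.face h ≠ D.outer) (hs : insert (D.face h) W ⊆ W₁)
    (hl : insert (D.face (leftSide D o h)) W₁ ⊆ W₂) (hr : D.face (rightSide D o h) ∈ W₂)
    (ht : D.face (D.twin h) ∈ W) {g : Fin m} (hg : D.face g = D.face h) :
    D.face (D.twin g) ∈ W₂ := by
  have hl' := hl (Finset.mem_insert_self _ _)
  rcases eq_of_face_eq hD hG hi hg with rfl | rfl | rfl
  · exact hl (Finset.mem_insert_of_mem (hs (Finset.mem_insert_of_mem ht)))
  · cases o
    · exact hl'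
    · exact hr
  · cases o
    · exact hr
    · exact hl'

/-- The search enters a triangle from a visited face and then searches across the two other sides,
so all its neighbours end up visited. -/
theorem Traverse.closed (hD : D.IsOuterplanarEmbedding G) (hG : IsMaximalOuterplanar G)
    (t : Traverse D W b o h W' T) (ho : D.outer ∈ W) (ht : D.face (D.twin h) ∈ W) {g : Fin m}
    (h1 : D.face g ∈ W') (h2 : D.face g ∉ W) : D.face (D.twin g) ∈ W' := by
  have node : ∀ {W : Finset (Fin f)} {o b c d : Bool} {h : Fin m} {W₁ W₂ : Finset (Fin f)}
      {l : Hang (Fin n) b} {r : Hang (Fin n) c}, D.face h ∉ W →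
      Traverse D (insert (D.face h) W) b o (leftSide D o h) W₁ l →
      Traverse D W₁ c d (rightSide D o h) W₂ r → D.outer ∈ W → D.face (D.twin h) ∈ W →
      (D.outer ∈ insert (D.face h) W → D.face (D.twin (leftSide D o h)) ∈ insert (D.face h) W →
        D.face g ∈ W₁ → D.face g ∉ insert (D.face h) W → D.face (D.twin g) ∈ W₁) →
      (D.outer ∈ W₁ → D.face (D.twin (rightSide D o h)) ∈ W₁ →
        D.face g ∈ W₂ → D.face g ∉ W₁ → D.face (D.twin g) ∈ W₂) →
      D.face g ∈ W₂ → D.face g ∉ W → D.face (D.twin g) ∈ W₂ := by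
    intro W o b c d h W₁ W₂ l r hW hl hr ho ht ihl ihr h1 h2
    have hi : D.face h ≠ D.outer := fun e => hW (e ▸ ho)
    have sl := (Finset.subset_insert _ _).trans hl.subset
    have sr := (Finset.subset_insert _ _).trans hr.subset
    obtain ⟨t1, t2⟩ := face_twin_sides (h := h) hD o
    by_cases hg : D.face g = D.face h
    · exact closed_insert hD hG hi (sl.trans sr) (Finset.insert_subset
        (sr (hl.subset (Finset.mem_insert_self _ _))) subset_rfl)
        (hr.subset (Finset.mem_insert_self _ _)) ht hg
    by_cases hg1 : D.face g ∈ W₁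
    · exact sr (ihl (Finset.mem_insert_of_mem ho) (t1 ▸ Finset.mem_insert_self _ _) hg1
        (by simp [hg, h2]))
    · exact ihr (sl (Finset.mem_insert_of_mem ho)) (t2 ▸ sl (Finset.mem_insert_self _ _)) h1 hg1
  induction t with
  | skip hW => exact (h2 h1).elim
  | unit hW hl hr ihl ihr => exact node hW hl hr ho ht ihl ihr h1 h2
  | long hW hl hr ihl ihr => exact node hW hl hr ho ht ihl ihr h1 h2

/-- A traversal that starts at the outer face finds the whole graph. -/
theorem Traverse.complete (hD : D.IsOuterplanarEmbedding G) (hG : IsMaximalOuterplanar G)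
    {T : Hang (Fin n) false} (hh : D.face h = D.outer)
    (t : Traverse D {D.outer} false false (D.twin h) W' T) :
    (D.origin h :: D.origin (D.twin h) :: T.nodes).Nodup ∧
      (∀ x, x ∈ D.origin h :: D.origin (D.twin h) :: T.nodes) ∧
      (∀ x y, G.Adj x y → s(x, y) ∈ T.edges (D.origin h) (D.origin (D.twin h))) ∧
      T.nodes.length + 2 = n := by
  have ho : D.outer ∈ ({D.outer} : Finset (Fin f)) := Finset.mem_singleton_self _
  have hsub := t.subset
  have houter : D.outer ∈ W' := hsub (Finset.mem_insert_of_mem ho)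
  have closed : ∀ g, D.face g ∈ W' → D.face g ≠ D.outer → D.face (D.twin g) ∈ W' := fun g h1 h2 =>
    t.closed hD hG ho (by rw [hD.twin_twin, hh]; exact ho) h1 (by simpa using h2)
  have hall := eq_univ_of_closed hD hG houter hh (hsub (Finset.mem_insert_self _ _)) closed
  -- Each visited inner face contributes one corner, and there are `n - 2` inner faces.
  have hlen : T.nodes.length + 2 = n := by
    have h1 := t.card
    have h2 := card_faces hD hG
    rw [Finset.eq_univ_of_forall hall, Finset.card_univ, Fintype.card_fin, Finset.card_singleton]
      at h1
    omega
  have el : leftEnd D false (D.twin h) = D.origin h := by simp [leftEnd, hD.twin_twin]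
  have er : rightVertex D false (D.twin h) = D.origin (D.twin h) := rfl
  have hmem : ∀ x, x ∈ D.origin h :: D.origin (D.twin h) :: T.nodes := by
    have inner : ∀ g, D.face g ≠ D.outer →
        D.origin g ∈ D.origin h :: D.origin (D.twin h) :: T.nodes := fun g hg => by
      have := t.origin_mem hD hG ho (hall (D.face g)) (by simpa using hg)
      rw [el, er] at this
      simpa using this
    intro x
    obtain ⟨g, hg, rfl⟩ := hD.outer_vertex x
    by_cases hn : n ≤ 2
    · have h1 := (adj_ends hD h).ne
      simp only [List.mem_cons]
      rw [Ne, Fin.ext_iff] at h1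
      rw [Fin.ext_iff, Fin.ext_iff]
      omega
    · have h1 := twin_not_outer hD hG (by omega) hg
      have h2 := inner (D.succ (D.twin g)) (by rwa [face_succ hD])
      rwa [hD.origin_succ, hD.twin_twin] at h2
  -- A list of length `n` that contains all `n` vertices has no repetitions; no study of the dual
  -- tree is needed.
  have hnd : (D.origin h :: D.origin (D.twin h) :: T.nodes).Nodup := by
    have huniv : (D.origin h :: D.origin (D.twin h) :: T.nodes).toFinset = Finset.univ :=
      Finset.eq_univ_of_forall fun x => List.mem_toFinset.2 (hmem x)
    have hcard := congrArg Finset.card huniv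
    rw [Finset.card_univ, Fintype.card_fin] at hcard
    rw [← Multiset.coe_nodup, ← Multiset.toFinset_card_eq_card_iff_nodup]
    refine hcard.trans ?_
    simp only [Multiset.coe_card, List.length_cons]
    omega
  refine ⟨hnd, hmem, fun x y hxy => ?_, hlen⟩
  have hE := t.edges_subset hD hG ho
  rw [el, er] at hE
  -- One inclusion is known, and both sides have `2 * n - 3` elements.
  have heq : (T.edges (D.origin h) (D.origin (D.twin h)) : Set (Sym2 (Fin n))) = G.edgeSet := by
    refine Set.eq_of_subset_of_ncard_le hE ?_ (Set.toFinite _)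
    have h1 := IsMaximalOuterplanar.ncard_edgeSet_add_three hG
      (by rw [Fintype.card_fin]; exact two_le_card hD)
    rw [Fintype.card_fin] at h1
    rw [Set.ncard_coe_finset, T.card_edges hnd]
    omega
  rw [← Finset.mem_coe, heq]
  exact hxy

end Traverse

/-! ## Programs without loops -/

section Programs

open RealRAM

/-- A bound for the number of operations of a program without loops. -/
def maxCost : Program → ℕ
  | .skip => 1
  | .setNat _ i e => i.cost + e.cost + 1
  | .setReal _ i e => i.cost + e.cost + 1
  | .seq P Q => maxCost P + maxCost Q
  | .cond b P Q => b.cost + max (maxCost P) (maxCost Q)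
  | .loop _ _ => 0

/-- Started in memory `s`, the program `P` halts within its cost bound in a memory with `Q`. -/
def Halts (P : Program) (s : Memory) (Q : Memory → Prop) : Prop :=
  ∃ t s', Exec P s t s' ∧ t ≤ maxCost P ∧ Q s'

variable {P P' : Program} {s : Memory} {Q R : Memory → Prop}

theorem Halts.skip (h : Q s) : Halts .skip s Q := ⟨_, _, .skip s, le_rfl, h⟩

theorem Halts.setNat {a : ℕ} {i e : NatExpr} (h : Q (s.setNat a (i.eval s) (e.eval s))) :
    Halts (.setNat a i e) s Q := ⟨_, _, .setNat s a i e, le_rfl, h⟩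

theorem Halts.setReal {a : ℕ} {i : NatExpr} {e : RealExpr}
    (h : Q (s.setReal a (i.eval s) (e.eval s))) : Halts (.setReal a i e) s Q :=
  ⟨_, _, .setReal s a i e, le_rfl, h⟩

theorem Halts.seq (h : Halts P s fun s' => Halts P' s' Q) : Halts (.seq P P') s Q := by
  obtain ⟨t, s', h1, h2, t', s'', h3, h4, h5⟩ := h
  exact ⟨_, _, .seq h1 h3, Nat.add_le_add h2 h4, h5⟩

theorem Halts.cond {b : Test} (h : b.holds s → Halts P s Q) (h' : ¬ b.holds s → Halts P' s Q) :
    Halts (.cond b P P') s Q := by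
  by_cases hb : b.holds s
  · obtain ⟨t, s', h1, h2, h3⟩ := h hb
    exact ⟨_, _, .cond_true hb h1, Nat.add_le_add_left (h2.trans (le_max_left _ _)) _, h3⟩
  · obtain ⟨t, s', h1, h2, h3⟩ := h' hb
    exact ⟨_, _, .cond_false hb h1, Nat.add_le_add_left (h2.trans (le_max_right _ _)) _, h3⟩

theorem Halts.mono (h : Halts P s Q) (hQ : ∀ s', Q s' → R s') : Halts P s R := by
  obtain ⟨t, s', h1, h2, h3⟩ := h
  exact ⟨t, s', h1, h2, hQ s' h3⟩

theorem setNat_nat (s : Memory) (a i x b j : ℕ) :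
    (s.setNat a i x).nat b j = if b = a ∧ j = i then x else s.nat b j := by
  unfold Memory.setNat
  by_cases hb : b = a
  · subst hb
    by_cases hj : j = i
    · simp [hj]
    · simp [hj]
  · simp [hb]

theorem setNat_nat_of_ne (s : Memory) {a b : ℕ} (i x : ℕ) (h : b ≠ a) :
    (s.setNat a i x).nat b = s.nat b := Function.update_of_ne h _ _

theorem setNat_real (s : Memory) (a i x : ℕ) : (s.setNat a i x).real = s.real := rfl

theorem setReal_real (s : Memory) (a i : ℕ) (x : ℝ) (b j : ℕ) :
    (s.setReal a i x).real b j = if b = a ∧ j = i then x else s.real b j := by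
  unfold Memory.setReal
  by_cases hb : b = a
  · subst hb
    by_cases hj : j = i
    · simp [hj]
    · simp [hj]
  · simp [hb]

theorem setReal_real_of_ne (s : Memory) {a b : ℕ} (i : ℕ) (x : ℝ) (h : b ≠ a) :
    (s.setReal a i x).real b = s.real b := Function.update_of_ne h _ _

theorem setReal_nat (s : Memory) (a i : ℕ) (x : ℝ) : (s.setReal a i x).nat = s.nat := rfl

end Programs

/-! ## The drawing program -/

section DrawingProgram

open RealRAM

variable {n m f : ℕ}

/-- A pending call of the search: the half-edge through which it enters, the kind of the edge, and
the data of its layout. -/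
structure Call (m : ℕ) where
  halfEdge : Fin m
  long : Bool
  forward : Bool
  pos : Plane
  φ : ℝ
  a : ℝ
  d : ℝ

/-- The call `c` stands at height `k` on the stack. -/
structure Holds (s : Memory) (k : ℕ) (c : Call m) : Prop where
  halfEdge : s.nat 9 k = c.halfEdge
  long : s.nat 10 k = c.long.toNat
  forward : s.nat 11 k = c.forward.toNat
  pos_zero : s.real 2 k = c.pos 0
  pos_one : s.real 3 k = c.pos 1
  φ : s.real 4 k = c.φ
  a : s.real 5 k = c.a
  d : s.real 6 k = c.d

/-- The memory contains the given stack. -/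
def Stored (s : Memory) : List (Call m) → Prop
  | [] => True
  | c :: l => Holds s l.length c ∧ Stored s l

theorem Holds.congr {s s' : Memory} {k : ℕ} {c : Call m} (h : Holds s k c)
    (h1 : ∀ a ∈ [9, 10, 11], s'.nat a k = s.nat a k)
    (h2 : ∀ a ∈ [2, 3, 4, 5, 6], s'.real a k = s.real a k) : Holds s' k c := by
  simp only [List.forall_mem_cons, List.not_mem_nil, false_imp_iff, implies_true, and_true]
    at h1 h2
  obtain ⟨e1, e2, e3⟩ := h1
  obtain ⟨e4, e5, e6, e7, e8⟩ := h2
  exact ⟨e1.trans h.halfEdge, e2.trans h.long, e3.trans h.forward, e4.trans h.pos_zero,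
    e5.trans h.pos_one, e6.trans h.φ, e7.trans h.a, e8.trans h.d⟩

theorem Stored.congr {s s' : Memory} {l : List (Call m)} (h : Stored s l)
    (h1 : ∀ k < l.length, ∀ a ∈ [9, 10, 11], s'.nat a k = s.nat a k)
    (h2 : ∀ k < l.length, ∀ a ∈ [2, 3, 4, 5, 6], s'.real a k = s.real a k) : Stored s' l := by
  induction l with
  | nil => trivial
  | cons c l ih =>
    have hlt : l.length < (c :: l).length := by simp
    exact ⟨h.1.congr (h1 _ hlt) (h2 _ hlt),
      ih h.2 (fun k hk => h1 k (hk.trans hlt)) fun k hk => h2 k (hk.trans hlt)⟩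

/-- The memory represents a state of the search: the visited faces, the stack, and the positions
found so far. -/
structure Represents (D : EdgeList n m f) (s : Memory) (W : Finset (Fin f)) (l : List (Call m))
    (p : Fin n → Plane) : Prop where
  input : ∀ a < 8, s.nat a = D.toMemory.nat a
  visited : ∀ i : Fin f, s.nat 8 i = if i ∈ W then 1 else 0
  height : s.nat 12 0 = l.length
  stored : Stored s l
  positions : ∀ v : Fin n, s.real 0 v = p v 0 ∧ s.real 1 v = p v 1

variable {D : EdgeList n m f} {s s' : Memory} {W : Finset (Fin f)} {l : List (Call m)}
  {p : Fin n → Plane} {c : Call m}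

theorem Represents.congr (h : Represents D s W l p) (h1 : ∀ a < 12, s'.nat a = s.nat a)
    (h2 : s'.nat 12 0 = s.nat 12 0) (h3 : ∀ a < 7, s'.real a = s.real a) :
    Represents D s' W l p where
  input a ha := (h1 a (by omega)).trans (h.input a ha)
  visited i := by rw [h1 8 (by omega), h.visited]
  height := h2.trans h.height
  stored := h.stored.congr
    (fun k _ a ha => by rw [h1 a (by simp at ha; omega)])
    (fun k _ a ha => by rw [h3 a (by simp at ha; omega)])
  positions v := by
    rw [h3 0 (by omega), h3 1 (by omega)]
    exact h.positions v

theorem toArray_val {k l : ℕ} (g : Fin k → Fin l) (i : Fin k) :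
    EdgeList.toArray g i = (g i : ℕ) := by
  rw [EdgeList.toArray, dif_pos i.isLt]

theorem Represents.origin (h : Represents D s W l p) (e : Fin m) : s.nat 1 e = D.origin e := by
  rw [h.input 1 (by omega)]
  exact toArray_val D.origin e

theorem Represents.twin (h : Represents D s W l p) (e : Fin m) : s.nat 2 e = D.twin e := by
  rw [h.input 2 (by omega)]
  exact toArray_val D.twin e

theorem Represents.succ (h : Represents D s W l p) (e : Fin m) : s.nat 3 e = D.succ e := by
  rw [h.input 3 (by omega)]
  exact toArray_val D.succ e

theorem Represents.face (h : Represents D s W l p) (e : Fin m) : s.nat 5 e = D.face e := by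
  rw [h.input 5 (by omega)]
  exact toArray_val D.face e

/-- The height of the stack. -/
def height : NatExpr := .get 12 (.const 0)

/-- A register for natural numbers. -/
def natReg (i : ℕ) : NatExpr := .get 12 (.const i)

/-- A register for real numbers. -/
def realReg (i : ℕ) : RealExpr := .get 7 (.const i)

/-- Push a call. -/
def push (e b o : NatExpr) (x y φ a d : RealExpr) : Program :=
  .seq (.setNat 9 height e) <| .seq (.setNat 10 height b) <| .seq (.setNat 11 height o) <|
  .seq (.setReal 2 height x) <| .seq (.setReal 3 height y) <| .seq (.setReal 4 height φ) <|
  .seq (.setReal 5 height a) <| .seq (.setReal 6 height d) <|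
  .setNat 12 (.const 0) (.add height (.const 1))

/-- The predicate `L` carries what the argument expressions rely on. It survives the writes to the
stack, so each expression may be evaluated after earlier ones have been stored. -/
theorem halts_push {e b o : NatExpr} {x y φ a d : RealExpr} {L : Memory → Prop}
    (hL : ∀ s s', L s → (∀ j ≠ 0, s'.nat 12 j = s.nat 12 j) → (s'.real 7 = s.real 7) →
      (∀ a < 8, s'.nat a = s.nat a) → L s')
    (he : ∀ s, L s → e.eval s = c.halfEdge) (hb : ∀ s, L s → b.eval s = c.long.toNat)
    (ho : ∀ s, L s → o.eval s = c.forward.toNat) (hx : ∀ s, L s → x.eval s = c.pos 0)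
    (hy : ∀ s, L s → y.eval s = c.pos 1) (hφ : ∀ s, L s → φ.eval s = c.φ)
    (ha : ∀ s, L s → a.eval s = c.a) (hd : ∀ s, L s → d.eval s = c.d) (hs : L s)
    (h : Represents D s W l p) :
    Halts (push e b o x y φ a d) s fun s' => L s' ∧ Represents D s' W (c :: l) p := by
  have natStep : ∀ {s : Memory} {a i v : ℕ}, L s → 8 < a → a < 12 → s.nat 12 0 = l.length →
      L (s.setNat a i v) ∧ (s.setNat a i v).nat 12 0 = l.length := by
    intro s a i v h1 h2 h3 h4
    refine ⟨hL s _ h1 (fun j _ => ?_) rfl fun b hb => setNat_nat_of_ne _ _ _ (by omega), ?_⟩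
    · rw [setNat_nat_of_ne _ _ _ (by omega)]
    · rw [setNat_nat_of_ne _ _ _ (by omega), h4]
  have realStep : ∀ {s : Memory} {a i : ℕ} {v : ℝ}, L s → a < 7 → s.nat 12 0 = l.length →
      L (s.setReal a i v) ∧ (s.setReal a i v).nat 12 0 = l.length := by
    intro s a i v h1 h2 h4
    exact ⟨hL s _ h1 (fun j _ => rfl) (setReal_real_of_ne _ _ _ (by omega)) fun b hb => rfl, h4⟩
  have hh : ∀ {s : Memory}, s.nat 12 0 = l.length → height.eval s = l.length := fun h => h
  refine .seq (.setNat ?_)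
  rw [hh h.height, he s hs]
  obtain ⟨L1, k1⟩ := natStep (a := 9) (i := l.length) (v := c.halfEdge) hs (by omega) (by omega)
    h.height
  refine .seq (.setNat ?_)
  rw [hh k1, hb _ L1]
  obtain ⟨L2, k2⟩ := natStep (a := 10) (i := l.length) (v := c.long.toNat) L1 (by omega)
    (by omega) k1
  refine .seq (.setNat ?_)
  rw [hh k2, ho _ L2]
  obtain ⟨L3, k3⟩ := natStep (a := 11) (i := l.length) (v := c.forward.toNat) L2 (by omega)
    (by omega) k2
  refine .seq (.setReal ?_)
  rw [hh k3, hx _ L3]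
  obtain ⟨L4, k4⟩ := realStep (a := 2) (i := l.length) (v := c.pos 0) L3 (by omega) k3
  refine .seq (.setReal ?_)
  rw [hh k4, hy _ L4]
  obtain ⟨L5, k5⟩ := realStep (a := 3) (i := l.length) (v := c.pos 1) L4 (by omega) k4
  refine .seq (.setReal ?_)
  rw [hh k5, hφ _ L5]
  obtain ⟨L6, k6⟩ := realStep (a := 4) (i := l.length) (v := c.φ) L5 (by omega) k5
  refine .seq (.setReal ?_)
  rw [hh k6, ha _ L6]
  obtain ⟨L7, k7⟩ := realStep (a := 5) (i := l.length) (v := c.a) L6 (by omega) k6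
  refine .seq (.setReal ?_)
  rw [hh k7, hd _ L7]
  obtain ⟨L8, k8⟩ := realStep (a := 6) (i := l.length) (v := c.d) L7 (by omega) k7
  refine .setNat ?_
  have e0 : (NatExpr.const 0).eval ((((((((s.setNat 9 l.length c.halfEdge).setNat 10 l.length
      c.long.toNat).setNat 11 l.length c.forward.toNat).setReal 2 l.length (c.pos 0)).setReal 3
      l.length (c.pos 1)).setReal 4 l.length c.φ).setReal 5 l.length c.a).setReal 6 l.length c.d) =
      0 := rfl
  rw [e0]
  have e1 : ∀ {s : Memory}, s.nat 12 0 = l.length →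
      (NatExpr.add height (.const 1)).eval s = l.length + 1 := fun h => congrArg (· + 1) h
  rw [e1 k8]
  refine ⟨hL _ _ L8 (fun j hj => ?_) rfl fun b hb => setNat_nat_of_ne _ _ _ (by omega),
    ⟨fun a ha => ?_, fun i => ?_, ?_, ⟨⟨?_, ?_, ?_, ?_, ?_, ?_, ?_, ?_⟩, ?_⟩, fun v => ?_⟩⟩
  · simp [setNat_nat, hj]
  · rw [setNat_nat_of_ne _ _ _ (by omega)]
    simp only [setReal_nat]
    rw [setNat_nat_of_ne _ _ _ (by omega), setNat_nat_of_ne _ _ _ (by omega),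
      setNat_nat_of_ne _ _ _ (by omega), h.input a ha]
  · rw [← h.visited]
    simp [setNat_nat, setReal_nat]
  · simp [setNat_nat]
  · simp [setNat_nat, setReal_nat]
  · simp [setNat_nat, setReal_nat]
  · simp [setNat_nat, setReal_nat]
  · simp [setNat_real, setReal_real]
  · simp [setNat_real, setReal_real]
  · simp [setNat_real, setReal_real]
  · simp [setNat_real, setReal_real]
  · simp [setNat_real, setReal_real]
  · refine h.stored.congr (fun k hk a ha => ?_) fun k hk a ha => ?_
    · simp only [List.mem_cons, List.not_mem_nil, or_false] at ha
      rcases ha with rfl | rfl | rfl <;> simp [setNat_nat, setReal_nat, hk.ne]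
    · simp only [List.mem_cons, List.not_mem_nil, or_false] at ha
      rcases ha with rfl | rfl | rfl | rfl | rfl <;> simp [setNat_real, setReal_real, hk.ne]
  · rw [← (h.positions v).1, ← (h.positions v).2]
    simp [setNat_real, setReal_real]

/-- Pop a call and copy its half-edge into register 1. -/
def pop : Program :=
  .seq (.setNat 12 (.const 0) (.sub height (.const 1))) (.setNat 12 (.const 1) (.get 9 height))

theorem halts_pop (h : Represents D s W (c :: l) p) : Halts pop s fun s' =>
    s'.nat 12 1 = c.halfEdge ∧ Holds s' l.length c ∧ Represents D s' W l p := by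
  refine .seq (.setNat (.setNat ?_))
  have hk := h.height
  have e1 : (NatExpr.sub height (.const 1)).eval s = l.length := by
    simp [NatExpr.eval, height, hk]
  have e0 : (NatExpr.const 0).eval s = 0 := rfl
  rw [e0, e1]
  have e2 : (NatExpr.get 9 height).eval (s.setNat 12 0 l.length) = c.halfEdge := by
    simp [NatExpr.eval, height, setNat_nat, h.stored.1.halfEdge]
  have e3 : (NatExpr.const 1).eval (s.setNat 12 0 l.length) = 1 := rfl
  rw [e2, e3]
  have hne : ∀ a < 12, ((s.setNat 12 0 l.length).setNat 12 1 c.halfEdge).nat a = s.nat a := by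
    intro a ha
    rw [setNat_nat_of_ne _ _ _ (by omega), setNat_nat_of_ne _ _ _ (by omega)]
  refine ⟨by simp [setNat_nat], h.stored.1.congr (fun a ha => ?_) fun a _ => rfl,
    ⟨fun a ha => (hne a (by omega)).trans (h.input a ha), fun i => ?_, ?_,
      h.stored.2.congr (fun k _ a ha => ?_) fun k _ a _ => rfl, h.positions⟩⟩
  · rw [hne a (by simp at ha; omega)]
  · rw [hne 8 (by omega), h.visited]
  · simp [setNat_nat]
  · rw [hne a (by simp at ha; omega)]

/-- The registers contain the data of the call `c`. -/
structure Loaded (D : EdgeList n m f) (s : Memory) (c : Call m) : Prop where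
  corner : s.nat 12 2 = corner D c.halfEdge
  long : s.nat 12 5 = c.long.toNat
  forward : s.nat 12 6 = c.forward.toNat
  left : s.nat 12 7 = leftSide D c.forward c.halfEdge
  right : s.nat 12 8 = rightSide D c.forward c.halfEdge
  pos_zero : s.real 7 0 = c.pos 0
  pos_one : s.real 7 1 = c.pos 1
  φ : s.real 7 2 = c.φ
  a : s.real 7 3 = c.a
  d : s.real 7 4 = c.d
  ψ : s.real 7 5 = c.a + 4 * c.d
  dir_zero : s.real 7 6 = dir c.φ 0
  dir_one : s.real 7 7 = dir c.φ 1
  dir_zero' : s.real 7 8 = dir (c.a + 4 * c.d) 0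
  dir_one' : s.real 7 9 = dir (c.a + 4 * c.d) 1

/-- Cell 0 is exempt because it holds the height of the stack, which pushing changes. -/
theorem Loaded.congr (h : Loaded D s c) (h1 : ∀ j ≠ 0, s'.nat 12 j = s.nat 12 j)
    (h2 : s'.real 7 = s.real 7) : Loaded D s' c := by
  constructor <;> first
    | rw [h2]
    | rw [h1 _ (by decide)]
  exacts [h.corner, h.long, h.forward, h.left, h.right, h.pos_zero, h.pos_one, h.φ, h.a, h.d, h.ψ,
    h.dir_zero, h.dir_one, h.dir_zero', h.dir_one']

end DrawingProgram

/-! ### Loading a call and placing a corner. -/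

section Loading

open RealRAM

variable {n m f : ℕ} {D : EdgeList n m f} {s s' : Memory} {W : Finset (Fin f)} {l : List (Call m)}
  {p : Fin n → Plane} {c : Call m}

theorem height_eval (h : Represents D s W l p) : height.eval s = l.length := h.height

/-- Mark the face of the half-edge in register 1 as visited. -/
def mark : Program := .setNat 8 (.get 5 (natReg 1)) (.const 1)

theorem halts_mark (h1 : s.nat 12 1 = c.halfEdge) (h2 : Holds s l.length c)
    (h : Represents D s W l p) : Halts mark s fun s' => s'.nat 12 1 = c.halfEdge ∧
      Holds s' l.length c ∧ Represents D s' (insert (D.face c.halfEdge) W) l p := by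
  refine .setNat ?_
  have e : (NatExpr.get 5 (natReg 1)).eval s = D.face c.halfEdge := by
    simp [NatExpr.eval, natReg, h1, h.face]
  have e1 : (NatExpr.const 1).eval s = 1 := rfl
  rw [e, e1]
  have hne : ∀ a ≠ 8, (s.setNat 8 (D.face c.halfEdge) 1).nat a = s.nat a := fun a ha =>
    setNat_nat_of_ne _ _ _ ha
  have hst : ∀ k, ∀ a ∈ [9, 10, 11], (s.setNat 8 (D.face c.halfEdge) 1).nat a k = s.nat a k := by
    intro k a ha
    rw [hne a (by simp at ha; omega)]
  refine ⟨by rw [hne _ (by decide), h1], h2.congr (hst _) fun a _ => rfl,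
    ⟨fun a ha => (hne a (by omega)).trans (h.input a ha), fun i => ?_, ?_,
      h.stored.congr (fun k _ => hst k) fun k _ a _ => rfl, h.positions⟩⟩
  · rw [setNat_nat, h.visited]
    by_cases hi : i = D.face c.halfEdge <;> simp [hi, ← Fin.ext_iff]
  · rw [hne _ (by decide), h.height]

/-- Load the integer data of the call above the stack. -/
def loadNat : Program :=
  .seq (.setNat 12 (.const 2) (.get 1 (.get 3 (.get 3 (natReg 1))))) <|
  .seq (.setNat 12 (.const 5) (.get 10 height)) <|
  .seq (.setNat 12 (.const 6) (.get 11 height)) <|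
  .cond (.natEq (natReg 6) (.const 0))
    (.seq (.setNat 12 (.const 7) (.get 2 (.get 3 (natReg 1))))
      (.setNat 12 (.const 8) (.get 2 (.get 3 (.get 3 (natReg 1))))))
    (.seq (.setNat 12 (.const 7) (.get 2 (.get 3 (.get 3 (natReg 1)))))
      (.setNat 12 (.const 8) (.get 2 (.get 3 (natReg 1)))))

/-- The registers contain the integer data of the call `c`. -/
structure NatLoaded (D : EdgeList n m f) (s : Memory) (c : Call m) : Prop where
  corner : s.nat 12 2 = corner D c.halfEdge
  long : s.nat 12 5 = c.long.toNat
  forward : s.nat 12 6 = c.forward.toNat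
  left : s.nat 12 7 = leftSide D c.forward c.halfEdge
  right : s.nat 12 8 = rightSide D c.forward c.halfEdge

theorem halts_loadNat (h1 : s.nat 12 1 = c.halfEdge) (h2 : Holds s l.length c)
    (h : Represents D s W l p) : Halts loadNat s fun s' => NatLoaded D s' c ∧
      Holds s' l.length c ∧ Represents D s' W l p := by
  have reg : ∀ {s' : Memory}, (∀ a < 12, s'.nat a = s.nat a) → s'.nat 12 0 = s.nat 12 0 →
      s'.real = s.real → NatLoaded D s' c →
      NatLoaded D s' c ∧ Holds s' l.length c ∧ Represents D s' W l p := by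
    intro s' e1 e2 e3 hl
    refine ⟨hl, h2.congr (fun a ha => ?_) fun a _ => by rw [e3], h.congr e1 e2 fun a _ => by rw [e3]⟩
    rw [e1 a (by simp at ha; omega)]
  refine .seq (.setNat (.seq (.setNat (.seq (.setNat ?_)))))
  have v2 : (NatExpr.get 1 (.get 3 (.get 3 (natReg 1)))).eval s = corner D c.halfEdge := by
    simp [NatExpr.eval, natReg, h1, h.succ, h.origin, corner]
  simp only [v2, show ∀ i s, (NatExpr.const i).eval s = i from fun _ _ => rfl]
  have v5 : (NatExpr.get 10 height).eval (s.setNat 12 2 (corner D c.halfEdge)) = c.long.toNat := by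
    simp [NatExpr.eval, height, setNat_nat, h.height, h2.long]
  rw [v5]
  have v6 : (NatExpr.get 11 height).eval ((s.setNat 12 2 (corner D c.halfEdge)).setNat 12 5
      c.long.toNat) = c.forward.toNat := by
    simp [NatExpr.eval, height, setNat_nat, h.height, h2.forward]
  rw [v6]
  set s₁ := ((s.setNat 12 2 (corner D c.halfEdge)).setNat 12 5 c.long.toNat).setNat 12 6
      c.forward.toNat with hs₁
  have a1 : ∀ a < 12, s₁.nat a = s.nat a := by
    intro a ha
    rw [hs₁, setNat_nat_of_ne _ _ _ (by omega), setNat_nat_of_ne _ _ _ (by omega),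
      setNat_nat_of_ne _ _ _ (by omega)]
  have a2 : s₁.nat 12 0 = s.nat 12 0 := by simp [hs₁, setNat_nat]
  have a3 : s₁.real = s.real := rfl
  have r1 : s₁.nat 12 1 = c.halfEdge := by simp [hs₁, setNat_nat, h1]
  have r2 : s₁.nat 12 2 = corner D c.halfEdge := by simp [hs₁, setNat_nat]
  have r5 : s₁.nat 12 5 = c.long.toNat := by simp [hs₁, setNat_nat]
  have r6 : s₁.nat 12 6 = c.forward.toNat := by simp [hs₁, setNat_nat]
  have hR : Represents D s₁ W l p := h.congr a1 a2 fun a _ => by rw [a3]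
  clear_value s₁
  have t1 : (NatExpr.get 2 (.get 3 (natReg 1))).eval s₁ = D.twin (D.succ c.halfEdge) := by
    simp [NatExpr.eval, natReg, r1, hR.succ, hR.twin]
  have t2 : (NatExpr.get 2 (.get 3 (.get 3 (natReg 1)))).eval s₁ =
      D.twin (D.succ (D.succ c.halfEdge)) := by
    simp [NatExpr.eval, natReg, r1, hR.succ, hR.twin]
  have t1' : ∀ x, (NatExpr.get 2 (.get 3 (natReg 1))).eval (s₁.setNat 12 7 x) =
      D.twin (D.succ c.halfEdge) := fun x => by
    rw [← t1]
    simp [NatExpr.eval, natReg, setNat_nat]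
  have t2' : ∀ x, (NatExpr.get 2 (.get 3 (.get 3 (natReg 1)))).eval (s₁.setNat 12 7 x) =
      D.twin (D.succ (D.succ c.halfEdge)) := fun x => by
    rw [← t2]
    simp [NatExpr.eval, natReg, setNat_nat]
  have fin : ∀ x y : ℕ, x = leftSide D c.forward c.halfEdge →
      y = rightSide D c.forward c.halfEdge →
      NatLoaded D ((s₁.setNat 12 7 x).setNat 12 8 y) c ∧
        Holds ((s₁.setNat 12 7 x).setNat 12 8 y) l.length c ∧
        Represents D ((s₁.setNat 12 7 x).setNat 12 8 y) W l p := by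
    intro x y hx hy
    refine reg (fun a ha => ?_) ?_ a3 ⟨?_, ?_, ?_, ?_, ?_⟩
    · rw [setNat_nat_of_ne _ _ _ (by omega), setNat_nat_of_ne _ _ _ (by omega), a1 a ha]
    · simp [setNat_nat, a2]
    · simp [setNat_nat, r2]
    · simp [setNat_nat, r5]
    · simp [setNat_nat, r6]
    · simp [setNat_nat, hx]
    · simp [setNat_nat, hy]
  refine .cond (fun hb => .seq (.setNat (.setNat ?_))) fun hb => .seq (.setNat (.setNat ?_))
  · replace hb : c.forward = false := by
      have : s₁.nat 12 6 = 0 := hb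
      rw [r6] at this
      simpa using this
    simp only [t1, t2', show ∀ i s, (NatExpr.const i).eval s = i from fun _ _ => rfl]
    exact fin _ _ (by simp [leftSide, hb]) (by simp [rightSide, hb])
  · replace hb : c.forward = true := by
      have : ¬ s₁.nat 12 6 = 0 := hb
      rw [r6] at this
      simpa using this
    simp only [t2, t1', show ∀ i s, (NatExpr.const i).eval s = i from fun _ _ => rfl]
    exact fin _ _ (by simp [leftSide, hb]) (by simp [rightSide, hb])

/-- The reciprocal of `√(1 + e ^ 2)`. -/
def rsqrt (e : RealExpr) : RealExpr := .div (.const 1) (.sqrt (.add (.const 1) (.mul e e)))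

theorem rsqrt_eval (e : RealExpr) (s : Memory) : (rsqrt e).eval s = dir (e.eval s) 0 := by
  simp only [rsqrt, RealExpr.eval, dir_zero]
  rw [Rat.cast_one, one_div, ← sq]

/-- Load the real data of the call above the stack, and compute the two directions. -/
def loadReal : Program :=
  .seq (.setReal 7 (.const 0) (.get 2 height)) <| .seq (.setReal 7 (.const 1) (.get 3 height)) <|
  .seq (.setReal 7 (.const 2) (.get 4 height)) <| .seq (.setReal 7 (.const 3) (.get 5 height)) <|
  .seq (.setReal 7 (.const 4) (.get 6 height)) <|
  .seq (.setReal 7 (.const 5) (.add (realReg 3) (.mul (.const 4) (realReg 4)))) <|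
  .seq (.setReal 7 (.const 6) (rsqrt (realReg 2))) <|
  .seq (.setReal 7 (.const 7) (.mul (realReg 2) (realReg 6))) <|
  .seq (.setReal 7 (.const 8) (rsqrt (realReg 5))) <|
  .setReal 7 (.const 9) (.mul (realReg 5) (realReg 8))

theorem halts_loadReal (h1 : NatLoaded D s c) (h2 : Holds s l.length c)
    (h : Represents D s W l p) : Halts loadReal s fun s' => Loaded D s' c ∧
      Represents D s' W l p := by
  refine .seq (.setReal (.seq (.setReal (.seq (.setReal (.seq (.setReal (.seq (.setReal ?_)))))))))
  simp only [show ∀ i s, (NatExpr.const i).eval s = i from fun _ _ => rfl]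
  have g : ∀ (s : Memory) (a i : ℕ) (v : ℝ), a ≠ 7 →
      (RealExpr.get a height).eval (s.setReal 7 i v) = (RealExpr.get a height).eval s := by
    intro s a i v ha
    change (s.setReal 7 i v).real a (height.eval s) = s.real a (height.eval s)
    rw [setReal_real_of_ne _ _ _ ha]
  have g' : ∀ a, (RealExpr.get a height).eval s = s.real a l.length := fun a =>
    congrArg (s.real a) (height_eval h)
  simp only [g _ 3 _ _ (by decide), g _ 4 _ _ (by decide), g _ 5 _ _ (by decide),
    g _ 6 _ _ (by decide), g', h2.pos_zero, h2.pos_one, h2.φ, h2.a, h2.d]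
  set s₁ := ((((s.setReal 7 0 (c.pos 0)).setReal 7 1 (c.pos 1)).setReal 7 2 c.φ).setReal 7 3
    c.a).setReal 7 4 c.d with hs₁
  have n1 : s₁.nat = s.nat := rfl
  have o1 : ∀ a < 7, s₁.real a = s.real a := by
    intro a ha
    simp only [hs₁, setReal_real_of_ne _ _ _ (show a ≠ 7 by omega)]
  have r0 : s₁.real 7 0 = c.pos 0 := by simp [hs₁, setReal_real]
  have r1 : s₁.real 7 1 = c.pos 1 := by simp [hs₁, setReal_real]
  have r2 : s₁.real 7 2 = c.φ := by simp [hs₁, setReal_real]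
  have r3 : s₁.real 7 3 = c.a := by simp [hs₁, setReal_real]
  have r4 : s₁.real 7 4 = c.d := by simp [hs₁, setReal_real]
  clear_value s₁
  refine .seq (.setReal (.seq (.setReal (.seq (.setReal (.seq (.setReal (.setReal ?_))))))))
  simp only [show ∀ i s, (NatExpr.const i).eval s = i from fun _ _ => rfl]
  have v5 : (RealExpr.add (realReg 3) (.mul (.const 4) (realReg 4))).eval s₁ = c.a + 4 * c.d := by
    simp [RealExpr.eval, realReg, NatExpr.eval, r3, r4]
  rw [v5, rsqrt_eval]
  have v6 : (realReg 2).eval (s₁.setReal 7 5 (c.a + 4 * c.d)) = c.φ := by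
    simp [RealExpr.eval, realReg, NatExpr.eval, setReal_real, r2]
  rw [v6]
  have v7 : (RealExpr.mul (realReg 2) (realReg 6)).eval ((s₁.setReal 7 5 (c.a + 4 * c.d)).setReal 7 6
      (dir c.φ 0)) = dir c.φ 1 := by
    simp [RealExpr.eval, realReg, NatExpr.eval, setReal_real, r2, dir_one]
  rw [v7, rsqrt_eval]
  have v8 : (realReg 5).eval (((s₁.setReal 7 5 (c.a + 4 * c.d)).setReal 7 6 (dir c.φ 0)).setReal 7 7
      (dir c.φ 1)) = c.a + 4 * c.d := by
    simp [RealExpr.eval, realReg, NatExpr.eval, setReal_real]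
  rw [v8]
  have v9 : (RealExpr.mul (realReg 5) (realReg 8)).eval ((((s₁.setReal 7 5 (c.a + 4 * c.d)).setReal 7
      6 (dir c.φ 0)).setReal 7 7 (dir c.φ 1)).setReal 7 8 (dir (c.a + 4 * c.d) 0)) =
      dir (c.a + 4 * c.d) 1 := by
    simp [RealExpr.eval, realReg, NatExpr.eval, setReal_real, dir_one]
  rw [v9]
  refine ⟨⟨?_, ?_, ?_, ?_, ?_, ?_, ?_, ?_, ?_, ?_, ?_, ?_, ?_, ?_, ?_⟩,
    h.congr (fun a _ => by simp only [setReal_nat, n1]) (by simp only [setReal_nat, n1])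
      fun a ha => ?_⟩
  · exact (congrFun₂ n1 _ _).trans h1.corner
  · exact (congrFun₂ n1 _ _).trans h1.long
  · exact (congrFun₂ n1 _ _).trans h1.forward
  · exact (congrFun₂ n1 _ _).trans h1.left
  · exact (congrFun₂ n1 _ _).trans h1.right
  · simp [setReal_real, r0]
  · simp [setReal_real, r1]
  · simp [setReal_real, r2]
  · simp [setReal_real, r3]
  · simp [setReal_real, r4]
  · simp [setReal_real]
  · simp [setReal_real]
  · simp [setReal_real]
  · simp [setReal_real]
  · simp [setReal_real]
  · simp only [setReal_real_of_ne _ _ _ (show a ≠ 7 by omega), o1 a ha]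

/-- Place the corner of the triangle. -/
def place (x y : RealExpr) : Program :=
  .seq (.setReal 0 (natReg 2) x) (.setReal 1 (natReg 2) y)

theorem halts_place {x y : RealExpr} {z : Plane} (hx : ∀ s, Loaded D s c → x.eval s = z 0)
    (hy : ∀ s, Loaded D s c → y.eval s = z 1) (hl : Loaded D s c) (h : Represents D s W l p) :
    Halts (place x y) s fun s' => Loaded D s' c ∧
      Represents D s' W l (Function.update p (corner D c.halfEdge) z) := by
  have e2 : ∀ {s : Memory}, Loaded D s c → (natReg 2).eval s = corner D c.halfEdge := fun h =>
    h.corner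
  refine .seq (.setReal ?_)
  rw [hx s hl, e2 hl]
  have hl' : Loaded D (s.setReal 0 (corner D c.halfEdge) (z 0)) c :=
    hl.congr (fun _ _ => rfl) (setReal_real_of_ne _ _ _ (by decide))
  refine .setReal ?_
  rw [hy _ hl', e2 hl']
  refine ⟨hl'.congr (fun _ _ => rfl) (setReal_real_of_ne _ _ _ (by decide)), h.input, h.visited,
    h.height, h.stored.congr (fun _ _ _ _ => rfl) fun k _ a ha => ?_, fun v => ?_⟩
  · have : a ≠ 0 ∧ a ≠ 1 := by
      simp at ha
      omega
    rw [setReal_real_of_ne _ _ _ this.2, setReal_real_of_ne _ _ _ this.1]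
  · obtain ⟨p0, p1⟩ := h.positions v
    by_cases hv : v = corner D c.halfEdge
    · subst hv
      simp [setReal_real]
    · rw [Function.update_of_ne hv, ← p0, ← p1]
      have : (v : ℕ) ≠ corner D c.halfEdge := fun e => hv (Fin.ext e)
      simp [setReal_real, this]

end Loading

/-! ### The search loop and its running time. -/

section Search

open RealRAM

variable {n m f : ℕ} {D : EdgeList n m f} {s s' : Memory} {W : Finset (Fin f)} {l : List (Call m)}
  {p : Fin n → Plane} {c : Call m}

/-- Place the corner over a short edge and call the search for the two other sides. -/
def unitStep : Program :=
  .seq (place (.add (.add (realReg 0) (realReg 6)) (realReg 8))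
    (.add (.add (realReg 1) (realReg 7)) (realReg 9))) <|
  .seq (push (natReg 8) (.const 0) (.sub (.const 1) (natReg 6)) (.add (realReg 0) (realReg 6))
    (.add (realReg 1) (realReg 7)) (realReg 5) (.add (realReg 3) (realReg 4))
    (.div (.sub (.const 0) (realReg 4)) (.const 6)))
  (push (natReg 7) (.const 1) (natReg 6) (realReg 0) (realReg 1) (realReg 2) (realReg 3) (realReg 4))

/-- Place the corner over a long edge and call the search for the two other sides. -/
def longStep : Program :=
  .seq (place (.add (realReg 0) (realReg 8)) (.add (realReg 1) (realReg 9))) <|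
  .seq (push (natReg 8) (.const 0) (natReg 6) (.add (realReg 0) (realReg 8))
    (.add (realReg 1) (realReg 9)) (realReg 2) (.add (realReg 3) (.mul (.const 2) (realReg 4)))
    (.div (realReg 4) (.const 6)))
  (push (natReg 7) (.const 0) (natReg 6) (realReg 0) (realReg 1) (realReg 5)
    (.add (realReg 3) (.mul (.const 5) (realReg 4))) (.div (realReg 4) (.const 6)))

theorem Loaded.natReg_six (h : Loaded D s c) : (natReg 6).eval s = c.forward.toNat := h.forward

theorem Loaded.natReg_seven (h : Loaded D s c) :
    (natReg 7).eval s = leftSide D c.forward c.halfEdge := h.left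

theorem Loaded.natReg_eight (h : Loaded D s c) :
    (natReg 8).eval s = rightSide D c.forward c.halfEdge := h.right

theorem Loaded.realReg_eval (h : Loaded D s c) :
    (realReg 0).eval s = c.pos 0 ∧ (realReg 1).eval s = c.pos 1 ∧ (realReg 2).eval s = c.φ ∧
    (realReg 3).eval s = c.a ∧ (realReg 4).eval s = c.d ∧ (realReg 5).eval s = c.a + 4 * c.d ∧
    (realReg 6).eval s = dir c.φ 0 ∧ (realReg 7).eval s = dir c.φ 1 ∧
    (realReg 8).eval s = dir (c.a + 4 * c.d) 0 ∧ (realReg 9).eval s = dir (c.a + 4 * c.d) 1 :=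
  ⟨h.pos_zero, h.pos_one, h.φ, h.a, h.d, h.ψ, h.dir_zero, h.dir_one, h.dir_zero', h.dir_one'⟩

/-- The right side is pushed first, so the left side is searched first, in the order of `Traverse`.
The right call has the reversed orientation of a mirrored polygon. -/
theorem halts_unitStep (hl : Loaded D s c) (h : Represents D s W l p) :
    Halts unitStep s fun s' => Represents D s' W
      (⟨leftSide D c.forward c.halfEdge, true, c.forward, c.pos, c.φ, c.a, c.d⟩ ::
        ⟨rightSide D c.forward c.halfEdge, false, !c.forward, c.pos + dir c.φ, c.a + 4 * c.d,
          c.a + c.d, -c.d / 6⟩ :: l)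
      (Function.update p (corner D c.halfEdge) (c.pos + dir c.φ + dir (c.a + 4 * c.d))) := by
  refine .seq ((halts_place (c := c)
    (z := c.pos + dir c.φ + dir (c.a + 4 * c.d)) (fun s hs => ?_) (fun s hs => ?_) hl h).mono fun s₁ h₁ => ?_)
  · obtain ⟨e0, e1, e2, e3, e4, e5, e6, e7, e8, e9⟩ := hs.realReg_eval
    simp only [RealExpr.eval, e0, e6, e8, PiLp.add_apply]
  · obtain ⟨e0, e1, e2, e3, e4, e5, e6, e7, e8, e9⟩ := hs.realReg_eval
    simp only [RealExpr.eval, e1, e7, e9, PiLp.add_apply]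
  refine .seq ((halts_push (L := fun s => Loaded D s c) (c := ⟨rightSide D c.forward c.halfEdge,
    false, !c.forward, c.pos + dir c.φ, c.a + 4 * c.d, c.a + c.d, -c.d / 6⟩)
    (fun _ _ h h1 h2 _ => h.congr h1 h2) (fun s hs => hs.natReg_eight) (fun _ _ => rfl)
    (fun s hs => ?_) (fun s hs => ?_) (fun s hs => ?_) (fun s hs => ?_) (fun s hs => ?_)
    (fun s hs => ?_) h₁.1 h₁.2).mono fun s₂ h₂ => ?_)
  · simp only [NatExpr.eval, hs.natReg_six]
    cases c.forward <;> rfl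
  · obtain ⟨e0, e1, e2, e3, e4, e5, e6, e7, e8, e9⟩ := hs.realReg_eval
    simp only [RealExpr.eval, e0, e6, PiLp.add_apply]
  · obtain ⟨e0, e1, e2, e3, e4, e5, e6, e7, e8, e9⟩ := hs.realReg_eval
    simp only [RealExpr.eval, e1, e7, PiLp.add_apply]
  · exact hs.ψ
  · obtain ⟨e0, e1, e2, e3, e4, e5, e6, e7, e8, e9⟩ := hs.realReg_eval
    simp only [RealExpr.eval, e3, e4]
  · obtain ⟨e0, e1, e2, e3, e4, e5, e6, e7, e8, e9⟩ := hs.realReg_eval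
    simp [RealExpr.eval, e4]
  exact (halts_push (L := fun s => Loaded D s c) (c := ⟨leftSide D c.forward c.halfEdge, true,
    c.forward, c.pos, c.φ, c.a, c.d⟩) (fun _ _ h h1 h2 _ => h.congr h1 h2)
    (fun s hs => hs.natReg_seven) (fun _ _ => rfl) (fun s hs => hs.natReg_six)
    (fun s hs => hs.realReg_eval.1) (fun s hs => hs.realReg_eval.2.1) (fun s hs => hs.realReg_eval.2.2.1) (fun s hs => hs.realReg_eval.2.2.2.1)
    (fun s hs => hs.realReg_eval.2.2.2.2.1) h₂.1 h₂.2).mono fun s₃ h₃ => h₃.2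

theorem halts_longStep (hl : Loaded D s c) (h : Represents D s W l p) :
    Halts longStep s fun s' => Represents D s' W
      (⟨leftSide D c.forward c.halfEdge, false, c.forward, c.pos, c.a + 4 * c.d, c.a + 5 * c.d,
          c.d / 6⟩ ::
        ⟨rightSide D c.forward c.halfEdge, false, c.forward, c.pos + dir (c.a + 4 * c.d), c.φ,
          c.a + 2 * c.d, c.d / 6⟩ :: l)
      (Function.update p (corner D c.halfEdge) (c.pos + dir (c.a + 4 * c.d))) := by
  refine .seq ((halts_place (c := c)
    (z := c.pos + dir (c.a + 4 * c.d)) (fun s hs => ?_) (fun s hs => ?_) hl h).mono fun s₁ h₁ => ?_)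
  · obtain ⟨e0, e1, e2, e3, e4, e5, e6, e7, e8, e9⟩ := hs.realReg_eval
    simp only [RealExpr.eval, e0, e8, PiLp.add_apply]
  · obtain ⟨e0, e1, e2, e3, e4, e5, e6, e7, e8, e9⟩ := hs.realReg_eval
    simp only [RealExpr.eval, e1, e9, PiLp.add_apply]
  refine .seq ((halts_push (L := fun s => Loaded D s c) (c := ⟨rightSide D c.forward c.halfEdge,
    false, c.forward, c.pos + dir (c.a + 4 * c.d), c.φ, c.a + 2 * c.d, c.d / 6⟩)
    (fun _ _ h h1 h2 _ => h.congr h1 h2) (fun s hs => hs.natReg_eight) (fun _ _ => rfl)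
    (fun s hs => hs.natReg_six) (fun s hs => ?_) (fun s hs => ?_) (fun s hs => hs.realReg_eval.2.2.1)
    (fun s hs => ?_) (fun s hs => ?_) h₁.1 h₁.2).mono fun s₂ h₂ => ?_)
  · obtain ⟨e0, e1, e2, e3, e4, e5, e6, e7, e8, e9⟩ := hs.realReg_eval
    simp only [RealExpr.eval, e0, e8, PiLp.add_apply]
  · obtain ⟨e0, e1, e2, e3, e4, e5, e6, e7, e8, e9⟩ := hs.realReg_eval
    simp only [RealExpr.eval, e1, e9, PiLp.add_apply]
  · obtain ⟨e0, e1, e2, e3, e4, e5, e6, e7, e8, e9⟩ := hs.realReg_eval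
    simp [RealExpr.eval, e3, e4]
  · obtain ⟨e0, e1, e2, e3, e4, e5, e6, e7, e8, e9⟩ := hs.realReg_eval
    simp [RealExpr.eval, e4]
  refine (halts_push (L := fun s => Loaded D s c) (c := ⟨leftSide D c.forward c.halfEdge, false,
    c.forward, c.pos, c.a + 4 * c.d, c.a + 5 * c.d, c.d / 6⟩)
    (fun _ _ h h1 h2 _ => h.congr h1 h2)
    (fun s hs => hs.natReg_seven) (fun _ _ => rfl) (fun s hs => hs.natReg_six)
    (fun s hs => hs.realReg_eval.1) (fun s hs => hs.realReg_eval.2.1) (fun s hs => hs.realReg_eval.2.2.2.2.2.1) (fun s hs => ?_)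
    (fun s hs => ?_) h₂.1 h₂.2).mono fun s₃ h₃ => h₃.2
  · obtain ⟨e0, e1, e2, e3, e4, e5, e6, e7, e8, e9⟩ := hs.realReg_eval
    simp [RealExpr.eval, e3, e4]
  · obtain ⟨e0, e1, e2, e3, e4, e5, e6, e7, e8, e9⟩ := hs.realReg_eval
    simp [RealExpr.eval, e4]

/-- Carry out the call on top of the stack. -/
def step : Program :=
  .seq pop <| .cond (.natEq (.get 8 (.get 5 (natReg 1))) (.const 0))
    (.seq mark <| .seq loadNat <| .seq loadReal <|
      .cond (.natEq (natReg 5) (.const 0)) unitStep longStep)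
    .skip

theorem halts_step (h : Represents D s W (c :: l) p) : Halts step s fun s' =>
    D.face c.halfEdge ∈ W ∧ Represents D s' W l p ∨
    D.face c.halfEdge ∉ W ∧ c.long = false ∧ Represents D s' (insert (D.face c.halfEdge) W)
      (⟨leftSide D c.forward c.halfEdge, true, c.forward, c.pos, c.φ, c.a, c.d⟩ ::
        ⟨rightSide D c.forward c.halfEdge, false, !c.forward, c.pos + dir c.φ, c.a + 4 * c.d,
          c.a + c.d, -c.d / 6⟩ :: l)
      (Function.update p (corner D c.halfEdge) (c.pos + dir c.φ + dir (c.a + 4 * c.d))) ∨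
    D.face c.halfEdge ∉ W ∧ c.long = true ∧ Represents D s' (insert (D.face c.halfEdge) W)
      (⟨leftSide D c.forward c.halfEdge, false, c.forward, c.pos, c.a + 4 * c.d, c.a + 5 * c.d,
          c.d / 6⟩ ::
        ⟨rightSide D c.forward c.halfEdge, false, c.forward, c.pos + dir (c.a + 4 * c.d), c.φ,
          c.a + 2 * c.d, c.d / 6⟩ :: l)
      (Function.update p (corner D c.halfEdge) (c.pos + dir (c.a + 4 * c.d))) := by
  refine .seq ((halts_pop h).mono fun s₁ ⟨h1, h2, h3⟩ => ?_)
  have hv : (NatExpr.get 8 (.get 5 (natReg 1))).eval s₁ =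
      if D.face c.halfEdge ∈ W then 1 else 0 := by
    simp only [NatExpr.eval, natReg]
    rw [h1, h3.face, h3.visited]
  refine .cond (fun hb => ?_) fun hb => .skip (.inl ⟨?_, h3⟩)
  · have hb' : (NatExpr.get 8 (.get 5 (natReg 1))).eval s₁ = 0 := hb
    rw [hv] at hb'
    have hW : D.face c.halfEdge ∉ W := fun hW => by simp [hW] at hb'
    refine .seq ((halts_mark h1 h2 h3).mono fun s₂ ⟨h4, h5, h6⟩ => .seq
      ((halts_loadNat h4 h5 h6).mono fun s₃ ⟨h7, h8, h9⟩ => .seq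
        ((halts_loadReal h7 h8 h9).mono fun s₄ ⟨h10, h11⟩ => ?_)))
    refine .cond (fun hc => ?_) fun hc => ?_
    · have hc' : s₄.nat 12 5 = 0 := hc
      rw [h10.long] at hc'
      exact (halts_unitStep h10 h11).mono fun s₅ h12 => .inr (.inl ⟨hW, by simpa using hc', h12⟩)
    · have hc' : ¬ s₄.nat 12 5 = 0 := hc
      rw [h10.long] at hc'
      exact (halts_longStep h10 h11).mono fun s₅ h12 => .inr (.inr ⟨hW, by simpa using hc', h12⟩)
  · have hb' : ¬ (NatExpr.get 8 (.get 5 (natReg 1))).eval s₁ = 0 := hb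
    rw [hv] at hb'
    by_contra hW
    simp [hW] at hb'

/-- The stack is not empty. -/
def pending : Test := .natLt (.const 0) height

/-- Carry out the calls on the stack. -/
def search : Program := .loop pending step

/-- Positions after a list of assignments. -/
noncomputable def assign (p : Fin n → Plane) (L : List (Fin n × Plane)) : Fin n → Plane :=
  L.foldl (fun p x => Function.update p x.1 x.2) p

/-- The loop has no recursive structure of its own, so handling the top call is stated with a
continuation: any run from the resulting memory extends backwards. The induction is on the number of
unvisited faces, which drops before both subcalls. -/
theorem exec_search (k : ℕ) {W : Finset (Fin f)} (hk : Wᶜ.card = k) {b o : Bool} {h : Fin m}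
    {q : Plane} {φ a d : ℝ} {l : List (Call m)} {p : Fin n → Plane} {s : Memory}
    (hs : Represents D s W (⟨h, b, o, q, φ, a, d⟩ :: l) p) :
    ∃ (W' : Finset (Fin f)) (T : Hang (Fin n) b) (t : ℕ) (s' : Memory),
      Traverse D W b o h W' T ∧
      (∀ t' s'', Exec search s' t' s'' → Exec search s (t + t') s'') ∧
      t ≤ (pending.cost + maxCost step) * (2 * T.nodes.length + 1) ∧
      Represents D s' W' l (assign p (T.layout q φ a d)) := by
  induction k using Nat.strong_induction_on generalizing W b o h q φ a d l p s with
  | _ k ih =>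
  obtain ⟨t, s₁, he, ht, hcase⟩ := halts_step hs
  have hpend : pending.holds s := by
    change 0 < s.nat 12 0
    rw [hs.height]
    simp
  have first : ∀ t' s'', Exec search s₁ t' s'' → Exec search s (pending.cost + t + t') s'' :=
    fun t' s'' h => .loop_true hpend he h
  have lt : D.face h ∉ W → ∀ W' : Finset (Fin f), insert (D.face h) W ⊆ W' → W'ᶜ.card < k := by
    intro hW W' hsub
    rw [← hk]
    refine Finset.card_lt_card ((Finset.ssubset_iff_of_subset ?_).2 ⟨D.face h, ?_, ?_⟩)
    · exact Finset.compl_subset_compl.2 ((Finset.subset_insert _ _).trans hsub)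
    · simpa using hW
    · simpa using hsub (Finset.mem_insert_self _ _)
  rcases hcase with ⟨hW, hr⟩ | ⟨hW, rfl, hr⟩ | ⟨hW, rfl, hr⟩
  · refine ⟨W, .leaf b, _, s₁, .skip hW, first, ?_, hr⟩
    simp only [Hang.nodes, List.length_nil, mul_zero, zero_add, mul_one]
    omega
  · obtain ⟨W₁, T₁, t₁, s₂, tr₁, ex₁, c₁, r₁⟩ := ih _ (lt hW _ subset_rfl) rfl hr
    obtain ⟨W₂, T₂, t₂, s₃, tr₂, ex₂, c₂, r₂⟩ := ih _
      (lt hW _ ((Finset.subset_insert _ _).trans tr₁.subset)) rfl r₁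
    refine ⟨W₂, .unit (corner D h) T₁ T₂, pending.cost + t + (t₁ + t₂), s₃, .unit hW tr₁ tr₂,
      fun t' s'' hx => ?_, ?_, ?_⟩
    · have := first _ _ (ex₁ _ _ (ex₂ _ _ hx))
      rwa [← add_assoc t₁, ← add_assoc] at this
    · simp only [Hang.nodes, List.length_cons, List.length_append]
      nlinarith
    · simpa only [Hang.layout, assign, List.foldl_cons, List.foldl_append] using r₂
  · obtain ⟨W₁, T₁, t₁, s₂, tr₁, ex₁, c₁, r₁⟩ := ih _ (lt hW _ subset_rfl) rfl hr
    obtain ⟨W₂, T₂, t₂, s₃, tr₂, ex₂, c₂, r₂⟩ := ih _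
      (lt hW _ ((Finset.subset_insert _ _).trans tr₁.subset)) rfl r₁
    refine ⟨W₂, .long (corner D h) T₁ T₂, pending.cost + t + (t₁ + t₂), s₃, .long hW tr₁ tr₂,
      fun t' s'' hx => ?_, ?_, ?_⟩
    · have := first _ _ (ex₁ _ _ (ex₂ _ _ hx))
      rwa [← add_assoc t₁, ← add_assoc] at this
    · simp only [Hang.nodes, List.length_cons, List.length_append]
      nlinarith
    · simpa only [Hang.layout, assign, List.foldl_cons, List.foldl_append] using r₂

/-- Mark the outer face, place an edge of the outer face, and call the search for the face on its
other side. -/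
def start : Program :=
  .seq (.setNat 8 (.get 0 (.const 3)) (.const 1)) <|
  .seq (.setNat 12 (.const 1) (.get 7 (.get 0 (.const 3)))) <|
  .seq (.setReal 0 (.get 1 (.get 2 (natReg 1))) (.const 1)) <|
  push (.get 2 (natReg 1)) (.const 0) (.const 0) (.const 0) (.const 0) (.const 0) (.const 1)
    (.const 1)

theorem dir_zero_coords : dir 0 0 = 1 ∧ dir 0 1 = 0 := by
  rw [dir_one, dir_zero]
  norm_num

theorem halts_start (D : EdgeList n m f) : Halts start D.toMemory fun s' =>
    Represents D s' {D.outer}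
      [⟨D.twin (D.faceEdge D.outer), false, false, 0, 0, 1, 1⟩]
      (Function.update 0 (D.origin (D.twin (D.faceEdge D.outer))) (dir 0)) := by
  set o := D.faceEdge D.outer with ho
  refine .seq (.setNat (.seq (.setNat (.seq (.setReal ?_)))))
  have v1 : (NatExpr.get 0 (.const 3)).eval D.toMemory = D.outer := rfl
  simp only [v1, show ∀ i s, (NatExpr.const i).eval s = i from fun _ _ => rfl]
  set s₁ := D.toMemory.setNat 8 D.outer 1 with hs₁
  have v2 : (NatExpr.get 7 (.get 0 (.const 3))).eval s₁ = o := by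
    change s₁.nat 7 (s₁.nat 0 3) = o
    rw [hs₁, setNat_nat_of_ne _ _ _ (by decide), setNat_nat_of_ne _ _ _ (by decide)]
    exact toArray_val D.faceEdge D.outer
  rw [v2]
  set s₂ := s₁.setNat 12 1 o with hs₂
  have input : ∀ a < 8, s₂.nat a = D.toMemory.nat a := by
    intro a ha
    rw [hs₂, setNat_nat_of_ne _ _ _ (by omega), hs₁, setNat_nat_of_ne _ _ _ (by omega)]
  have reg : s₂.nat 12 1 = o := by simp [hs₂, setNat_nat]
  have v3 : (NatExpr.get 1 (.get 2 (natReg 1))).eval s₂ = D.origin (D.twin o) := by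
    change s₂.nat 1 (s₂.nat 2 (s₂.nat 12 1)) = _
    rw [reg, input 1 (by omega), input 2 (by omega)]
    refine (congrArg (D.toMemory.nat 1) (toArray_val D.twin o)).trans (toArray_val D.origin _)
  have v4 : (RealExpr.const 1).eval s₂ = 1 := Rat.cast_one
  rw [v3, v4]
  -- A single write suffices: all other coordinates, the empty stack height and the marks of the
  -- inner faces are the initial zeros.
  have hrep : Represents D (s₂.setReal 0 (D.origin (D.twin o)) 1) {D.outer} []
      (Function.update 0 (D.origin (D.twin o)) (dir 0)) := by
    refine ⟨input, fun i => ?_, ?_, trivial, fun v => ?_⟩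
    · simp only [setReal_nat, hs₂, hs₁, setNat_nat, Finset.mem_singleton, Fin.ext_iff]
      simp [EdgeList.toMemory]
    · simp [setReal_nat, hs₂, hs₁, setNat_nat, EdgeList.toMemory]
    · obtain ⟨d0, d1⟩ := dir_zero_coords
      by_cases hv : v = D.origin (D.twin o)
      · subst hv
        simp [setReal_real, hs₂, hs₁, setNat_real, EdgeList.toMemory, d0, d1]
      · have : (v : ℕ) ≠ D.origin (D.twin o) := fun e => hv (Fin.ext e)
        simp [setReal_real, hs₂, hs₁, setNat_real, EdgeList.toMemory, hv, this]
  refine (halts_push (s := s₂.setReal 0 (D.origin (D.twin o)) 1)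
    (L := fun s => s.nat 12 1 = o ∧ s.nat 2 = D.toMemory.nat 2)
    (c := ⟨D.twin o, false, false, 0, 0, 1, 1⟩) (fun s s' hs h1 _ h3 => ?_) (fun s hs => ?_)
    (fun _ _ => rfl) (fun _ _ => rfl) (fun _ _ => Rat.cast_zero) (fun _ _ => Rat.cast_zero)
    (fun _ _ => Rat.cast_zero) (fun _ _ => Rat.cast_one) (fun _ _ => Rat.cast_one)
    ⟨reg, input 2 (by omega)⟩ hrep).mono fun s₃ h₃ => h₃.2
  · exact ⟨(h1 1 one_ne_zero).trans hs.1, (h3 2 (by omega)).trans hs.2⟩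
  · change s.nat 2 (s.nat 12 1) = _
    rw [hs.1, hs.2]
    exact toArray_val D.twin o

theorem assign_of_notMem (p : Fin n → Plane) (L : List (Fin n × Plane)) {v : Fin n}
    (hv : v ∉ L.map Prod.fst) : assign p L v = p v := by
  induction L generalizing p with
  | nil => rfl
  | cons x L ih =>
    rw [List.map_cons, List.mem_cons, not_or] at hv
    exact (ih _ hv.2).trans (Function.update_of_ne hv.1 _ _)

theorem assign_of_mem (p : Fin n → Plane) (L : List (Fin n × Plane)) (hL : (L.map Prod.fst).Nodup)
    {x : Fin n × Plane} (hx : x ∈ L) : assign p L x.1 = x.2 := by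
  induction L generalizing p with
  | nil => simp at hx
  | cons y L ih =>
    rw [List.map_cons, List.nodup_cons] at hL
    rcases List.mem_cons.1 hx with rfl | hx
    · exact (assign_of_notMem _ L hL.1).trans (Function.update_self ..)
    · exact ih _ hL.2 hx

/-- The drawing program. -/
def drawing : Program := .seq start search

theorem exec_drawing {G : SimpleGraph (Fin n)} (hG : IsMaximalOuterplanar G)
    (hD : D.IsOuterplanarEmbedding G) : ∃ (t : ℕ) (s : Memory), Exec drawing D.toMemory t s ∧
      t ≤ (maxCost start + 2 * (pending.cost + maxCost step) + pending.cost) * n ∧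
      IsPlanarDrawing G (s.positions n) ∧ drawingRatio G (s.positions n) < 2 := by
  obtain ⟨t, s₁, he, ht, hr⟩ := halts_start D
  -- The initial stack has one call, so after it the stack is empty and the loop test fails.
  obtain ⟨W', T, t₁, s₂, tr, ex, c₁, r₁⟩ := exec_search _ rfl hr
  have hend : ¬ pending.holds s₂ := by
    change ¬ 0 < s₂.nat 12 0
    rw [r₁.height]
    simp
  obtain ⟨hnd, hall, hE, hlen⟩ := tr.complete hD hG (hD.face_faceEdge _)
  refine ⟨_, s₂, .seq he (ex _ _ (.loop_false hend)), ?_, ?_⟩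
  · have h1 : maxCost start ≤ maxCost start * n :=
      Nat.le_mul_of_pos_right _ (by have := two_le_card hD; omega)
    have h2 : pending.cost ≤ pending.cost * n :=
      Nat.le_mul_of_pos_right _ (by have := two_le_card hD; omega)
    have h3 : (pending.cost + maxCost step) * (2 * T.nodes.length + 1) ≤
        (pending.cost + maxCost step) * (2 * n) := Nat.mul_le_mul_left _ (by omega)
    calc _ ≤ maxCost start * n + ((pending.cost + maxCost step) * (2 * n) + pending.cost * n) := by
          omega
      _ = _ := by ring
  · have hpos : s₂.positions n = assign (Function.update 0 (D.origin (D.twin (D.faceEdge D.outer)))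
        (dir 0)) (T.layout 0 0 1 1) := by
      funext v
      obtain ⟨p0, p1⟩ := r₁.positions v
      exact plane_ext p0 p1
    rw [List.nodup_cons, List.nodup_cons, List.mem_cons, not_or] at hnd
    obtain ⟨⟨n1, n2⟩, n3, n4⟩ := hnd
    rw [hpos]
    refine T.drawing hall hE ?_ ?_ fun x hx => ?_
    · rw [assign_of_notMem _ _ (by rwa [T.layout_fst]), Function.update_of_ne n1]
      rfl
    · rw [assign_of_notMem _ _ (by rwa [T.layout_fst]), Function.update_self]
    · exact assign_of_mem _ _ (by rwa [T.layout_fst]) hx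

end Search

end OuterplanarDrawing

theorem theorem1 :
    -- every outerplanar graph has a planar straight-line drawing of ratio less than 2
    (∀ (V : Type*) [Finite V] (G : SimpleGraph V), IsOuterplanar G →
      (∃ p : V → Plane, IsPlanarDrawing G p ∧ drawingRatio G p < 2) ∧
        planarEdgeLengthRatio G < 2) ∧
    -- for maximal outerplanar graphs one is computed in linear time by a fixed program
    (∃ (P : RealRAM.Program) (C : ℕ),
      ∀ (n m f : ℕ) (G : SimpleGraph (Fin n)) (D : EdgeList n m f),
        IsMaximalOuterplanar G → D.IsOuterplanarEmbedding G →
        ∃ (t : ℕ) (s : RealRAM.Memory), RealRAM.Exec P D.toMemory t s ∧ t ≤ C * n ∧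
          IsPlanarDrawing G (s.positions n) ∧ drawingRatio G (s.positions n) < 2) ∧
    -- the bound 2 is tight, already for the fans with pendant triangles
    (∀ ε : ℝ, 0 < ε → ∃ k : ℕ, IsMaximalOuterplanar (pendantFan k) ∧
      ENNReal.ofReal (2 - ε) < planarEdgeLengthRatio (pendantFan k)) := by
  refine ⟨fun V _ G h => ⟨OuterplanarDrawing.IsOuterplanar.exists_drawing h,
    OuterplanarDrawing.IsOuterplanar.planarEdgeLengthRatio_lt h⟩,
    ⟨OuterplanarDrawing.drawing, _, fun n m f G D hG hD => OuterplanarDrawing.exec_drawing hG hD⟩,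
    fun ε hε => OuterplanarDrawing.exists_lt_planarEdgeLengthRatio_pendantFan hε⟩
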